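/- **Theorem (CAT(0) disc diagram).** *Metrically systolic complexes.* A metric simplicial complex is a flag simplicial complex $X$ whose $2$-skeleton carries a metric in which every triangle is isometric to a (nondegenerate) Euclidean triangle, such that for every vertex $v$ and all pairwise adjacent vertices $v_1,v_2,v_3$ adjacent to $v$ one has $\angle_v(v_1,v_3)\le\angle_v(v_1,v_2)+\angle_v(v_2,v_3)$, where $\angle_v(a,b)$ is the angle at $v$ of the triangle $vab$. The angular length of a cycle in the link of $v$ is the sum of the angles $\angle_v(a,b)$ over its edges $ab$. A simple $k$-cycle, $k\ge 4$, is $2$-full if no two of its vertices having a common neighbour in the cycle are joined by an edge. $X$ is metrically systolic if it is simply connected (in particular connected) and every $2$-full simple cycle in the link of a vertex has angular length at least $2\pi$. *Diagrams.* A singular disc $D$ is a simplicial complex isomorphic to a finite connected and simply connected subcomplex of a triangulation of the plane. A singular disc diagram for a cycle (closed edge path) $C$ in $X$ is a simplicial map $f\colon D\to X$ from a singular disc taking the boundary cycle of $D$ to $C$. Its area is the number of triangles of $D$; it is minimal if its area is least among all singular disc diagrams for $C$. It is nondegenerate if $f$ is injective on every simplex, and reduced if distinct triangles of $D$ sharing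 an edge have distinct images. A nondegenerate diagram is CAT(0) if, for the angles pulled back from $X$, the link of every internal vertex of $D$ (a vertex whose link is a cycle) has angular length at least $2\pi$. *Moves* on a diagram $f\colon D\to X$. * A-move: if $u,v,w$ are pairwise adjacent vertices of $D$ not spanning a triangle of $D$, remove all vertices inside the region bounded by the edges between them (with all simplices containing them) and add the triangle $uvw$. The other moves are performed only if every three pairwise adjacent vertices of $D$ span a triangle. * B-move: if $uvw$, $uvz$ are distinct triangles of $D$ with $f(w)=f(z)$, replace the edge $uv$ by the edge $wz$ (so the two triangles are replaced by $uwz$ and $vwz$). * C-move: if $u_1u_2$ is an edge of $D$ with $f(u_1)=f(u_2)$, collapse it to a new vertex $u$, with $f'(u)=f(u_1)$. * D-move: if $v$ is an internal vertex of $D$, $u$ is a vertex of its link, $w,z$ are the two neighbours of $u$ in that link, and $f(w),f(z)$ are adjacent in $X$, replace the edge $uv$ by the edge $wz$ (so the triangles $uvw$, $uvz$ are replaced by $uwz$ and $vwz$). In each case the new map agrees with $f$ on the old vertices. *Statement.* Let $X$ be a metrically systolic complex, $C$ a cycle in $X$ and $f\colon D\to X$ a singular disc diagram for $C$. By finitely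 many A-, B-, C- and D-moves, through singular disc diagrams for $C$, the diagram can be changed into a CAT(0), nondegenerate, reduced singular disc diagram $f'\colon D'\to X$ for $C$ such that 1. there is an injective map $i$ from the vertex set of $D'$ to the vertex set of $D$ with $f'=f\circ i$ on the vertex set of $D'$; 2. the number of triangles of $D'$ is at most the number of triangles of $D$. Moreover, every minimal singular disc diagram for $C$ is CAT(0), nondegenerate and reduced. -/

import Mathlib

noncomputable section

open scoped Classical

namespace MetricSystolic

universe u w

/-! ### Simplicial complexes

A simplicial complex with vertices among the elements of `V` is a `PreAbstractSimplicialComplex V`;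
an element `x : V` is a vertex of it exactly when `{x}` is a face. -/

section Complexes

variable {V : Type u} (K : PreAbstractSimplicialComplex V)

/-- The vertex set of a complex. -/
def vertices : Set V := {x | ({x} : Finset V) ∈ K.faces}

/-- The 1-skeleton of a complex, as a graph. -/
def graph : SimpleGraph V where
  Adj x y := x ≠ y ∧ ({x, y} : Finset V) ∈ K.faces
  symm := ⟨fun x y h => ⟨h.1.symm, by rw [Finset.pair_comm]; exact h.2⟩⟩
  loopless := ⟨fun _ h => h.1 rfl⟩

/-- The set of 2-simplices. -/
def triangles : Set (Finset V) := {t | t ∈ K.faces ∧ t.card = 3}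

/-- A flag complex: finitely many pairwise adjacent vertices span a simplex. -/
def IsFlag : Prop :=
  ∀ s : Finset V, s.Nonempty → (∀ x ∈ s, ∀ y ∈ s, ({x, y} : Finset V) ∈ K.faces) → s ∈ K.faces

/-- Homotopy (relative to the end points) of edge paths: the congruence generated by deleting a
backtracking and by pushing a path across a triangle. -/
inductive PathHomotopic : ∀ {x y : V}, (graph K).Walk x y → (graph K).Walk x y → Prop
  | refl {x y : V} (p : (graph K).Walk x y) : PathHomotopic p p
  | symm {x y : V} {p q : (graph K).Walk x y} : PathHomotopic p q → PathHomotopic q p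
  | trans {x y : V} {p q r : (graph K).Walk x y} :
      PathHomotopic p q → PathHomotopic q r → PathHomotopic p r
  | cons {x y z : V} (h : (graph K).Adj x y) {p q : (graph K).Walk y z} :
      PathHomotopic p q → PathHomotopic (.cons h p) (.cons h q)
  | backtrack {x y z : V} (h : (graph K).Adj x y) (p : (graph K).Walk x z) :
      PathHomotopic (.cons h (.cons h.symm p)) p
  | triangle {x y z t : V} (hxy : (graph K).Adj x y) (hyz : (graph K).Adj y z)
      (hxz : (graph K).Adj x z) (hf : ({x, y, z} : Finset V) ∈ K.faces)
      (p : (graph K).Walk z t) :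
      PathHomotopic (.cons hxy (.cons hyz p)) (.cons hxz p)

/-- Simple connectedness: the complex is nonempty and connected, and its edge path group is
trivial. -/
structure IsSimplyConnected : Prop where
  nonempty : (vertices K).Nonempty
  connected : ∀ x ∈ vertices K, ∀ y ∈ vertices K, (graph K).Reachable x y
  trivial_loops : ∀ (x : V) (c : (graph K).Walk x x), PathHomotopic K c .nil

/-- The link of the vertex `a` is the (triangulated) circle with the consecutive vertices
`c 0, c 1, …, c (k - 1)`. Here `finRotate k i` is the cyclic successor of `i`. -/
structure IsLinkCycle (a : V) {k : ℕ} (c : Fin k → V) : Prop where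
  three_le : 3 ≤ k
  injective : Function.Injective c
  ne : ∀ i, c i ≠ a
  mem_faces_iff : ∀ s : Finset V, a ∈ s →
    (s ∈ K.faces ↔ s = {a} ∨ ∃ i, s = {a, c i} ∨ s = {a, c i, c (finRotate k i)})

/-- An internal vertex of a surface complex: its link is a cycle. -/
def IsInterior (a : V) : Prop := ∃ (k : ℕ) (c : Fin k → V), IsLinkCycle K a c

/-- A triangulation of the plane, combinatorially: a surface complex without boundary
(every vertex link is a circle) that is simply connected and non-compact. -/
structure IsPlaneTriangulation : Prop where
  simplyConnected : IsSimplyConnected K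
  infinite : (vertices K).Infinite
  interior : ∀ a ∈ vertices K, IsInterior K a

/-- A singular disc: a finite connected and simply connected complex that is isomorphic (via `e`)
to a subcomplex of a triangulation of the plane. -/
structure IsSingularDisc : Prop where
  finite : K.faces.Finite
  simplyConnected : IsSimplyConnected K
  planar : ∃ (P : Type u) (T : PreAbstractSimplicialComplex P) (e : V → P),
    IsPlaneTriangulation T ∧ Set.InjOn e (vertices K) ∧ K.map e ≤ T

/-- The closed edge path `c` is a boundary cycle of the singular disc `K`. Every edge has two sides
in the plane, each of which is occupied by a triangle of `K` or is passed once by `c`: so `c` runs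
once through the edges lying in one triangle, twice (once in each direction) through the edges
lying in no triangle, and not at all through the others. -/
def IsBoundaryCycle {p : V} (c : (graph K).Walk p p) : Prop :=
  p ∈ vertices K ∧ ∀ x y, (graph K).Adj x y →
    c.edges.count s(x, y) + {t | t ∈ triangles K ∧ x ∈ t ∧ y ∈ t}.ncard = 2

/-- There are three pairwise adjacent vertices that do not bound a triangle. -/
def HasEmptyTriangle : Prop :=
  ∃ a b c : V, (graph K).Adj a b ∧ (graph K).Adj b c ∧ (graph K).Adj a c ∧
    ({a, b, c} : Finset V) ∉ K.faces

/-- The vertex `x` lies strictly inside the region of the singular disc `K` bounded by the edges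
between `a, b, c`: it cannot be joined to the boundary of `K` off `a, b, c`. -/
def IsEnclosed (a b c x : V) : Prop :=
  x ∈ vertices K ∧ x ≠ a ∧ x ≠ b ∧ x ≠ c ∧
    ∀ y ∈ vertices K, ¬ IsInterior K y → ∀ p : (graph K).Walk x y,
      a ∈ p.support ∨ b ∈ p.support ∨ c ∈ p.support

/-- The faces of the complex obtained by removing the edge `ab`, common to the triangles `abc` and
`abd`, and adding the edge `cd`, with the triangles `acd` and `bcd`. -/
def flipFaces (a b c d : V) : Set (Finset V) :=
  {s | s ∈ K.faces ∧ ¬ (a ∈ s ∧ b ∈ s)} ∪ {{c, d}, {a, c, d}, {b, c, d}}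

end Complexes

/-! ### Metric simplicial complexes -/

/-- The angle, opposite to the side of length `c`, of a Euclidean triangle with side lengths
`a, b, c` (law of cosines). -/
def euclideanAngle (a b c : ℝ) : ℝ := Real.arccos ((a ^ 2 + b ^ 2 - c ^ 2) / (2 * a * b))

/-- A metric simplicial complex: a flag complex with a piecewise Euclidean metric on the
2-skeleton, recorded by the lengths of edges, which are the side lengths of (nondegenerate)
Euclidean triangles; the angles at each vertex satisfy the weak triangle inequality. -/
structure MetricComplex (W : Type w) where
  complex : PreAbstractSimplicialComplex W
  flag : IsFlag complex
  len : Sym2 W → ℝ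
  len_pos : ∀ x y, (graph complex).Adj x y → 0 < len s(x, y)
  len_lt : ∀ x y z, (graph complex).Adj x y → (graph complex).Adj y z → (graph complex).Adj x z →
    len s(x, z) < len s(x, y) + len s(y, z)
  angle_le : ∀ a x y z, (graph complex).Adj a x → (graph complex).Adj a y →
    (graph complex).Adj a z → (graph complex).Adj x y → (graph complex).Adj y z →
    (graph complex).Adj x z →
    euclideanAngle (len s(a, x)) (len s(a, z)) (len s(x, z)) ≤
      euclideanAngle (len s(a, x)) (len s(a, y)) (len s(x, y)) +
        euclideanAngle (len s(a, y)) (len s(a, z)) (len s(y, z))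

/-- The angle with apex `a` in the triangle `axy`. -/
def MetricComplex.angle {W : Type w} (X : MetricComplex W) (a x y : W) : ℝ :=
  euclideanAngle (X.len s(a, x)) (X.len s(a, y)) (X.len s(x, y))

/-- Every 2-full simple cycle in the link of the vertex `a` has angular length at least `2π`. -/
def MetricComplex.IsLinkLarge {W : Type w} (X : MetricComplex W) (a : W) : Prop :=
  ∀ (k : ℕ) (c : Fin k → W), 4 ≤ k → Function.Injective c →
    (∀ i, (graph X.complex).Adj a (c i)) →
    (∀ i, (graph X.complex).Adj (c i) (c (finRotate k i))) →
    (∀ i, ¬ (graph X.complex).Adj (c i) (c (finRotate k (finRotate k i)))) →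
    2 * Real.pi ≤ ∑ i, X.angle a (c i) (c (finRotate k i))

/-- A metrically systolic complex: simply connected and locally `2π`-large. -/
structure MetricComplex.IsMetricallySystolic {W : Type w} (X : MetricComplex W) : Prop where
  simplyConnected : IsSimplyConnected X.complex
  large : ∀ a ∈ vertices X.complex, X.IsLinkLarge a

/-! ### Singular disc diagrams -/

/-- A complex together with a map from its vertices to the vertices of another complex
(the values of `map` off the vertex set of `complex` are irrelevant). -/
structure Diagram (V : Type u) (W : Type w) where
  complex : PreAbstractSimplicialComplex V
  map : V → W

namespace Diagram

variable {V : Type u} {W : Type w} (G : Diagram V W)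

/-- `G` is a singular disc diagram for the cycle (closed edge path) `C` in `X`: a simplicial map
from a singular disc to `X` that takes the boundary cycle to `C`. -/
structure IsDiscDiagram (X : PreAbstractSimplicialComplex W) {q : W}
    (C : (graph X).Walk q q) : Prop where
  singularDisc : IsSingularDisc G.complex
  simplicial : ∀ s ∈ G.complex.faces, s.image G.map ∈ X.faces
  boundary : ∃ (p : V) (c : (graph G.complex).Walk p p),
    IsBoundaryCycle G.complex c ∧ c.support.map G.map = C.support

/-- Injective on all simplices. -/
def IsNondegenerate : Prop := ∀ s ∈ G.complex.faces, Set.InjOn G.map (s : Set V)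

/-- Distinct triangles sharing an edge are mapped to distinct triangles. -/
def IsReduced : Prop :=
  ∀ s ∈ triangles G.complex, ∀ t ∈ triangles G.complex, s ≠ t → (s ∩ t).card = 2 →
    s.image G.map ≠ t.image G.map

/-- The number of triangles. -/
def area : ℕ := (triangles G.complex).ncard

/-- A singular disc diagram for `C` of minimal area. -/
def IsMinimal (X : PreAbstractSimplicialComplex W) {q : W} (C : (graph X).Walk q q) : Prop :=
  G.IsDiscDiagram X C ∧
    ∀ (V' : Type u) (G' : Diagram V' W), G'.IsDiscDiagram X C → G.area ≤ G'.area

/-- In the metric pulled back from `X`, every vertex link that is a cycle has angular length at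
least `2π`. -/
def IsCAT0 (X : MetricComplex W) : Prop :=
  ∀ (a : V) (k : ℕ) (c : Fin k → V), IsLinkCycle G.complex a c →
    2 * Real.pi ≤ ∑ i, X.angle (G.map a) (G.map (c i)) (G.map (c (finRotate k i)))

/-! ### Moves. In each case `G'` is the result of the move performed on `G`. -/

/-- A-move on `a, b, c`: pairwise adjacent vertices not bounding a triangle; the vertices inside
the region bounded by them are removed, and the triangle `abc` takes their place. -/
def AMove (a b c : V) (G' : Diagram V W) : Prop :=
  (graph G.complex).Adj a b ∧ (graph G.complex).Adj b c ∧ (graph G.complex).Adj a c ∧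
  ({a, b, c} : Finset V) ∉ G.complex.faces ∧
  G'.complex.faces =
    {s | s ∈ G.complex.faces ∧ ∀ x ∈ s, ¬ IsEnclosed G.complex a b c x} ∪ {{a, b, c}} ∧
  ∀ x ∈ vertices G'.complex, G'.map x = G.map x

/-- B-move on `a, b`: the triangles `abc` and `abd` have `c` and `d` mapped to the same vertex; the
edge `ab` is replaced by `cd`. -/
def BMove (a b : V) (G' : Diagram V W) : Prop :=
  ¬ HasEmptyTriangle G.complex ∧
  ∃ c d : V, c ≠ d ∧ {a, b, c} ∈ triangles G.complex ∧ {a, b, d} ∈ triangles G.complex ∧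
    G.map c = G.map d ∧
    G'.complex.faces = flipFaces G.complex a b c d ∧
    ∀ x ∈ vertices G'.complex, G'.map x = G.map x

/-- C-move on `a₁, a₂`: an edge `a₁a₂` mapped to a vertex is collapsed to a new vertex `a`; as
the name of `a` one may take any name not used by another vertex. -/
def CMove (a₁ a₂ : V) (G' : Diagram V W) : Prop :=
  ¬ HasEmptyTriangle G.complex ∧
  (graph G.complex).Adj a₁ a₂ ∧ G.map a₁ = G.map a₂ ∧
  ∃ a : V, (a = a₁ ∨ a = a₂ ∨ a ∉ vertices G.complex) ∧
    G'.complex = G.complex.map (fun x => if x = a₁ ∨ x = a₂ then a else x) ∧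
    G'.map a = G.map a₁ ∧
    ∀ x ∈ vertices G'.complex, x ≠ a → G'.map x = G.map x

/-- D-move on `a, b`: `a` is an internal vertex, and the images of the two neighbours `c, d` of `b`
in the link of `a` are adjacent in `X`; the edge `ab` is replaced by `cd`. -/
def DMove (X : PreAbstractSimplicialComplex W) (a b : V) (G' : Diagram V W) : Prop :=
  ¬ HasEmptyTriangle G.complex ∧ IsInterior G.complex a ∧
  ∃ c d : V, c ≠ d ∧ {a, b, c} ∈ triangles G.complex ∧ {a, b, d} ∈ triangles G.complex ∧
    (graph X).Adj (G.map c) (G.map d) ∧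
    G'.complex.faces = flipFaces G.complex a b c d ∧
    ∀ x ∈ vertices G'.complex, G'.map x = G.map x

/-- `G'` is obtained from `G` by one A-, B-, C- or D-move. -/
def Move (X : PreAbstractSimplicialComplex W) (G G' : Diagram V W) : Prop :=
  (∃ a b c, G.AMove a b c G') ∨ (∃ a b, G.BMove a b G') ∨ (∃ a b, G.CMove a b G') ∨
    ∃ a b, G.DMove X a b G'

/-- `G'` is obtained from `G` by finitely many A-, B-, C- and D-moves, each of which produces a
singular disc diagram for `C`. -/
def MovesTo (X : PreAbstractSimplicialComplex W) {q : W} (C : (graph X).Walk q q)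
    (G G' : Diagram V W) : Prop :=
  Relation.ReflTransGen (fun H H' => Move X H H' ∧ H'.IsDiscDiagram X C) G G'

end Diagram

end MetricSystolic

end

noncomputable section

open scoped Classical

namespace MetricSystolic

universe u w

/-! ### Cocycles and simple connectedness -/

section Cocycles

variable {V : Type u} {K : PreAbstractSimplicialComplex V}

/-! It suffices that a diagram which is degenerate, not reduced or not CAT(0) can be turned by moves
into one with strictly fewer triangles (`exists_improves`): induction on the area gives the first
claim, and a minimal diagram admits no such improvement. Vertices are only ever deleted (a
contracted edge keeps the name of one end), so the map on vertices never changes and `i` can be the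
identity.

An A-move replaces a disc of at least two triangles by one triangle, and a C-move destroys the two
triangles on the collapsed edge; both lower the area. B- and D-moves flip an edge and keep the area.
After a B-move the new edge is mapped to a vertex, so that an A- or a C-move can follow. In a
nondegenerate reduced diagram without empty triangles, the link of an interior vertex `a` with angle
sum below `2π` maps to a closed path without backtracking in the link of `f a`. Largeness of that
link makes two vertices at distance two along the path adjacent in `X` (`exists_adj_finRotate`), and
a D-move at `a` is possible. By the angle inequality it does not increase the angle sum at `a`,
while it lowers the number of triangles at `a`. Hence, after finitely many D-moves, one of the
earlier cases occurs.

The topological work lies in showing that each move yields a singular disc again. Planarity is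
replaced by the intrinsic conditions of `IsDisc`: finite, of dimension at most two, simply
connected, without 2-cycles mod 2, and with a walk that together with the triangles occupies every
edge twice. A finite subcomplex of the plane has no 2-cycle, since the support would spread over the
whole infinite plane (`noCycle_of_embedded`). Conversely, an infinite cylinder glued along the
boundary walk completes such a complex to a triangulation of the plane; the delicate point is that
vertex links are connected (`collar_link_connected`).

For a nonempty connected complex, simple connectedness means that every group-valued 1-cocycle has a
primitive. In this form it passes through gluings and moves by extending or pulling back cocycles,
and the absence of 2-cycles passes by extending mod 2 functions on triangles (`IsDisc.aMove`,
`IsDisc.flip`, `IsDisc.contract`). -/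

theorem face_nonempty {s : Finset V} (hs : s ∈ K.faces) : s.Nonempty :=
  (K.isRelLowerSet_faces hs).1

theorem face_mono {s t : Finset V} (hs : s ∈ K.faces) (hts : t ⊆ s) (ht : t.Nonempty) :
    t ∈ K.faces :=
  (K.isRelLowerSet_faces hs).2 hts ht

theorem adj_of_face {s : Finset V} (hs : s ∈ K.faces) {x y : V} (hx : x ∈ s) (hy : y ∈ s)
    (hxy : x ≠ y) : (graph K).Adj x y :=
  ⟨hxy, face_mono hs (by intro z; simp only [Finset.mem_insert, Finset.mem_singleton]
                         rintro (rfl | rfl) <;> assumption) ⟨x, by simp⟩⟩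

theorem mem_vertices_of_face {s : Finset V} (hs : s ∈ K.faces) {x : V} (hx : x ∈ s) :
    x ∈ vertices K :=
  face_mono hs (by simpa using hx) ⟨x, by simp⟩

theorem mem_vertices_of_adj {x y : V} (h : (graph K).Adj x y) : x ∈ vertices K :=
  mem_vertices_of_face h.2 (by simp)

theorem graph_adj {x y : V} : (graph K).Adj x y ↔ x ≠ y ∧ ({x, y} : Finset V) ∈ K.faces := Iff.rfl

variable (K) in
/-- A 1-cocycle with values in a group. -/
structure IsCocycle {H : Type*} [Group H] (g : V → V → H) : Prop where
  inv : ∀ x y, (graph K).Adj x y → g x y * g y x = 1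
  mul : ∀ x y z, (graph K).Adj x y → (graph K).Adj y z → (graph K).Adj x z →
    ({x, y, z} : Finset V) ∈ K.faces → g x y * g y z = g x z

variable (K) in
/-- The function `h` on the vertices is a primitive of `g`. -/
def IsPrimitive {H : Type*} [Group H] (g : V → V → H) (h : V → H) : Prop :=
  ∀ x y, (graph K).Adj x y → h y = h x * g x y

/-- The product of the values of `g` along a walk. -/
def hol {H : Type*} [Group H] (g : V → V → H) : ∀ {x y : V}, (graph K).Walk x y → H
  | _, _, .nil => 1
  | x, _, .cons (v := v) _ p => g x v * hol g p

theorem hol_append {H : Type*} [Group H] (g : V → V → H) {x y z : V} (p : (graph K).Walk x y)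
    (q : (graph K).Walk y z) : hol g (p.append q) = hol g p * hol g q := by
  induction p with
  | nil => simp [hol]
  | cons h p ih => simp [hol, ih, mul_assoc]

theorem hol_reverse {H : Type*} [Group H] {g : V → V → H} (hg : IsCocycle K g) {x y : V}
    (p : (graph K).Walk x y) : hol g p.reverse = (hol g p)⁻¹ := by
  induction p with
  | nil => simp [hol]
  | cons h p ih =>
    simp only [SimpleGraph.Walk.reverse_cons, hol_append, ih, hol, mul_one, mul_inv_rev]
    congr 1
    exact eq_inv_of_mul_eq_one_left (hg.inv _ _ h.symm)

theorem PathHomotopic.hol_eq {H : Type*} [Group H] {g : V → V → H} (hg : IsCocycle K g) {x y : V}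
    {p q : (graph K).Walk x y} (h : PathHomotopic K p q) : hol g p = hol g q := by
  induction h with
  | refl p => rfl
  | symm _ ih => exact ih.symm
  | trans _ _ ih₁ ih₂ => exact ih₁.trans ih₂
  | cons h _ ih => simp [hol, ih]
  | backtrack h p => simp [hol, ← mul_assoc, hg.inv _ _ h]
  | triangle hxy hyz hxz hf p => simp [hol, ← mul_assoc, hg.mul _ _ _ hxy hyz hxz hf]

/-- Since loops are null-homotopic, the product of `g` along a path depends only on its end points;
a primitive is obtained by integrating `g` from a base point. -/
theorem IsSimplyConnected.exists_primitive (hK : IsSimplyConnected K) {H : Type*} [Group H]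
    {g : V → V → H} (hg : IsCocycle K g) : ∃ h, IsPrimitive K g h := by
  obtain ⟨x₀, hx₀⟩ := hK.nonempty
  have key : ∀ x y, ∀ p : (graph K).Walk x y, ∀ q : (graph K).Walk x y, hol g p = hol g q := by
    intro x y p q
    have := (hK.trivial_loops x (p.append q.reverse)).hol_eq hg
    rw [hol_append, hol_reverse hg] at this
    simpa [hol, mul_inv_eq_one] using this
  have hr : ∀ x ∈ vertices K, Nonempty ((graph K).Walk x₀ x) := hK.connected x₀ hx₀
  refine ⟨fun x => if hx : x ∈ vertices K then hol g (hr x hx).some else 1, fun x y hxy => ?_⟩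
  have hx := mem_vertices_of_adj hxy
  have hy := mem_vertices_of_adj hxy.symm
  simp only [hx, hy, dif_pos]
  rw [key _ _ (hr y hy).some ((hr x hx).some.append (.cons hxy .nil)), hol_append]
  simp [hol]

/-! ### The edge path group and the converse criterion -/

theorem PathHomotopic.append_left {x y z : V} (r : (graph K).Walk x y) {p q : (graph K).Walk y z}
    (h : PathHomotopic K p q) : PathHomotopic K (r.append p) (r.append q) := by
  induction r with
  | nil => exact h
  | cons h' r ih => exact .cons h' (ih h)

theorem PathHomotopic.append_right {x y z : V} {p q : (graph K).Walk x y}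
    (h : PathHomotopic K p q) (r : (graph K).Walk y z) :
    PathHomotopic K (p.append r) (q.append r) := by
  induction h with
  | refl p => exact .refl _
  | symm _ ih => exact (ih r).symm
  | trans _ _ ih₁ ih₂ => exact (ih₁ r).trans (ih₂ r)
  | cons h _ ih => exact .cons h (ih r)
  | backtrack h p => exact .backtrack h _
  | triangle hxy hyz hxz hf p => exact .triangle hxy hyz hxz hf _

theorem PathHomotopic.reverse {x y : V} {p q : (graph K).Walk x y}
    (h : PathHomotopic K p q) : PathHomotopic K p.reverse q.reverse := by
  induction h with
  | refl p => exact .refl _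
  | symm _ ih => exact ih.symm
  | trans _ _ ih₁ ih₂ => exact ih₁.trans ih₂
  | cons h _ ih => simpa using ih.append_right _
  | backtrack h p =>
    simp only [SimpleGraph.Walk.reverse_cons, ← SimpleGraph.Walk.append_assoc]
    simpa using (PathHomotopic.backtrack h .nil).append_left p.reverse
  | triangle hxy hyz hxz hf p =>
    simp only [SimpleGraph.Walk.reverse_cons, ← SimpleGraph.Walk.append_assoc]
    refine PathHomotopic.append_left _ (.triangle hyz.symm hxy.symm hxz.symm ?_ .nil)
    convert hf using 1
    ext; simp; tauto

theorem PathHomotopic.append_reverse {x y : V} (p : (graph K).Walk x y) :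
    PathHomotopic K (p.append p.reverse) .nil := by
  induction p with
  | nil => exact .refl _
  | cons h p ih =>
    simp only [SimpleGraph.Walk.reverse_cons, SimpleGraph.Walk.cons_append,
      SimpleGraph.Walk.append_assoc]
    exact (PathHomotopic.cons h (ih.append_right _)).trans (.backtrack h .nil)

theorem PathHomotopic.reverse_append {x y : V} (p : (graph K).Walk x y) :
    PathHomotopic K (p.reverse.append p) .nil := by
  simpa using PathHomotopic.append_reverse p.reverse

variable (K) in
/-- Homotopy of loops, as a setoid. -/
def loopSetoid (x : V) : Setoid ((graph K).Walk x x) where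
  r := PathHomotopic K
  iseqv := ⟨.refl, .symm, .trans⟩

variable (K) in
/-- The edge path group. -/
def EdgePathGroup (x : V) : Type u := Quotient (loopSetoid K x)

instance (x : V) : Group (EdgePathGroup K x) where
  mul := Quotient.map₂ (fun p q => p.append q)
    fun _ p' hp q _ hq => (PathHomotopic.append_right hp q).trans (PathHomotopic.append_left p' hq)
  one := Quotient.mk _ .nil
  inv := Quotient.map (fun p => p.reverse) fun _ _ h => PathHomotopic.reverse h
  mul_assoc := by
    rintro ⟨p⟩ ⟨q⟩ ⟨r⟩
    exact congrArg (Quotient.mk _) (SimpleGraph.Walk.append_assoc p q r).symm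
  one_mul := by rintro ⟨p⟩; rfl
  mul_one := by rintro ⟨p⟩; exact congrArg (Quotient.mk _) (SimpleGraph.Walk.append_nil p)
  inv_mul_cancel := by rintro ⟨p⟩; exact Quotient.sound (PathHomotopic.reverse_append p)

/-- The class of a loop. -/
def EdgePathGroup.mk {x : V} (p : (graph K).Walk x x) : EdgePathGroup K x := Quotient.mk _ p

theorem EdgePathGroup.mk_mul {x : V} (p q : (graph K).Walk x x) :
    EdgePathGroup.mk p * EdgePathGroup.mk q = EdgePathGroup.mk (p.append q) := rfl

theorem EdgePathGroup.mk_eq {x : V} {p q : (graph K).Walk x x} :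
    EdgePathGroup.mk p = EdgePathGroup.mk q ↔ PathHomotopic K p q := Quotient.eq

theorem hol_eq_of_isPrimitive {H : Type*} [Group H] {g : V → V → H} {h : V → H}
    (hh : IsPrimitive K g h) {x y : V} (p : (graph K).Walk x y) : h y = h x * hol g p := by
  induction p with
  | nil => simp [hol]
  | cons a p ih => rw [ih, hh _ _ a]; simp [hol, mul_assoc]

/-- The universal cocycle sends an edge `yz` to the class of `γ y · yz · (γ z)⁻¹` in the edge path
group, where `γ` joins the base point to each vertex. A primitive of this cocycle makes the class of
every loop trivial. -/
theorem isSimplyConnected_of_exists_primitive (hne : (vertices K).Nonempty)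
    (hc : ∀ x ∈ vertices K, ∀ y ∈ vertices K, (graph K).Reachable x y)
    (hp : ∀ (H : Type u) [Group H] (g : V → V → H), IsCocycle K g → ∃ h, IsPrimitive K g h) :
    IsSimplyConnected K := by
  refine ⟨hne, hc, fun x c => ?_⟩
  by_cases hx : x ∈ vertices K
  swap
  · cases c with
    | nil => exact .refl _
    | cons h p => exact absurd (mem_vertices_of_adj h) hx
  have hr : ∀ y, y ∈ vertices K → Nonempty ((graph K).Walk x y) := hc x hx
  obtain ⟨γ, -⟩ : ∃ γ : ∀ y, y ∈ vertices K → (graph K).Walk x y, True :=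
    ⟨fun y hy => (hr y hy).some, trivial⟩
  let g : V → V → EdgePathGroup K x := fun y z =>
    if h : (graph K).Adj y z then
      .mk ((γ y (mem_vertices_of_adj h)).append
        (.cons h (γ z (mem_vertices_of_adj h.symm)).reverse))
    else 1
  have gval : ∀ y z (h : (graph K).Adj y z), g y z = .mk ((γ y (mem_vertices_of_adj h)).append
        (.cons h (γ z (mem_vertices_of_adj h.symm)).reverse)) := fun y z h => dif_pos h
  have cancel : ∀ {y z t : V} (hy : y ∈ vertices K) (p : (graph K).Walk z y)
      (q : (graph K).Walk y t), PathHomotopic K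
        ((p.append (γ y hy).reverse).append ((γ y hy).append q)) (p.append q) := by
    intro y z t hy p q
    rw [← SimpleGraph.Walk.append_assoc]
    refine PathHomotopic.append_left p ?_
    rw [SimpleGraph.Walk.append_assoc]
    exact (PathHomotopic.reverse_append _).append_right q
  have hg : IsCocycle K g := by
    constructor
    · intro y z h
      rw [gval _ _ h, gval _ _ h.symm, EdgePathGroup.mk_mul]
      refine EdgePathGroup.mk_eq.2 ?_
      have h1 := cancel (mem_vertices_of_adj h.symm)
        ((γ y (mem_vertices_of_adj h)).append (.cons h .nil))
        (.cons h.symm (γ y (mem_vertices_of_adj h)).reverse)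
      have h2 := (PathHomotopic.append_left (γ y (mem_vertices_of_adj h))
        (.backtrack h (γ y (mem_vertices_of_adj h)).reverse)).trans
          (PathHomotopic.append_reverse _)
      simp only [← SimpleGraph.Walk.append_assoc, SimpleGraph.Walk.cons_append,
        SimpleGraph.Walk.nil_append] at h1 ⊢
      exact h1.trans h2
    · intro y z t hyz hzt hyt hf
      rw [gval _ _ hyz, gval _ _ hzt, gval _ _ hyt, EdgePathGroup.mk_mul]
      refine EdgePathGroup.mk_eq.2 ?_
      have h1 := cancel (mem_vertices_of_adj hzt)
        ((γ y (mem_vertices_of_adj hyz)).append (.cons hyz .nil))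
        (.cons hzt (γ t (mem_vertices_of_adj hzt.symm)).reverse)
      have h2 := PathHomotopic.append_left (γ y (mem_vertices_of_adj hyz))
        (.triangle hyz hzt hyt hf (γ t (mem_vertices_of_adj hzt.symm)).reverse)
      simp only [← SimpleGraph.Walk.append_assoc, SimpleGraph.Walk.cons_append,
        SimpleGraph.Walk.nil_append] at h1 ⊢
      exact h1.trans h2
  obtain ⟨h, hh⟩ := hp _ g hg
  have hol_val : ∀ {y z : V} (p : (graph K).Walk y z) (hy : y ∈ vertices K) (hz : z ∈ vertices K),
      hol g p = .mk ((γ y hy).append (p.append (γ z hz).reverse)) := by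
    intro y z p
    induction p with
    | nil => intro hy _; exact (EdgePathGroup.mk_eq.2 (.append_reverse _)).symm
    | @cons y t z a p ih =>
      intro hy hz
      rw [hol, ih (mem_vertices_of_adj a.symm) hz, gval _ _ a, EdgePathGroup.mk_mul]
      refine EdgePathGroup.mk_eq.2 ?_
      have h1 := cancel (mem_vertices_of_adj a.symm) ((γ y hy).append (.cons a .nil))
        (p.append (γ z hz).reverse)
      simpa only [← SimpleGraph.Walk.append_assoc, SimpleGraph.Walk.cons_append,
        SimpleGraph.Walk.nil_append] using h1
  have h1 := hol_eq_of_isPrimitive hh c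
  rw [left_eq_mul, hol_val c hx hx] at h1
  have h2 := EdgePathGroup.mk_eq.1 (h1.trans (rfl : _ = EdgePathGroup.mk .nil))
  -- The path `γ x` need not be constant, so what has been shown to be trivial is the conjugate of
  -- `c` by `γ x`; it is conjugated back.
  have h3 := ((PathHomotopic.append_left (γ x hx).reverse h2).append_right (γ x hx))
  simp only [← SimpleGraph.Walk.append_assoc, SimpleGraph.Walk.nil_append] at h3
  have h4 := h3.trans (PathHomotopic.reverse_append _)
  refine PathHomotopic.trans (.symm ?_) h4
  rw [SimpleGraph.Walk.append_assoc]
  have h5 := (PathHomotopic.reverse_append (γ x hx)).append_right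
    (c.append ((γ x hx).reverse.append (γ x hx)))
  refine h5.trans ?_
  have h6 := PathHomotopic.append_left c (PathHomotopic.reverse_append (γ x hx))
  simpa using h6

theorem IsCocycle.inv_eq {H : Type*} [Group H] {g : V → V → H} (hg : IsCocycle K g) {x y : V}
    (h : (graph K).Adj x y) : g y x = (g x y)⁻¹ :=
  eq_inv_of_mul_eq_one_left (hg.inv y x h.symm)

/-- The pull-back of a function of pairs, normalized on the pairs that are collapsed. -/
def pullback {V' H : Type*} [Group H] (φ : V → V') (g : V' → V' → H) (x y : V) : H :=
  if φ x = φ y then 1 else g (φ x) (φ y)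

/-- When `φ` collapses an edge of a triangle, the cocycle relation degenerates to a triviality or to
the inversion law. This transports primitives along the simplicial maps of the A- and C-moves. -/
theorem IsCocycle.pullback {V' : Type*} {K' : PreAbstractSimplicialComplex V'} {φ : V → V'}
    (hφ : ∀ s ∈ K.faces, s.image φ ∈ K'.faces) {H : Type*} [Group H] {g : V' → V' → H}
    (hg : IsCocycle K' g) : IsCocycle K (MetricSystolic.pullback φ g) := by
  have hadj : ∀ x y, (graph K).Adj x y → φ x ≠ φ y → (graph K').Adj (φ x) (φ y) := by
    intro x y h hne
    exact ⟨hne, by simpa [Finset.image_insert] using hφ _ h.2⟩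
  constructor
  · intro x y h
    by_cases hne : φ x = φ y
    · simp [MetricSystolic.pullback, hne]
    · simp [MetricSystolic.pullback, hne, Ne.symm hne, hg.inv _ _ (hadj x y h hne)]
  · intro x y z hxy hyz hxz hf
    unfold MetricSystolic.pullback
    by_cases h1 : φ x = φ y
    · simp [h1]
    by_cases h2 : φ y = φ z
    · simp [h1, ← h2]
    by_cases h3 : φ x = φ z
    · have := hg.inv _ _ (hadj y z hyz h2)
      have h4 := hg.inv _ _ (hadj z y hyz.symm (Ne.symm h2))
      simp [h2, h3, Ne.symm h2, h4]
    · simp only [h1, h2, h3, if_false]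
      exact hg.mul _ _ _ (hadj _ _ hxy h1) (hadj _ _ hyz h2) (hadj _ _ hxz h3)
        (by simpa [Finset.image_insert] using hφ _ hf)

theorem reachable_of_forall_adj {V' : Type*} {A : SimpleGraph V} {B : SimpleGraph V'} {φ : V → V'}
    (hφ : ∀ x y, A.Adj x y → B.Reachable (φ x) (φ y)) {x y : V} (h : A.Reachable x y) :
    B.Reachable (φ x) (φ y) := by
  obtain ⟨p⟩ := h
  induction p with
  | nil => exact .refl _
  | cons a p ih => exact (hφ _ _ a).trans ih

end Cocycles

/-! ### Chains of triangles mod 2 -/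

section Chains

variable {V : Type u} (K : PreAbstractSimplicialComplex V)

/-- The finset of triangles of a finite complex. -/
def triF : Finset (Finset V) := if h : (triangles K).Finite then h.toFinset else ∅

/-- The sum of `f` over the triangles containing `x` and `y`. -/
def edgeSum {R : Type*} [AddCommMonoid R] (f : Finset V → R) (x y : V) : R :=
  ∑ t ∈ triF K with x ∈ t ∧ y ∈ t, f t

/-- There are no nonzero 2-cycles mod 2. -/
def NoCycle : Prop :=
  ∀ f : Finset V → ZMod 2, (∀ x y, (graph K).Adj x y → edgeSum K f x y = 0) →
    ∀ t ∈ triangles K, f t = 0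

/-- A set of triangles at the vertex `x` that is closed under adjacency around `x`, as soon as
every edge at `x` lies in two triangles of the set, is the whole star of the interior
vertex `x`. -/
def StarRigid : Prop :=
  ∀ (x : V) (S : Set (Finset V)), S ⊆ triangles K → S.Nonempty → (∀ t ∈ S, x ∈ t) →
    (∀ s ∈ S, ∀ y ∈ s, y ≠ x → ∃ t ∈ S, t ≠ s ∧ y ∈ t) →
    IsInterior K x ∧ ∀ t ∈ triangles K, x ∈ t → t ∈ S

variable {K}

theorem mem_triF (hfin : K.faces.Finite) {t : Finset V} : t ∈ triF K ↔ t ∈ triangles K := by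
  have h : (triangles K).Finite := hfin.subset fun _ h => h.1
  simp [triF, h]

theorem ncard_triangles (hfin : K.faces.Finite) : (triangles K).ncard = (triF K).card := by
  rw [← Set.ncard_coe_finset]
  congr 1
  ext t
  simp [mem_triF hfin]

theorem ncard_edge (hfin : K.faces.Finite) (x y : V) :
    {t | t ∈ triangles K ∧ x ∈ t ∧ y ∈ t}.ncard = edgeSum K (fun _ => 1) x y := by
  rw [edgeSum, Finset.sum_const, smul_eq_mul, mul_one, ← Set.ncard_coe_finset]
  congr 1
  ext t
  simp [mem_triF hfin]

theorem edgeSum_comm {R : Type*} [AddCommMonoid R] (f : Finset V → R) (x y : V) :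
    edgeSum K f x y = edgeSum K f y x := by
  unfold edgeSum
  congr 1
  ext t
  simp [and_comm]

theorem edgeSum_one_cast {R : Type*} [Semiring R] (x y : V) :
    edgeSum K (fun _ => (1 : R)) x y = ((edgeSum K (fun _ => 1) x y : ℕ) : R) := by
  simp [edgeSum]

theorem edgeSum_congr (hfin : K.faces.Finite) {R : Type*} [AddCommMonoid R] {f g : Finset V → R}
    {x y : V} (h : ∀ t ∈ triangles K, x ∈ t → y ∈ t → f t = g t) :
    edgeSum K f x y = edgeSum K g x y :=
  Finset.sum_congr rfl fun t ht => by
    rw [Finset.mem_filter, mem_triF hfin] at ht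
    exact h t ht.1 ht.2.1 ht.2.2

theorem edgeSum_eq_zero (hfin : K.faces.Finite) {R : Type*} [AddCommMonoid R] {f : Finset V → R}
    {x y : V} (h : ∀ t ∈ triangles K, x ∈ t → y ∈ t → f t = 0) :
    edgeSum K f x y = 0 :=
  Finset.sum_eq_zero fun t ht => by
    rw [Finset.mem_filter, mem_triF hfin] at ht
    exact h t ht.1 ht.2.1 ht.2.2

theorem edgeSum_add {R : Type*} [AddCommMonoid R] (f g : Finset V → R) (x y : V) :
    edgeSum K (fun t => f t + g t) x y = edgeSum K f x y + edgeSum K g x y :=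
  Finset.sum_add_distrib

theorem exists_triangle_eq {t : Finset V} (ht : t ∈ triangles K) {x : V} (hx : x ∈ t) :
    ∃ y z, x ≠ y ∧ x ≠ z ∧ y ≠ z ∧ t = {x, y, z} := by
  have h1 : (t.erase x).card = 2 := by rw [Finset.card_erase_of_mem hx, ht.2]
  obtain ⟨y, z, hyz, h⟩ := Finset.card_eq_two.1 h1
  have hy : y ∈ t.erase x := by simp [h]
  have hz : z ∈ t.erase x := by simp [h]
  refine ⟨y, z, (Finset.ne_of_mem_erase hy).symm, (Finset.ne_of_mem_erase hz).symm, hyz, ?_⟩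
  rw [← Finset.insert_erase hx, h]

theorem exists_triangle_eq' {t : Finset V} (ht : t ∈ triangles K) {x y : V} (hx : x ∈ t)
    (hy : y ∈ t) (hxy : x ≠ y) : ∃ z, x ≠ z ∧ y ≠ z ∧ t = {x, y, z} := by
  obtain ⟨a, b, h1, h2, h3, rfl⟩ := exists_triangle_eq ht hx
  simp only [Finset.mem_insert, Finset.mem_singleton] at hy
  rcases hy with rfl | rfl | rfl
  · exact absurd rfl hxy
  · exact ⟨b, h2, h3, rfl⟩
  · exact ⟨a, h1, h3.symm, by rw [Finset.pair_comm]⟩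

theorem triangle_mem {x y z : V} (h : ({x, y, z} : Finset V) ∈ K.faces) (hxy : x ≠ y)
    (hxz : x ≠ z) (hyz : y ≠ z) : ({x, y, z} : Finset V) ∈ triangles K :=
  ⟨h, Finset.card_eq_three.2 ⟨x, y, z, hxy, hxz, hyz, rfl⟩⟩

/-- The boundary of a boundary vanishes. -/
theorem sum_edgeSum_eq_zero (hfin : K.faces.Finite) (f : Finset V → ZMod 2) (a : V) :
    ∑ y ∈ ((triF K).biUnion id).erase a, edgeSum K f a y = 0 := by
  unfold edgeSum
  simp_rw [Finset.sum_filter]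
  rw [Finset.sum_comm]
  refine Finset.sum_eq_zero fun t ht => ?_
  by_cases ha : a ∈ t
  · simp only [ha, true_and]
    rw [← Finset.sum_filter, Finset.sum_const]
    have : (((triF K).biUnion id).erase a).filter (fun y => y ∈ t) = t.erase a := by
      ext y
      simp only [Finset.mem_filter, Finset.mem_erase, Finset.mem_biUnion, id]
      constructor
      · rintro ⟨⟨h, -⟩, h'⟩; exact ⟨h, h'⟩
      · rintro ⟨h, h'⟩; exact ⟨⟨h, t, ht, h'⟩, h'⟩
    rw [this, Finset.card_erase_of_mem ha, ((mem_triF hfin).1 ht).2]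
    exact CharTwo.two_nsmul _
  · simp [ha]

theorem edgeSum_eq_zero_of_not_adj (hfin : K.faces.Finite) {R : Type*} [AddCommMonoid R]
    (f : Finset V → R) {x y : V} (hxy : x ≠ y) (h : ¬ (graph K).Adj x y) : edgeSum K f x y = 0 :=
  edgeSum_eq_zero hfin fun _ ht hx hy => absurd (adj_of_face ht.1 hx hy hxy) h

/-- The mod 2 boundary of a chain has an even number of edges at every vertex `a`; if only `ab` and
`ac` can occur in it, both do or neither does. -/
theorem edgeSum_eq_edgeSum_of_forall (hfin : K.faces.Finite) {f : Finset V → ZMod 2} {a b c : V}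
    (hb : a ≠ b) (hc : a ≠ c) (hbc : b ≠ c)
    (h : ∀ y, (graph K).Adj a y → y ≠ b → y ≠ c → edgeSum K f a y = 0) :
    edgeSum K f a b = edgeSum K f a c := by
  have h1 := sum_edgeSum_eq_zero hfin f a
  have h2 : ∑ y ∈ ((triF K).biUnion id).erase a, edgeSum K f a y =
      ∑ y ∈ {b, c}, edgeSum K f a y := by
    refine Finset.sum_congr_of_eq_on_inter ?_ ?_ fun _ _ _ => rfl
    · intro y hy hy'
      simp only [Finset.mem_insert, Finset.mem_singleton, not_or] at hy'
      by_cases hay : (graph K).Adj a y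
      · exact h y hay hy'.1 hy'.2
      · exact edgeSum_eq_zero_of_not_adj hfin f (Finset.ne_of_mem_erase hy).symm hay
    · intro y hy hy'
      refine edgeSum_eq_zero hfin fun t ht hat hyt => absurd ?_ hy'
      have hya : y ≠ a := by
        simp only [Finset.mem_insert, Finset.mem_singleton] at hy
        rcases hy with rfl | rfl <;> exact Ne.symm ‹_›
      exact Finset.mem_erase.2 ⟨hya, Finset.mem_biUnion.2 ⟨t, (mem_triF hfin).2 ht, hyt⟩⟩
  rw [h2, Finset.sum_pair hbc] at h1
  exact CharTwo.add_eq_zero.1 h1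

theorem edgeSum_eq_zero_of_forall (hfin : K.faces.Finite) {f : Finset V → ZMod 2} {a b : V}
    (hb : a ≠ b) (h : ∀ y, (graph K).Adj a y → y ≠ b → edgeSum K f a y = 0) :
    edgeSum K f a b = 0 := by
  by_cases hc : ∃ c, a ≠ c ∧ b ≠ c
  · obtain ⟨c, hac, hbc⟩ := hc
    rw [edgeSum_eq_edgeSum_of_forall hfin hb hac hbc fun y h1 h2 _ => h y h1 h2]
    by_cases hadj : (graph K).Adj a c
    · exact h c hadj hbc.symm
    · exact edgeSum_eq_zero_of_not_adj hfin f hac hadj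
  -- Without a third vertex there is no triangle at all.
  · push Not at hc
    refine edgeSum_eq_zero hfin fun t ht hat _ => ?_
    obtain ⟨y, z, h1, h2, h3, -⟩ := exists_triangle_eq ht hat
    exact absurd ((hc y h1).symm.trans (hc z h2)) h3

/-- The counting function of the edges of a walk, mod 2. -/
theorem PathHomotopic.exists_chain (hfin : K.faces.Finite) {x y : V} {p q : (graph K).Walk x y}
    (h : PathHomotopic K p q) : ∃ f : Finset V → ZMod 2, ∀ u v, (graph K).Adj u v →
      edgeSum K f u v = (p.edges.count s(u, v) : ZMod 2) + (q.edges.count s(u, v) : ZMod 2) := by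
  induction h with
  | refl p => exact ⟨0, fun u v _ => by simp [edgeSum, CharTwo.add_self_eq_zero]⟩
  | symm _ ih =>
    obtain ⟨f, hf⟩ := ih
    exact ⟨f, fun u v h => by rw [hf u v h, add_comm]⟩
  | trans _ _ ih₁ ih₂ =>
    obtain ⟨f, hf⟩ := ih₁
    obtain ⟨g, hg⟩ := ih₂
    refine ⟨fun t => f t + g t, fun u v h => ?_⟩
    rw [edgeSum_add, hf u v h, hg u v h]
    rw [add_assoc, CharTwo.add_cancel_left]
  | cons h _ ih =>
    obtain ⟨f, hf⟩ := ih
    refine ⟨f, fun u v h' => ?_⟩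
    rw [hf u v h']
    simp only [SimpleGraph.Walk.edges_cons, List.count_cons, Nat.cast_add]
    rw [add_add_add_comm, CharTwo.add_self_eq_zero, add_zero]
  | backtrack h p =>
    refine ⟨0, fun u v _ => ?_⟩
    simp only [SimpleGraph.Walk.edges_cons, List.count_cons, Nat.cast_add, Sym2.eq_swap]
    rw [add_right_comm, add_assoc, CharTwo.add_self_eq_zero]
    simp [edgeSum]
  | @triangle x y z t hxy hyz hxz hf p =>
    -- The two paths differ by the boundary of this one triangle; their common tail `p` is counted
    -- twice and cancels.
    refine ⟨fun s => if s = {x, y, z} then 1 else 0, fun u v h => ?_⟩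
    have hmem : ({x, y, z} : Finset V) ∈ triF K :=
      (mem_triF hfin).2 (triangle_mem hf hxy.1 hxz.1 hyz.1)
    simp only [SimpleGraph.Walk.edges_cons, List.count_cons, Nat.cast_add, edgeSum,
      Finset.sum_ite_eq', Finset.mem_filter, hmem, true_and]
    have h1 := hxy.1
    have h2 := hyz.1
    have h3 := hxz.1
    have h4 := h.1
    generalize (List.count s(u, v) p.edges : ZMod 2) = n
    have e : ∀ a b c : ZMod 2, n + a + b + (n + c) = a + b + c := by
      intro a b c
      have := CharTwo.add_self_eq_zero n
      linear_combination this
    rw [e]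
    simp only [Finset.mem_insert, Finset.mem_singleton, beq_iff_eq, Sym2.eq_iff]
    by_cases a1 : u = x <;> by_cases a2 : u = y <;> by_cases a3 : u = z <;>
    by_cases b1 : v = x <;> by_cases b2 : v = y <;> by_cases b3 : v = z <;> subst_vars <;>
      simp_all [eq_comm]

end Chains

/-! ### Link cycles and subcomplexes of plane triangulations -/

section Planar

variable {V : Type u} {K : PreAbstractSimplicialComplex V}

theorem fin_induction_finRotate {k : ℕ} {J : Set (Fin k)} (hne : J.Nonempty)
    (h : ∀ i ∈ J, finRotate k i ∈ J) (i : Fin k) : i ∈ J := by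
  obtain ⟨j, hj⟩ := hne
  cases k with
  | zero => exact j.elim0
  | succ n =>
    simp only [finRotate_apply] at h
    have key : ∀ l : Fin (n + 1), j + l ∈ J := by
      intro l
      induction l using Fin.induction with
      | zero => simpa using hj
      | succ l ih => simpa [add_assoc, Fin.coeSucc_eq_succ] using h _ ih
    simpa using key (i - j)

theorem finRotate_ne {k : ℕ} (hk : 3 ≤ k) (i : Fin k) : finRotate k i ≠ i := by
  obtain ⟨n, rfl⟩ : ∃ n, k = n + 2 := ⟨k - 2, by omega⟩
  rw [finRotate_apply]
  simp

theorem finRotate_finRotate_ne {k : ℕ} (hk : 3 ≤ k) (i : Fin k) :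
    finRotate k (finRotate k i) ≠ i := by
  obtain ⟨n, rfl⟩ : ∃ n, k = n + 3 := ⟨k - 3, by omega⟩
  rw [finRotate_apply, finRotate_apply, add_assoc]
  simp only [ne_eq, add_eq_left]
  rw [Fin.ext_iff]
  simp [Fin.val_add, Nat.mod_eq_of_lt (show 2 < n + 2 + 1 by omega)]

namespace IsLinkCycle

variable {a : V} {k : ℕ} {c : Fin k → V} (h : IsLinkCycle K a c)
include h

theorem triangle_mem (i : Fin k) : ({a, c i, c (finRotate k i)} : Finset V) ∈ triangles K :=
  MetricSystolic.triangle_mem ((h.mem_faces_iff _ (by simp)).2 (.inr ⟨i, .inr rfl⟩))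
    (h.ne _).symm (h.ne _).symm (h.injective.ne (finRotate_ne h.three_le i).symm)

theorem card_le {s : Finset V} (hs : s ∈ K.faces) (ha : a ∈ s) : s.card ≤ 3 := by
  rcases (h.mem_faces_iff s ha).1 hs with rfl | ⟨i, rfl | rfl⟩
  · simp
  · exact Finset.card_le_two.trans (by norm_num)
  · exact Finset.card_le_three

theorem exists_eq {t : Finset V} (ht : t ∈ triangles K) (ha : a ∈ t) :
    ∃ i, t = {a, c i, c (finRotate k i)} := by
  rcases (h.mem_faces_iff t ha).1 ht.1 with rfl | ⟨i, rfl | rfl⟩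
  · simpa using ht.2
  · have := ht.2
    have h2 := Finset.card_le_two (a := a) (b := c i)
    omega
  · exact ⟨i, rfl⟩

theorem exists_of_adj {y : V} (hy : (graph K).Adj a y) : ∃ i, y = c i := by
  have hy1 := hy.1
  rcases (h.mem_faces_iff _ (by simp)).1 hy.2 with e | ⟨i, e | e⟩
  · have : y ∈ ({a} : Finset V) := e ▸ (by simp)
    exact absurd (Finset.mem_singleton.1 this).symm hy1
  · have : y ∈ ({a, c i} : Finset V) := e ▸ (by simp)
    simp only [Finset.mem_insert, Finset.mem_singleton] at this
    rcases this with h | h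
    · exact absurd h.symm hy1
    · exact ⟨i, h⟩
  · have : y ∈ ({a, c i, c (finRotate k i)} : Finset V) := e ▸ (by simp)
    simp only [Finset.mem_insert, Finset.mem_singleton] at this
    rcases this with h | h | h
    · exact absurd h.symm hy1
    · exact ⟨i, h⟩
    · exact ⟨_, h⟩

theorem mem_triangle_iff {i j : Fin k} :
    c j ∈ ({a, c i, c (finRotate k i)} : Finset V) ↔ j = i ∨ j = finRotate k i := by
  simp [h.ne, h.injective.eq_iff]

/-- Otherwise each of `i`, `j` would be the cyclic successor of the other, which is impossible as `3
≤ k`. -/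
theorem triangle_inj {i j : Fin k} (e : ({a, c i, c (finRotate k i)} : Finset V) =
    {a, c j, c (finRotate k j)}) : i = j := by
  have h1 := h.mem_triangle_iff.1 (e ▸ h.mem_triangle_iff.2 (.inl rfl) : c i ∈ _)
  have h2 := h.mem_triangle_iff.1 (e ▸ h.mem_triangle_iff.2 (.inr rfl) : c (finRotate k i) ∈ _)
  rcases h1 with h1 | h1
  · exact h1
  · rcases h2 with h2 | h2
    · exact absurd (h2 ▸ h1.symm : finRotate k (finRotate k i) = i)
        (finRotate_finRotate_ne h.three_le i)
    · exact (finRotate k).injective h2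

/-- Triangles at `a` that are closed under adjacency exhaust the star of `a`. -/
theorem forall_triangle_mem {S : Set (Finset V)} (hS : S ⊆ triangles K) (hne : S.Nonempty)
    (ha : ∀ t ∈ S, a ∈ t) (hcl : ∀ s ∈ S, ∀ y ∈ s, y ≠ a → ∃ t ∈ S, t ≠ s ∧ y ∈ t) (i : Fin k) :
    ({a, c i, c (finRotate k i)} : Finset V) ∈ S := by
  refine fin_induction_finRotate (J := {i | ({a, c i, c (finRotate k i)} : Finset V) ∈ S}) ?_ ?_ i
  · obtain ⟨s, hs⟩ := hne
    obtain ⟨i, rfl⟩ := h.exists_eq (hS hs) (ha s hs)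
    exact ⟨i, hs⟩
  · intro i hi
    -- Only two triangles at `a` contain this link vertex, so the second one in `S` has to be the
    -- next one around `a`.
    obtain ⟨t, ht, hne, hmem⟩ := hcl _ hi (c (finRotate k i)) (by simp) (h.ne _)
    obtain ⟨j, rfl⟩ := h.exists_eq (hS ht) (ha t ht)
    rcases h.mem_triangle_iff.1 hmem with rfl | e
    · exact ht
    · exact absurd (by rw [(finRotate k).injective e]) hne

end IsLinkCycle

/-! ### Subcomplexes of a triangulation of the plane -/

section Embedded

variable {P : Type u} {T : PreAbstractSimplicialComplex P} {e : V → P}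
  (hT : IsPlaneTriangulation T) (he : Set.InjOn e (vertices K)) (hle : K.map e ≤ T)

include hle in
theorem image_mem_faces {s : Finset V} (hs : s ∈ K.faces) : s.image e ∈ T.faces :=
  hle ⟨s, hs, rfl⟩

include he in
theorem injOn_face {s : Finset V} (hs : s ∈ K.faces) : Set.InjOn e (s : Set V) :=
  he.mono fun _ hx => mem_vertices_of_face hs hx

include he in
theorem image_injOn_faces {s t : Finset V} (hs : s ∈ K.faces) (ht : t ∈ K.faces)
    (h : s.image e = t.image e) : s = t := by
  ext x
  constructor
  · intro hx
    have : e x ∈ t.image e := h ▸ Finset.mem_image_of_mem e hx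
    obtain ⟨y, hy, hxy⟩ := Finset.mem_image.1 this
    rwa [← he (mem_vertices_of_face ht hy) (mem_vertices_of_face hs hx) hxy]
  · intro hx
    have : e x ∈ s.image e := h ▸ Finset.mem_image_of_mem e hx
    obtain ⟨y, hy, hxy⟩ := Finset.mem_image.1 this
    rwa [← he (mem_vertices_of_face hs hy) (mem_vertices_of_face ht hx) hxy]

include he hle in
theorem image_mem_triangles {s : Finset V} (hs : s ∈ triangles K) : s.image e ∈ triangles T :=
  ⟨image_mem_faces hle hs.1, by rw [Finset.card_image_of_injOn (injOn_face he hs.1), hs.2]⟩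

include hT he hle in
theorem card_le_three_of_embedded {s : Finset V} (hs : s ∈ K.faces) : s.card ≤ 3 := by
  obtain ⟨x, hx⟩ := face_nonempty hs
  have h1 := image_mem_faces hle hs
  obtain ⟨k, c, hc⟩ := hT.interior (e x) (mem_vertices_of_face h1 (Finset.mem_image_of_mem e hx))
  rw [← Finset.card_image_of_injOn (injOn_face he hs)]
  exact hc.card_le h1 (Finset.mem_image_of_mem e hx)

include he hle in
/-- The link of `e x` in the plane is the image of the triangles of a closed subset of the
star of `x`. -/
theorem forall_exists_image_eq {x : V} {k : ℕ} {c : Fin k → P} (hc : IsLinkCycle T (e x) c)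
    {S : Set (Finset V)} (hS : S ⊆ triangles K) (hne : S.Nonempty)
    (ha : ∀ t ∈ S, x ∈ t) (hcl : ∀ s ∈ S, ∀ y ∈ s, y ≠ x → ∃ t ∈ S, t ≠ s ∧ y ∈ t) (i : Fin k) :
    ∃ t ∈ S, t.image e = {e x, c i, c (finRotate k i)} := by
  refine hc.forall_triangle_mem (S := (fun t : Finset V => t.image e) '' S) ?_ (hne.image _) ?_ ?_ i
  · rintro _ ⟨t, ht, rfl⟩
    exact image_mem_triangles he hle (hS ht)
  · rintro _ ⟨t, ht, rfl⟩
    exact Finset.mem_image_of_mem e (ha t ht)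
  · rintro _ ⟨s, hs, rfl⟩ z hz hzx
    obtain ⟨y, hy, rfl⟩ := Finset.mem_image.1 hz
    obtain ⟨t, ht, hts, hyt⟩ := hcl s hs y hy (fun h => hzx (h ▸ rfl))
    exact ⟨_, ⟨t, ht, rfl⟩, fun h => hts (image_injOn_faces he (hS ht).1 (hS hs).1 h),
      Finset.mem_image_of_mem e hyt⟩

include hT he hle in
-- The image of `S` is closed under adjacency around `e x`, so it exhausts the star of `e x` in the
-- plane. As `e` is injective on vertices, the link circle pulls back to `K`, and no face of `K` at
-- `x` is left over.
theorem starRigid_of_embedded : StarRigid K := by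
  intro x S hS hne hx hcl
  obtain ⟨s₀, hs₀⟩ := hne
  have hxv : x ∈ vertices K := mem_vertices_of_face (hS hs₀).1 (hx _ hs₀)
  obtain ⟨k, c, hc⟩ := hT.interior (e x) (by simpa [vertices] using image_mem_faces hle hxv)
  have key := forall_exists_image_eq he hle hc hS ⟨s₀, hs₀⟩ hx hcl
  choose t htS ht using key
  have hpre : ∀ i, ∃ y, y ∈ t i ∧ e y = c i := fun i => by
    have : c i ∈ (t i).image e := by rw [ht]; simp
    simpa using this
  choose c' hc't hc' using hpre
  have hcv : ∀ i, c' i ∈ vertices K := fun i => mem_vertices_of_face (hS (htS i)).1 (hc't i)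
  have hteq : ∀ i, t i = {x, c' i, c' (finRotate k i)} := by
    intro i
    obtain ⟨y, hy, hy'⟩ : ∃ y, y ∈ t i ∧ e y = c (finRotate k i) := by
      have : c (finRotate k i) ∈ (t i).image e := by rw [ht]; simp
      simpa using this
    have hye : y = c' (finRotate k i) :=
      he (mem_vertices_of_face (hS (htS i)).1 hy) (hcv _) (hy'.trans (hc' _).symm)
    refine (Finset.eq_of_subset_of_card_le (t := t i) ?_ ?_).symm
    · intro z hz
      simp only [Finset.mem_insert, Finset.mem_singleton] at hz
      rcases hz with rfl | rfl | rfl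
      · exact hx _ (htS i)
      · exact hc't i
      · exact hye ▸ hy
    · have h3 := (hc.triangle_mem i).2
      rw [(hS (htS i)).2, ← h3]
      refine (Finset.card_le_card (t := ({x, c' i, c' (finRotate k i)} : Finset V).image e)
        ?_).trans Finset.card_image_le
      intro z hz
      simpa [hc', Finset.image_insert] using hz
  refine ⟨⟨k, c', hc.three_le, fun i j h => hc.injective (by rw [← hc', ← hc', h]),
    fun i h => hc.ne i (by rw [← hc', h]), fun s hs => ⟨fun hsK => ?_, ?_⟩⟩, fun s hs hxs => ?_⟩
  · have h1 := image_mem_faces hle hsK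
    have sub : ∀ s' ∈ K.faces, s.image e = s'.image e → s = s' :=
      fun s' hs' => image_injOn_faces he hsK hs'
    rcases (hc.mem_faces_iff _ (Finset.mem_image_of_mem e hs)).1 h1 with h | ⟨i, h | h⟩
    · left
      exact sub _ hxv (by simpa using h)
    · right
      refine ⟨i, .inl (sub _ (face_mono (hS (htS i)).1 ?_ ⟨x, by simp⟩) ?_)⟩
      · rw [hteq]; intro z; simp; tauto
      · simpa [Finset.image_insert, hc'] using h
    · right
      refine ⟨i, .inr (sub _ (hteq i ▸ (hS (htS i)).1) ?_)⟩
      simpa [Finset.image_insert, hc'] using h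
  · rintro (rfl | ⟨i, rfl | rfl⟩)
    · exact hxv
    · refine face_mono (hS (htS i)).1 ?_ ⟨x, by simp⟩
      rw [hteq]; intro z; simp; tauto
    · exact hteq i ▸ (hS (htS i)).1
  · obtain ⟨i, hi⟩ := hc.exists_eq (image_mem_triangles he hle hs) (Finset.mem_image_of_mem e hxs)
    rw [image_injOn_faces he hs.1 (hS (htS i)).1 (hi.trans (ht i).symm)]
    exact htS i

/-- A sum with exactly one nonzero term cannot vanish. -/
theorem exists_ne_of_edgeSum_eq_zero {R : Type*} [AddCommMonoid R] (hfin : K.faces.Finite)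
    {f : Finset V → R} {x y : V} (h : edgeSum K f x y = 0) {s : Finset V} (hs : s ∈ triangles K)
    (hx : x ∈ s) (hy : y ∈ s) (hf : f s ≠ 0) :
    ∃ t ∈ triangles K, t ≠ s ∧ x ∈ t ∧ y ∈ t ∧ f t ≠ 0 := by
  by_contra hcon
  push Not at hcon
  refine hf ?_
  rw [← h, edgeSum]
  refine (Finset.sum_eq_single s ?_ ?_).symm
  · intro t ht hts
    rw [Finset.mem_filter, mem_triF hfin] at ht
    exact hcon t ht.1 hts ht.2.1 ht.2.2
  · intro hs'
    exact absurd (Finset.mem_filter.2 ⟨(mem_triF hfin).2 hs, hx, hy⟩) hs'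

include hT he hle in
-- Around each vertex of its support a 2-cycle fills the whole star in the plane. So the vertex set
-- `A` of the support is closed under adjacency in `T` and, by connectedness, contains every vertex;
-- but `A` is finite and `T` is infinite.
theorem noCycle_of_embedded (hfin : K.faces.Finite) : NoCycle K := by
  intro f hf t₀ ht₀
  by_contra h₀
  set S : Set (Finset V) := {t | t ∈ triangles K ∧ f t ≠ 0} with hSdef
  set A : Set P := {p | ∃ t ∈ S, p ∈ t.image e} with hA
  have hstep : ∀ p q, (graph T).Adj p q → p ∈ A → q ∈ A := by
    rintro p q hpq ⟨t, htS, hpt⟩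
    obtain ⟨x, hx, rfl⟩ := Finset.mem_image.1 hpt
    obtain ⟨k, c, hc⟩ := hT.interior (e x)
      (mem_vertices_of_face (image_mem_faces hle htS.1.1) hpt)
    have key := forall_exists_image_eq he hle hc (S := {t | t ∈ S ∧ x ∈ t}) (fun t ht => ht.1.1)
      ⟨t, htS, hx⟩ (fun t ht => ht.2) (by
        rintro s ⟨hs, hxs⟩ y hy hyx
        obtain ⟨t, ht, hts, hxt, hyt, hft⟩ := exists_ne_of_edgeSum_eq_zero hfin
          (hf x y (adj_of_face hs.1.1 hxs hy hyx.symm)) hs.1 hxs hy hs.2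
        exact ⟨t, ⟨⟨ht, hft⟩, hxt⟩, hts, hyt⟩)
    obtain ⟨i, rfl⟩ := hc.exists_of_adj hpq
    obtain ⟨t', ht', h⟩ := key i
    exact ⟨t', ht'.1, by rw [h]; simp⟩
  have hfinA : A.Finite := by
    have : A ⊆ ⋃ t ∈ triangles K, ((t.image e : Finset P) : Set P) := by
      rintro p ⟨t, ht, hp⟩
      simp only [Set.mem_iUnion]
      exact ⟨t, ht.1, hp⟩
    refine Set.Finite.subset (Set.Finite.biUnion (hfin.subset fun _ h => h.1) ?_) this
    intro t _
    exact Finset.finite_toSet _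
  obtain ⟨x₀, hx₀⟩ := face_nonempty ht₀.1
  have hp₀ : e x₀ ∈ A := ⟨t₀, ⟨ht₀, h₀⟩, Finset.mem_image_of_mem e hx₀⟩
  have hp₀v : e x₀ ∈ vertices T :=
    mem_vertices_of_face (image_mem_faces hle ht₀.1) (Finset.mem_image_of_mem e hx₀)
  refine hT.infinite (hfinA.subset fun p hp => ?_)
  obtain ⟨w⟩ := hT.simplyConnected.connected _ hp₀v _ hp
  clear hp hp₀v
  generalize e x₀ = p₀ at w hp₀
  induction w with
  | nil => exact hp₀
  | cons h w ih => exact ih (hstep _ _ h hp₀)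

end Embedded

theorem IsSingularDisc.card_le (hK : IsSingularDisc K) {s : Finset V} (hs : s ∈ K.faces) :
    s.card ≤ 3 := by
  obtain ⟨P, T, e, hT, he, hle⟩ := hK.planar
  exact card_le_three_of_embedded hT he hle hs

theorem IsSingularDisc.starRigid (hK : IsSingularDisc K) : StarRigid K := by
  obtain ⟨P, T, e, hT, he, hle⟩ := hK.planar
  exact starRigid_of_embedded hT he hle

theorem IsSingularDisc.noCycle (hK : IsSingularDisc K) : NoCycle K := by
  obtain ⟨P, T, e, hT, he, hle⟩ := hK.planar
  exact noCycle_of_embedded hT he hle hK.finite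

end Planar

/-! ### Gluing an infinite collar to the boundary of a disc -/

section CollarComplex

/-- A parametrization of the boundary of `K`: every edge has two sides, each of which is occupied by
a triangle or is passed once by `v`. -/
structure IsBoundaryParam {V : Type u} (K : PreAbstractSimplicialComplex V) {n : ℕ} [NeZero n]
    (v : ZMod n → V) : Prop where
  three_le : 3 ≤ n
  edge : ∀ i, (graph K).Adj (v i) (v (i + 1))
  count : ∀ x y, (graph K).Adj x y →
    (Finset.univ.filter fun i => s(v i, v (i + 1)) = s(x, y)).card +
      edgeSum K (fun _ => 1) x y = 2

/-- The vertices of a complex with an infinite collar attached. -/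
inductive Collar (V : Type u) (n : ℕ) : Type u
  | base : V → Collar V n
  | new : ZMod n → ℕ → Collar V n

open Collar

variable {V : Type u} {K : PreAbstractSimplicialComplex V} {n : ℕ} {v : ZMod n → V}

/-- The vertices of the collar, including those of the curve along which it is attached. -/
def Collar.pos (v : ZMod n → V) (i : ZMod n) : ℕ → Collar V n
  | 0 => base (v i)
  | j + 1 => new i j

/-- The distance of a vertex from the base. -/
def Collar.level : Collar V n → ℕ
  | base _ => 0
  | new _ j => j + 1

@[simp] theorem Collar.level_pos (i : ZMod n) (j : ℕ) : (pos v i j).level = j := by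
  cases j <;> rfl

/-- The triangles of the collar pointing outwards. -/
def upTri (v : ZMod n → V) (i : ZMod n) (j : ℕ) : Finset (Collar V n) :=
  {pos v i j, pos v (i + 1) j, pos v i (j + 1)}

/-- The triangles of the collar pointing inwards. -/
def downTri (v : ZMod n → V) (i : ZMod n) (j : ℕ) : Finset (Collar V n) :=
  {pos v (i + 1) j, pos v i (j + 1), pos v (i + 1) (j + 1)}

variable (K v) in
/-- The complex `K` with an infinite cylinder glued along `v`. -/
def collarComplex : PreAbstractSimplicialComplex (Collar V n) where
  faces := {s | (∃ t ∈ K.faces, s = t.image base) ∨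
    (s.Nonempty ∧ ∃ i j, s ⊆ upTri v i j ∨ s ⊆ downTri v i j)}
  isRelLowerSet_faces := by
    rintro s (⟨t, ht, rfl⟩ | ⟨hs, i, j, h⟩)
    · refine ⟨(face_nonempty ht).image _, fun s' hs' hne => ?_⟩
      obtain ⟨t', ht', rfl⟩ := Finset.subset_image_iff.1 hs'
      exact .inl ⟨t', face_mono ht ht' (Finset.image_nonempty.1 hne), rfl⟩
    · exact ⟨hs, fun s' hs' hne => .inr ⟨hne, i, j, h.imp hs'.trans hs'.trans⟩⟩

theorem collar_face_of_subset_up {s : Finset (Collar V n)} (hs : s.Nonempty) {i : ZMod n} {j : ℕ}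
    (h : s ⊆ upTri v i j) : s ∈ (collarComplex K v).faces := .inr ⟨hs, i, j, .inl h⟩

theorem collar_face_of_subset_down {s : Finset (Collar V n)} (hs : s.Nonempty) {i : ZMod n} {j : ℕ}
    (h : s ⊆ downTri v i j) : s ∈ (collarComplex K v).faces := .inr ⟨hs, i, j, .inr h⟩

theorem upTri_mem (i : ZMod n) (j : ℕ) : upTri v i j ∈ (collarComplex K v).faces :=
  collar_face_of_subset_up ⟨_, Finset.mem_insert_self _ _⟩ subset_rfl

theorem downTri_mem (i : ZMod n) (j : ℕ) : downTri v i j ∈ (collarComplex K v).faces :=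
  collar_face_of_subset_down ⟨_, Finset.mem_insert_self _ _⟩ subset_rfl

theorem collar_face_of_new_mem {s : Finset (Collar V n)} (hs : s ∈ (collarComplex K v).faces)
    {i : ZMod n} {j : ℕ} (h : new i j ∈ s) : ∃ i j, s ⊆ upTri v i j ∨ s ⊆ downTri v i j := by
  rcases hs with ⟨t, -, rfl⟩ | ⟨-, h⟩
  · simp at h
  · exact h

section Param

variable [NeZero n] (hv : IsBoundaryParam K v)
include hv

theorem IsBoundaryParam.one_ne_zero : (1 : ZMod n) ≠ 0 := by
  have : Fact (1 < n) := ⟨by have := hv.three_le; omega⟩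
  exact _root_.one_ne_zero

theorem IsBoundaryParam.two_ne_zero : (2 : ZMod n) ≠ 0 := by
  intro h
  have h1 : ((2 : ℕ) : ZMod n) = 0 := by exact_mod_cast h
  rw [ZMod.natCast_eq_zero_iff] at h1
  have := Nat.le_of_dvd (by norm_num) h1
  have := hv.three_le
  omega

theorem pos_ne_pos_succ (i : ZMod n) (j : ℕ) : pos v i j ≠ pos v (i + 1) j := by
  cases j with
  | zero => intro h; exact (hv.edge i).1 (by injection h)
  | succ j =>
    intro h
    injection h with h
    exact hv.one_ne_zero (left_eq_add.1 h)

omit hv [NeZero n] in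
theorem pos_ne_of_ne (i i' : ZMod n) {j j' : ℕ} (h : j ≠ j') : pos v i j ≠ pos v i' j' := by
  intro e
  exact h (by simpa using congrArg level e)

theorem adj_collar_horizontal (i : ZMod n) (j : ℕ) :
    (graph (collarComplex K v)).Adj (pos v i j) (pos v (i + 1) j) :=
  adj_of_face (upTri_mem i j) (by simp [upTri]) (by simp [upTri]) (pos_ne_pos_succ hv i j)

omit hv [NeZero n] in
theorem adj_collar_vertical (i : ZMod n) (j : ℕ) :
    (graph (collarComplex K v)).Adj (pos v i j) (pos v i (j + 1)) :=
  adj_of_face (upTri_mem i j) (by simp [upTri]) (by simp [upTri]) (pos_ne_of_ne _ _ (by simp))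

omit hv [NeZero n] in
theorem adj_collar_diagonal (i : ZMod n) (j : ℕ) :
    (graph (collarComplex K v)).Adj (pos v (i + 1) j) (pos v i (j + 1)) :=
  adj_of_face (upTri_mem i j) (by simp [upTri]) (by simp [upTri]) (pos_ne_of_ne _ _ (by simp))

/-- The collar adds no simplex between old vertices: a collar triangle meets the base within an edge
`v i`, `v (i + 1)`, which already belongs to `K`. -/
theorem base_image_mem_collar {s : Finset V} :
    s.image base ∈ (collarComplex K v).faces ↔ s ∈ K.faces := by
  constructor
  · rintro (⟨t, ht, h⟩ | ⟨hs, i, j, h⟩)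
    · have : s = t := Finset.image_injective (fun _ _ h => by injection h) h
      exact this ▸ ht
    · have hsub : s ⊆ {v i, v (i + 1)} := by
        intro x hx
        have hx' : (base x : Collar V n) ∈ s.image base := Finset.mem_image_of_mem _ hx
        rcases h with h | h <;> have h1 := h hx' <;> cases j <;>
          simp [upTri, downTri, pos] at h1 ⊢ <;> tauto
      exact face_mono (hv.edge i).2 hsub (Finset.image_nonempty.1 hs)
  · exact fun h => .inl ⟨s, h, rfl⟩

theorem adj_collar_base {x y : V} :
    (graph (collarComplex K v)).Adj (base x) (base y) ↔ (graph K).Adj x y := by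
  have := base_image_mem_collar hv (s := {x, y})
  rw [Finset.image_insert, Finset.image_singleton] at this
  simp only [graph_adj, this, ne_eq, base.injEq]

omit hv [NeZero n] in
theorem collar_adj_cases {x y : Collar V n} (h : (graph (collarComplex K v)).Adj x y) :
    (∃ a b, (graph K).Adj a b ∧ x = base a ∧ y = base b) ∨
      ∃ i j, (x ∈ upTri v i j ∧ y ∈ upTri v i j) ∨ (x ∈ downTri v i j ∧ y ∈ downTri v i j) := by
  rcases h.2 with ⟨t, ht, e⟩ | ⟨-, i, j, e⟩
  · left
    have hx : x ∈ t.image base := e ▸ (by simp)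
    have hy : y ∈ t.image base := e ▸ (by simp)
    obtain ⟨a, ha, rfl⟩ := Finset.mem_image.1 hx
    obtain ⟨b, hb, rfl⟩ := Finset.mem_image.1 hy
    exact ⟨a, b, adj_of_face ht ha hb (fun h' => h.1 (h' ▸ rfl)), rfl, rfl⟩
  · right
    exact ⟨i, j, e.imp (fun e => ⟨e (by simp), e (by simp)⟩) fun e => ⟨e (by simp), e (by simp)⟩⟩

/-- A primitive on `K` is integrated upwards along the vertical edges. The two triangles of each
square then carry the relation from the lower horizontal edge to the diagonal, and from there to the
upper horizontal edge, level by level. -/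
theorem collar_exists_primitive (hK : IsSimplyConnected K) {H : Type*} [Group H]
    {g : Collar V n → Collar V n → H} (hg : IsCocycle (collarComplex K v) g) :
    ∃ h, IsPrimitive (collarComplex K v) g h := by
  have hg0 : IsCocycle K fun x y => g (base x) (base y) := by
    constructor
    · intro x y h
      exact hg.inv _ _ ((adj_collar_base hv).2 h)
    · intro x y z h1 h2 h3 hf
      refine hg.mul _ _ _ ((adj_collar_base hv).2 h1) ((adj_collar_base hv).2 h2)
        ((adj_collar_base hv).2 h3) ?_
      have := (base_image_mem_collar hv).2 hf
      simpa [Finset.image_insert] using this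
  obtain ⟨h₀, hh₀⟩ := hK.exists_primitive hg0
  let F : ZMod n → ℕ → H := fun i j =>
    Nat.rec (h₀ (v i)) (fun j y => y * g (pos v i j) (pos v i (j + 1))) j
  let h : Collar V n → H := fun x => match x with
    | base x => h₀ x
    | new i j => F i (j + 1)
  have hF : ∀ i j, h (pos v i j) = F i j := by
    intro i j
    cases j <;> rfl
  have symm : ∀ {x y}, (graph (collarComplex K v)).Adj x y → h y = h x * g x y →
      h x = h y * g y x := by
    intro x y hxy e
    rw [e, mul_assoc, hg.inv _ _ hxy, mul_one]
  have tr : ∀ {x y z}, (graph (collarComplex K v)).Adj x y → (graph (collarComplex K v)).Adj y z →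
      (graph (collarComplex K v)).Adj x z → ({x, y, z} : Finset _) ∈ (collarComplex K v).faces →
      h y = h x * g x y → h z = h y * g y z → h z = h x * g x z := by
    intro x y z h1 h2 h3 hf e1 e2
    rw [e2, e1, mul_assoc, hg.mul _ _ _ h1 h2 h3 hf]
  have vert : ∀ i j, h (pos v i (j + 1)) = h (pos v i j) * g (pos v i j) (pos v i (j + 1)) := by
    intro i j
    rw [hF, hF]
  have diag_of : ∀ i j,
      h (pos v (i + 1) j) = h (pos v i j) * g (pos v i j) (pos v (i + 1) j) →
      h (pos v i (j + 1)) = h (pos v (i + 1) j) * g (pos v (i + 1) j) (pos v i (j + 1)) := by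
    intro i j e
    refine tr (adj_collar_horizontal hv i j).symm (adj_collar_vertical i j)
      (adj_collar_diagonal i j) ?_ (symm (adj_collar_horizontal hv i j) e) (vert i j)
    have := upTri_mem (K := K) (v := v) i j
    rw [upTri, Finset.insert_comm] at this
    exact this
  have horiz : ∀ j i, h (pos v (i + 1) j) = h (pos v i j) * g (pos v i j) (pos v (i + 1) j) := by
    intro j
    induction j with
    | zero => exact fun i => hh₀ _ _ (hv.edge i)
    | succ j ih =>
      intro i
      refine tr (adj_collar_diagonal i j).symm (adj_collar_vertical (i + 1) j)
        (adj_collar_horizontal hv i (j + 1)) ?_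
        (symm (adj_collar_diagonal i j) (diag_of i j (ih i))) (vert (i + 1) j)
      have := downTri_mem (K := K) (v := v) i j
      rw [downTri, Finset.insert_comm] at this
      exact this
  have diag := fun i j => diag_of i j (horiz j i)
  refine ⟨h, fun x y hxy => ?_⟩
  rcases collar_adj_cases hxy with ⟨a, b, hab, rfl, rfl⟩ | ⟨i, j, ⟨hx, hy⟩ | ⟨hx, hy⟩⟩
  · exact hh₀ _ _ hab
  · simp only [upTri, Finset.mem_insert, Finset.mem_singleton] at hx hy
    rcases hx with rfl | rfl | rfl <;> rcases hy with rfl | rfl | rfl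
    · exact absurd rfl hxy.1
    · exact horiz j i
    · exact vert i j
    · exact symm hxy.symm (horiz j i)
    · exact absurd rfl hxy.1
    · exact diag i j
    · exact symm hxy.symm (vert i j)
    · exact symm hxy.symm (diag i j)
    · exact absurd rfl hxy.1
  · simp only [downTri, Finset.mem_insert, Finset.mem_singleton] at hx hy
    rcases hx with rfl | rfl | rfl <;> rcases hy with rfl | rfl | rfl
    · exact absurd rfl hxy.1
    · exact diag i j
    · exact vert (i + 1) j
    · exact symm hxy.symm (diag i j)
    · exact absurd rfl hxy.1
    · exact horiz (j + 1) i
    · exact symm hxy.symm (vert (i + 1) j)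
    · exact symm hxy.symm (horiz (j + 1) i)
    · exact absurd rfl hxy.1

theorem pos_mem_vertices (i : ZMod n) (j : ℕ) : pos v i j ∈ vertices (collarComplex K v) :=
  mem_vertices_of_adj (adj_collar_horizontal hv i j)

theorem collar_isSimplyConnected (hK : IsSimplyConnected K) :
    IsSimplyConnected (collarComplex K v) := by
  refine isSimplyConnected_of_exists_primitive ⟨_, pos_mem_vertices hv 0 0⟩ ?_
    fun H _ g hg => collar_exists_primitive hv hK hg
  have h1 : ∀ x ∈ vertices (collarComplex K v), ∃ y ∈ vertices K,
      (graph (collarComplex K v)).Reachable x (base y) := by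
    intro x hx
    cases x with
    | base y =>
      refine ⟨y, (base_image_mem_collar hv (s := {y})).1 ?_, .refl _⟩
      simpa [vertices] using hx
    | new i j =>
      refine ⟨v i, mem_vertices_of_adj (hv.edge i), ?_⟩
      have : ∀ j, (graph (collarComplex K v)).Reachable (pos v i j) (pos v i 0) := by
        intro j
        induction j with
        | zero => exact .refl _
        | succ j ih => exact (adj_collar_vertical i j).symm.reachable.trans ih
      exact this (j + 1)
  intro x hx y hy
  obtain ⟨x', hx', hxx⟩ := h1 x hx
  obtain ⟨y', hy', hyy⟩ := h1 y hy
  refine hxx.trans (SimpleGraph.Reachable.trans ?_ hyy.symm)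
  exact reachable_of_forall_adj (φ := base)
    (fun a b h => ((adj_collar_base hv).2 h).reachable) (hK.connected x' hx' y' hy')

omit hv [NeZero n] in
theorem collar_image_le : K.map (base (n := n)) ≤ collarComplex K v := by
  rintro _ ⟨t, ht, rfl⟩
  exact .inl ⟨t, ht, rfl⟩

theorem collar_infinite : (vertices (collarComplex K v)).Infinite := by
  refine Set.infinite_of_injective_forall_mem (f := fun j : ℕ => pos v 0 j) ?_
    fun j => pos_mem_vertices hv 0 j
  intro j j' h
  simpa using congrArg level h

/-- The link of a new vertex of the collar. -/
theorem collar_isInterior_new (i : ZMod n) (j : ℕ) :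
    IsInterior (collarComplex K v) (new i j) := by
  have e1 : i - 1 + 1 = i := sub_add_cancel i 1
  -- The vertex `new i j` is `pos v i (j + 1)`; its link is a hexagon with two vertices below, two
  -- on the same level and two above.
  refine ⟨6, ![pos v i j, pos v (i + 1) j, pos v (i + 1) (j + 1), pos v i (j + 2),
    pos v (i - 1) (j + 2), pos v (i - 1) (j + 1)], by norm_num, ?_, ?_, ?_⟩
  · have h1 := pos_ne_pos_succ hv i j
    have h2 := pos_ne_pos_succ hv (i - 1) (j + 2)
    rw [e1] at h2
    -- The neighbours on the two sides differ because `2 ≠ 0` modulo `n`; here boundary length at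
    -- least three is needed.
    have h3 : pos v (i + 1) (j + 1) ≠ pos v (i - 1) (j + 1) := by
      intro h
      injection h with h
      exact hv.two_ne_zero (by linear_combination h)
    have h01 := fun a b => pos_ne_of_ne (v := v) a b (show j ≠ j + 1 by omega)
    have h02 := fun a b => pos_ne_of_ne (v := v) a b (show j ≠ j + 2 by omega)
    have h12 := fun a b => pos_ne_of_ne (v := v) a b (show j + 1 ≠ j + 2 by omega)
    have h10 := fun a b => (h01 a b).symm
    have h20 := fun a b => (h02 a b).symm
    have h21 := fun a b => (h12 a b).symm
    intro a b hab
    fin_cases a <;> fin_cases b <;>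
      first
      | rfl
      | (exfalso; revert hab; simp [h1, h2, h3, h1.symm, h2.symm, h3.symm, h01, h02, h12, h10,
          h20, h21])
  · intro a h
    have h0 := congrArg level (show _ = pos v i (j + 1) from h)
    have hne : ∀ i' : ZMod n, i' ≠ i → pos v i' (j + 1) ≠ new i j := by
      intro i' hi h
      injection h with h
      exact hi h
    have hp : i + 1 ≠ i := by simpa using hv.one_ne_zero
    have hm : i - 1 ≠ i := by simpa using hv.one_ne_zero
    fin_cases a
    · simp at h0
    · simp at h0
    · exact hne _ hp h
    · simp at h0
    · simp at h0
    · exact hne _ hm h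
  · intro s hs
    have tri : ∀ y z : Collar V n, s ⊆ {new i j, y, z} → s = {new i j} ∨ s = {new i j, y} ∨
        s = {new i j, z} ∨ s = {new i j, y, z} := by
      intro y z h
      by_cases hy : y ∈ s <;> by_cases hz : z ∈ s
      · right; right; right
        refine h.antisymm ?_
        intro w; simp only [Finset.mem_insert, Finset.mem_singleton]
        rintro (rfl | rfl | rfl) <;> assumption
      · right; left
        ext w
        simp only [Finset.mem_insert, Finset.mem_singleton]
        refine ⟨fun hw => ?_, ?_⟩
        · have := h hw
          simp only [Finset.mem_insert, Finset.mem_singleton] at this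
          rcases this with rfl | rfl | rfl <;> tauto
        · rintro (rfl | rfl) <;> assumption
      · right; right; left
        ext w
        simp only [Finset.mem_insert, Finset.mem_singleton]
        refine ⟨fun hw => ?_, ?_⟩
        · have := h hw
          simp only [Finset.mem_insert, Finset.mem_singleton] at this
          rcases this with rfl | rfl | rfl <;> tauto
        · rintro (rfl | rfl) <;> assumption
      · left
        ext w
        simp only [Finset.mem_singleton]
        refine ⟨fun hw => ?_, ?_⟩
        · have := h hw
          simp only [Finset.mem_insert, Finset.mem_singleton] at this
          rcases this with rfl | rfl | rfl <;> tauto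
        · rintro rfl; assumption
    set c : Fin 6 → Collar V n := ![pos v i j, pos v (i + 1) j, pos v (i + 1) (j + 1),
      pos v i (j + 2), pos v (i - 1) (j + 2), pos v (i - 1) (j + 1)] with hc
    have fin : ∀ a : Fin 6, s ⊆ {new i j, c a, c (finRotate 6 a)} →
        s = {new i j} ∨ ∃ a, s = {new i j, c a} ∨ s = {new i j, c a, c (finRotate 6 a)} := by
      intro a h
      rcases tri _ _ h with h | h | h | h
      · exact .inl h
      · exact .inr ⟨a, .inl h⟩
      · exact .inr ⟨_, .inl h⟩
      · exact .inr ⟨a, .inr h⟩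
    have t0 : ({new i j, c 0, c (finRotate 6 0)} : Finset (Collar V n)) = upTri v i j := by
      rw [show finRotate 6 0 = 1 from rfl]
      ext w; simp [hc, upTri, pos]; tauto
    have t1 : ({new i j, c 1, c (finRotate 6 1)} : Finset (Collar V n)) = downTri v i j := by
      rw [show finRotate 6 1 = 2 from rfl]
      ext w; simp [hc, downTri, pos]; tauto
    have t2 : ({new i j, c 2, c (finRotate 6 2)} : Finset (Collar V n)) = upTri v i (j + 1) := by
      rw [show finRotate 6 2 = 3 from rfl]
      ext w; simp [hc, upTri, pos]
    have t3 : ({new i j, c 3, c (finRotate 6 3)} : Finset (Collar V n)) =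
        downTri v (i - 1) (j + 1) := by
      rw [show finRotate 6 3 = 4 from rfl]
      ext w; simp [hc, downTri, pos]; tauto
    have t4 : ({new i j, c 4, c (finRotate 6 4)} : Finset (Collar V n)) =
        upTri v (i - 1) (j + 1) := by
      rw [show finRotate 6 4 = 5 from rfl]
      ext w; simp [hc, upTri, pos]; tauto
    have t5 : ({new i j, c 5, c (finRotate 6 5)} : Finset (Collar V n)) = downTri v (i - 1) j := by
      rw [show finRotate 6 5 = 0 from rfl]
      ext w; simp [hc, downTri, pos]; tauto
    constructor
    · intro h
      obtain ⟨i', j', h' | h'⟩ := collar_face_of_new_mem h hs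
      · have hm := h' hs
        simp only [upTri, Finset.mem_insert, Finset.mem_singleton] at hm
        rcases hm with hm | hm | hm
        · cases j' with
          | zero => simp [pos] at hm
          | succ j' =>
            simp only [pos, new.injEq] at hm
            obtain ⟨rfl, rfl⟩ := hm
            exact fin 2 (t2 ▸ h')
        · cases j' with
          | zero => simp [pos] at hm
          | succ j' =>
            simp only [pos, new.injEq] at hm
            obtain ⟨rfl, rfl⟩ := hm
            rw [add_sub_cancel_right] at t4
            exact fin 4 (t4 ▸ h')
        · simp only [pos, new.injEq] at hm
          obtain ⟨rfl, rfl⟩ := hm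
          exact fin 0 (t0 ▸ h')
      · have hm := h' hs
        simp only [downTri, Finset.mem_insert, Finset.mem_singleton] at hm
        rcases hm with hm | hm | hm
        · cases j' with
          | zero => simp [pos] at hm
          | succ j' =>
            simp only [pos, new.injEq] at hm
            obtain ⟨rfl, rfl⟩ := hm
            rw [add_sub_cancel_right] at t3
            exact fin 3 (t3 ▸ h')
        · simp only [pos, new.injEq] at hm
          obtain ⟨rfl, rfl⟩ := hm
          exact fin 1 (t1 ▸ h')
        · simp only [pos, new.injEq] at hm
          obtain ⟨rfl, rfl⟩ := hm
          rw [add_sub_cancel_right] at t5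
          exact fin 5 (t5 ▸ h')
    · have all : ∀ a, ({new i j, c a, c (finRotate 6 a)} : Finset (Collar V n)) ∈
          (collarComplex K v).faces := by
        intro a
        fin_cases a
        · exact t0 ▸ upTri_mem i j
        · exact t1 ▸ downTri_mem i j
        · exact t2 ▸ upTri_mem i (j + 1)
        · exact t3 ▸ downTri_mem (i - 1) (j + 1)
        · exact t4 ▸ upTri_mem (i - 1) (j + 1)
        · exact t5 ▸ downTri_mem (i - 1) j
      rintro (rfl | ⟨a, rfl | rfl⟩)
      · exact face_mono (all 0) (by simp) ⟨new i j, by simp⟩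
      · refine face_mono (all a) ?_ ⟨_, Finset.mem_insert_self _ _⟩
        intro w; simp only [Finset.mem_insert, Finset.mem_singleton]; tauto
      · exact all a

end Param
end CollarComplex

/-! ### Recognizing link cycles -/

section LinkGraph

variable {P : Type u} {T : PreAbstractSimplicialComplex P} {a : P}

variable (T a) in
/-- The link of a vertex, as a graph on the set of its neighbours. -/
def linkGraph : SimpleGraph {y // (graph T).Adj a y} where
  Adj y z := ({a, y.1, z.1} : Finset P) ∈ triangles T
  symm := ⟨fun y z h => by rw [Finset.pair_comm]; exact h⟩
  loopless := ⟨fun y h => by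
    have h1 := h.2
    have h2 := Finset.card_le_two (a := a) (b := y.1)
    rw [Finset.pair_eq_singleton] at h1
    omega⟩

theorem ne_of_triangle {x y z : P} (h : ({x, y, z} : Finset P) ∈ triangles T) :
    x ≠ y ∧ x ≠ z ∧ y ≠ z := by
  have h1 := h.2
  refine ⟨?_, ?_, ?_⟩ <;> rintro rfl
  · rw [Finset.insert_idem] at h1
    have h2 := Finset.card_le_two (a := x) (b := z)
    omega
  · rw [Finset.pair_comm, Finset.insert_idem] at h1
    have h2 := Finset.card_le_two (a := x) (b := y)
    omega
  · rw [Finset.pair_eq_singleton] at h1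
    have h2 := Finset.card_le_two (a := x) (b := y)
    omega

/-- A vertex is interior if its link is finite, connected and 2-regular. -/
theorem isInterior_of_link (hv : a ∈ vertices T) (hcard : ∀ s ∈ T.faces, a ∈ s → s.card ≤ 3)
    (hfin : {y | (graph T).Adj a y}.Finite) (hne : ∃ y, (graph T).Adj a y)
    (htwo : ∀ y, (graph T).Adj a y → {z | ({a, y, z} : Finset P) ∈ triangles T}.ncard = 2)
    (hconn : ∀ S : Set P, (∀ y ∈ S, (graph T).Adj a y) → S.Nonempty →
      (∀ y ∈ S, ∀ z, ({a, y, z} : Finset P) ∈ triangles T → z ∈ S) →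
      ∀ y, (graph T).Adj a y → y ∈ S) : IsInterior T a := by
  have : Finite {y // (graph T).Adj a y} := hfin
  have hadj : ∀ {y z : P}, ({a, y, z} : Finset P) ∈ triangles T → (graph T).Adj a z := fun h =>
    adj_of_face h.1 (by simp) (by simp) (ne_of_triangle h).2.1
  have himg : ∀ y, Subtype.val '' (linkGraph T a).neighborSet y =
      {z | ({a, y.1, z} : Finset P) ∈ triangles T} := by
    intro y
    ext z
    constructor
    · rintro ⟨z, hz, rfl⟩; exact hz
    · intro hz; exact ⟨⟨z, hadj hz⟩, hz, rfl⟩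
  have hn2 : ∀ y, ((linkGraph T a).neighborSet y).ncard = 2 := by
    intro y
    rw [← Set.ncard_image_of_injective _ Subtype.val_injective, himg]
    exact htwo y.1 y.2
  have hcyc : (linkGraph T a).IsCycles := fun y _ => hn2 y
  obtain ⟨y₀, hy₀⟩ := hne
  -- In a finite 2-regular graph each component is a cycle; by `hconn` the component of `y₀` is the
  -- entire link.
  obtain ⟨p, hp, hverts⟩ := hcyc.exists_cycle_toSubgraph_verts_eq_connectedComponentSupp
    (c := (linkGraph T a).connectedComponentMk ⟨y₀, hy₀⟩) (v := ⟨y₀, hy₀⟩) rfl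
    (Set.nonempty_of_ncard_ne_zero (by rw [hn2]; norm_num))
  have hall : ∀ y, y ∈ p.support := by
    intro y
    rw [← SimpleGraph.Walk.mem_verts_toSubgraph, hverts]
    have := hconn {z | ∃ hz : (graph T).Adj a z, (⟨z, hz⟩ : {y // (graph T).Adj a y}) ∈
      ((linkGraph T a).connectedComponentMk ⟨y₀, hy₀⟩).supp} (fun z hz => hz.1) ⟨y₀, hy₀, rfl⟩ (by
        rintro z ⟨hz, hz'⟩ t ht
        refine ⟨hadj ht, ?_⟩
        have h1 : (linkGraph T a).Adj ⟨t, hadj ht⟩ ⟨z, hz⟩ := (linkGraph T a).symm.symm _ _ ht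
        exact (SimpleGraph.ConnectedComponent.sound h1.reachable).trans hz') y.1 y.2
    exact this.2
  have h3 := hp.three_le_length
  -- For the last index the cyclic successor is `0`, while the walk is at its end point; both give
  -- the base point of the cycle.
  have hrot : ∀ i : Fin p.length, p.getVert (finRotate _ i).val = p.getVert (i.val + 1) := by
    intro i
    obtain ⟨m, hm⟩ : ∃ m, p.length = m + 1 := ⟨p.length - 1, by omega⟩
    by_cases hi : i.val = m
    · have e1 : p.getVert (i.val + 1) = ⟨y₀, hy₀⟩ := by
        rw [hi, ← hm, SimpleGraph.Walk.getVert_length]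
      have e2 : (finRotate _ i).val = 0 := by
        clear e1
        revert i
        rw [hm]
        intro i hi
        rw [show i = Fin.last m from Fin.ext hi, finRotate_last]
        rfl
      rw [e1, e2, SimpleGraph.Walk.getVert_zero]
    · congr 1
      revert i
      rw [hm]
      intro i hi
      exact coe_finRotate_of_ne_last (fun h => hi (by rw [h]; rfl))
  have hc : ∀ i : Fin p.length, ({a, (p.getVert i).1, (p.getVert (finRotate _ i).val).1} : Finset P)
      ∈ triangles T := by
    intro i
    rw [hrot]
    exact p.adj_getVert_succ i.2
  have hidx : ∀ y, (graph T).Adj a y → ∃ i : Fin p.length, y = (p.getVert i).1 := by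
    intro y hy
    obtain ⟨j, hj, hjl⟩ := SimpleGraph.Walk.mem_support_iff_exists_getVert.1 (hall ⟨y, hy⟩)
    by_cases hj' : j = p.length
    · refine ⟨⟨0, by omega⟩, ?_⟩
      rw [hj', SimpleGraph.Walk.getVert_length] at hj
      simp [SimpleGraph.Walk.getVert_zero, hj]
    · exact ⟨⟨j, by omega⟩, by simp [hj]⟩
  refine ⟨p.length, fun i => (p.getVert i).1, h3, ?_, fun i => (p.getVert i).2.1.symm, ?_⟩
  · intro i j hij
    refine Fin.ext (hp.getVert_injOn' ?_ ?_ (Subtype.val_injective hij)) <;>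
      simp only [Set.mem_ofPred_eq] <;> omega
  · intro s hs
    constructor
    · intro hsT
      have h4 := hcard s hsT hs
      have h5 : (s.erase a).card ≤ 2 := by rw [Finset.card_erase_of_mem hs]; omega
      have h6 : s = insert a (s.erase a) := (Finset.insert_erase hs).symm
      interval_cases h7 : (s.erase a).card
      · left
        rw [h6, Finset.card_eq_zero.1 h7]
        rfl
      · right
        obtain ⟨y, hy⟩ := Finset.card_eq_one.1 h7
        rw [hy] at h6
        have hay : a ≠ y := fun e => Finset.notMem_erase a s (by rw [hy, e]; simp)
        obtain ⟨i, hi⟩ := hidx y ⟨hay, h6 ▸ hsT⟩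
        exact ⟨i, .inl (by rw [h6, hi])⟩
      · right
        obtain ⟨y, z, hyz, hy⟩ := Finset.card_eq_two.1 h7
        rw [hy] at h6
        have ht : ({a, y, z} : Finset P) ∈ triangles T :=
          ⟨h6 ▸ hsT, by rw [← h6, ← Finset.card_erase_add_one hs, h7]⟩
        have hay := adj_of_face ht.1 (by simp) (by simp) (ne_of_triangle ht).1
        have hl : (linkGraph T a).Adj ⟨y, hay⟩ ⟨z, hadj ht⟩ := ht
        have : Fintype {y // (graph T).Adj a y} := Fintype.ofFinite _
        -- By 2-regularity the cycle already uses every link edge at the vertices it visits, so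
        -- there are no chords.
        have hl' := (hp.adj_toSubgraph_iff_of_isCycles hcyc
          (p.mem_verts_toSubgraph.2 (hall ⟨y, hay⟩)) ⟨z, hadj ht⟩).2 hl
        obtain ⟨i, hi, hil⟩ := (SimpleGraph.Walk.toSubgraph_adj_iff _).1 hl'
        refine ⟨⟨i, hil⟩, .inr ?_⟩
        rw [hrot, h6]
        rcases Sym2.eq_iff.1 hi with ⟨e1, e2⟩ | ⟨e1, e2⟩
        · simp only [e1, e2]
        · simp only [e1, e2]
          rw [Finset.pair_comm]
    · rintro (rfl | ⟨i, rfl | rfl⟩)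
      · exact hv
      · exact (p.getVert i).2.2
      · exact (hc i).1

end LinkGraph

/-! ### The collared disc is a triangulation of the plane -/

section CollarBase

open Collar

variable {V : Type u} {K : PreAbstractSimplicialComplex V} {n : ℕ} {v : ZMod n → V} [NeZero n]
  (hv : IsBoundaryParam K v)

theorem vertices_finite (hfin : K.faces.Finite) : (vertices K).Finite :=
  Set.Finite.preimage (fun _ _ _ _ h => Finset.singleton_injective h) hfin

theorem ncard_apex {x y : V} (hfin : K.faces.Finite) (hxy : x ≠ y) :
    {z | ({x, y, z} : Finset V) ∈ triangles K}.ncard = edgeSum K (fun _ => 1) x y := by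
  rw [← ncard_edge hfin]
  have hinj : Set.InjOn (fun z => ({x, y, z} : Finset V))
      {z | ({x, y, z} : Finset V) ∈ triangles K} := by
    intro z hz z' hz' h
    have h1 := ne_of_triangle hz
    have h3 : z ∈ ({x, y, z'} : Finset V) := by
      have : z ∈ ({x, y, z} : Finset V) := by simp
      rwa [show ({x, y, z} : Finset V) = {x, y, z'} from h] at this
    simp only [Finset.mem_insert, Finset.mem_singleton] at h3
    rcases h3 with h3 | h3 | h3
    · exact absurd h3.symm h1.2.1
    · exact absurd h3.symm h1.2.2
    · exact h3
  rw [← hinj.ncard_image]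
  congr 1
  ext t
  constructor
  · rintro ⟨z, hz, rfl⟩
    exact ⟨hz, by simp, by simp⟩
  · rintro ⟨ht, hx, hy⟩
    obtain ⟨z, -, -, rfl⟩ := exists_triangle_eq' ht hx hy hxy
    exact ⟨z, ht, rfl⟩

omit [NeZero n] in
theorem collar_card_le (hcard : ∀ s ∈ K.faces, s.card ≤ 3) {s : Finset (Collar V n)}
    (hs : s ∈ (collarComplex K v).faces) : s.card ≤ 3 := by
  rcases hs with ⟨t, ht, rfl⟩ | ⟨-, i, j, h | h⟩
  · exact Finset.card_image_le.trans (hcard t ht)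
  · exact (Finset.card_le_card h).trans Finset.card_le_three
  · exact (Finset.card_le_card h).trans Finset.card_le_three

theorem triangle_perm {P : Type*} {T : PreAbstractSimplicialComplex P} {x y z : P}
    (h : ({x, y, z} : Finset P) ∈ triangles T) : ({y, x, z} : Finset P) ∈ triangles T := by
  rwa [Finset.insert_comm]

omit [NeZero n] in
theorem new_adj_base {x : V} {i : ZMod n} {j : ℕ}
    (h : (graph (collarComplex K v)).Adj (base x) (new i j)) :
    j = 0 ∧ (x = v i ∨ x = v (i + 1)) := by
  rcases collar_adj_cases h with ⟨a, b, -, -, h⟩ | ⟨i', j', ⟨hx, hy⟩ | ⟨hx, hy⟩⟩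
  · cases h
  · rcases j' with _ | _ <;> simp [upTri, pos] at hx hy
    obtain ⟨rfl, rfl⟩ := hy
    exact ⟨rfl, hx⟩
  · rcases j' with _ | _ <;> simp [downTri, pos] at hx hy
    rcases hy with ⟨rfl, rfl⟩ | ⟨rfl, rfl⟩
    · exact ⟨rfl, .inr hx⟩
    · exact ⟨rfl, .inl hx⟩

include hv

theorem up_triangle (i : ZMod n) :
    ({base (v i), base (v (i + 1)), new i 0} : Finset (Collar V n)) ∈
      triangles (collarComplex K v) :=
  triangle_mem (upTri_mem i 0) (pos_ne_pos_succ hv i 0) (by simp) (by simp)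

theorem down_triangle (i : ZMod n) :
    ({base (v (i + 1)), new i 0, new (i + 1) 0} : Finset (Collar V n)) ∈
      triangles (collarComplex K v) :=
  triangle_mem (downTri_mem i 0) (by simp) (by simp) (pos_ne_pos_succ hv i 1)

theorem mem_collar_triangle_base_base {x y : V} {z : Collar V n} :
    ({base x, base y, z} : Finset (Collar V n)) ∈ triangles (collarComplex K v) ↔
      (∃ z', z = base z' ∧ ({x, y, z'} : Finset V) ∈ triangles K) ∨
        ∃ i, z = new i 0 ∧ s(v i, v (i + 1)) = s(x, y) := by
  constructor
  · intro h
    have hd := ne_of_triangle h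
    cases z with
    | base z =>
      left
      refine ⟨z, rfl, triangle_mem ?_ (fun e => hd.1 (e ▸ rfl)) (fun e => hd.2.1 (e ▸ rfl))
        (fun e => hd.2.2 (e ▸ rfl))⟩
      rw [← base_image_mem_collar hv]
      simpa [Finset.image_insert] using h.1
    | new i j =>
      right
      have h1 := new_adj_base (adj_of_face h.1 (x := base x) (y := new i j)
        (by simp) (by simp) (by simp))
      have h2 := new_adj_base (adj_of_face h.1 (x := base y) (y := new i j)
        (by simp) (by simp) (by simp))
      obtain ⟨rfl, h1⟩ := h1
      refine ⟨i, rfl, ?_⟩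
      rcases h1 with rfl | rfl <;> rcases h2.2 with rfl | rfl
      · exact absurd rfl hd.1
      · rfl
      · exact Sym2.eq_swap
      · exact absurd rfl hd.1
  · rintro (⟨z', rfl, h⟩ | ⟨i, rfl, h⟩)
    · have hd := ne_of_triangle h
      have := (base_image_mem_collar hv).2 h.1
      rw [Finset.image_insert, Finset.image_insert, Finset.image_singleton] at this
      exact triangle_mem this (by simpa using hd.1) (by simpa using hd.2.1) (by simpa using hd.2.2)
    · rcases Sym2.eq_iff.1 h with ⟨rfl, rfl⟩ | ⟨rfl, rfl⟩
      · exact up_triangle hv i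
      · exact triangle_perm (up_triangle hv i)

theorem mem_collar_triangle_base_new {i : ZMod n} {z : Collar V n} :
    ({base (v i), new i 0, z} : Finset (Collar V n)) ∈ triangles (collarComplex K v) ↔
      z = base (v (i + 1)) ∨ z = new (i - 1) 0 := by
  constructor
  · intro h
    have hd := ne_of_triangle h
    have hvi := (hv.edge i).1
    obtain ⟨i', j', h' | h'⟩ := collar_face_of_new_mem h.1 (i := i) (j := 0) (by simp)
    · have h1 := h' (x := base (v i)) (by simp)
      have h2 := h' (x := new i 0) (by simp)
      have h3 := h' (x := z) (by simp)
      rcases j' with _ | j' <;> simp [upTri, pos] at h1 h2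
      subst h2
      simp only [upTri, pos, Finset.mem_insert, Finset.mem_singleton] at h3
      rcases h3 with rfl | rfl | rfl
      · exact absurd rfl hd.2.1
      · exact .inl rfl
      · exact absurd rfl hd.2.2
    · have h1 := h' (x := base (v i)) (by simp)
      have h2 := h' (x := new i 0) (by simp)
      have h3 := h' (x := z) (by simp)
      rcases j' with _ | j' <;> simp [downTri, pos] at h1 h2
      rcases h2 with rfl | rfl
      · exact absurd h1 hvi
      · simp only [downTri, pos, Finset.mem_insert, Finset.mem_singleton] at h3
        rcases h3 with rfl | rfl | rfl
        · exact absurd rfl hd.2.1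
        · right; simp
        · exact absurd rfl hd.2.2
  · rintro (rfl | rfl)
    · rw [Finset.pair_comm]
      exact up_triangle hv i
    · have := down_triangle hv (i - 1)
      rw [sub_add_cancel] at this
      rwa [Finset.pair_comm]

theorem mem_collar_triangle_base_new' {i : ZMod n} {z : Collar V n} :
    ({base (v (i + 1)), new i 0, z} : Finset (Collar V n)) ∈ triangles (collarComplex K v) ↔
      z = base (v i) ∨ z = new (i + 1) 0 := by
  constructor
  · intro h
    have hd := ne_of_triangle h
    have hvi := (hv.edge i).1
    obtain ⟨i', j', h' | h'⟩ := collar_face_of_new_mem h.1 (i := i) (j := 0) (by simp)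
    · have h1 := h' (x := base (v (i + 1))) (by simp)
      have h2 := h' (x := new i 0) (by simp)
      have h3 := h' (x := z) (by simp)
      rcases j' with _ | j' <;> simp [upTri, pos] at h1 h2
      subst h2
      simp only [upTri, pos, Finset.mem_insert, Finset.mem_singleton] at h3
      rcases h3 with rfl | rfl | rfl
      · exact .inl rfl
      · exact absurd rfl hd.2.1
      · exact absurd rfl hd.2.2
    · have h1 := h' (x := base (v (i + 1))) (by simp)
      have h2 := h' (x := new i 0) (by simp)
      have h3 := h' (x := z) (by simp)
      rcases j' with _ | j' <;> simp [downTri, pos] at h1 h2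
      rcases h2 with rfl | rfl
      · simp only [downTri, pos, Finset.mem_insert, Finset.mem_singleton] at h3
        rcases h3 with rfl | rfl | rfl
        · exact absurd rfl hd.2.1
        · exact absurd rfl hd.2.2
        · exact .inr rfl
      · exact absurd h1.symm hvi
  · rintro (rfl | rfl)
    · rw [Finset.pair_comm]
      exact triangle_perm (up_triangle hv i)
    · exact down_triangle hv i

/-- At an edge of `K` every passage of `v` contributes one collar triangle, so the counting
condition on `v` is precisely that two triangles meet there. At an edge leading into the collar the
two triangles are explicit. -/
theorem collar_ncard_apex_base (hfin : K.faces.Finite) {x : V} {y : Collar V n}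
    (hxy : (graph (collarComplex K v)).Adj (base x) y) :
    {z | ({base x, y, z} : Finset (Collar V n)) ∈ triangles (collarComplex K v)}.ncard = 2 := by
  cases y with
  | base y =>
    have hxy' := (adj_collar_base hv).1 hxy
    have e : {z | ({base x, base y, z} : Finset (Collar V n)) ∈ triangles (collarComplex K v)} =
        base '' {z | ({x, y, z} : Finset V) ∈ triangles K} ∪
          (fun i => new i 0) '' {i | s(v i, v (i + 1)) = s(x, y)} := by
      ext z
      rw [Set.mem_ofPred_eq, mem_collar_triangle_base_base hv]
      simp only [Set.mem_union, Set.mem_image, Set.mem_ofPred_eq]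
      refine or_congr ?_ ?_
      · exact exists_congr fun z' => by rw [and_comm, eq_comm]
      · exact exists_congr fun z' => by rw [and_comm, eq_comm (a := z)]
    have hf1 : {z | ({x, y, z} : Finset V) ∈ triangles K}.Finite :=
      (vertices_finite hfin).subset fun z hz => mem_vertices_of_face hz.1 (by simp)
    rw [e, Set.ncard_union_eq ?_ (hf1.image _) ((Set.toFinite _).image _),
      Set.ncard_image_of_injective _ (fun _ _ h => by injection h),
      Set.ncard_image_of_injective _ (fun _ _ h => by injection h), ncard_apex hfin hxy'.1, add_comm]
    · rw [← hv.count x y hxy']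
      congr 1
      rw [← Set.ncard_coe_finset]
      congr 1
      ext i
      simp
    · rw [Set.disjoint_left]
      rintro _ ⟨z, -, rfl⟩ ⟨i, -, h⟩
      cases h
  | new i j =>
    obtain ⟨rfl, rfl | rfl⟩ := new_adj_base hxy
    · simp only [mem_collar_triangle_base_new hv]
      exact Set.ncard_pair (by simp)
    · simp only [mem_collar_triangle_base_new' hv]
      exact Set.ncard_pair (by simp)

/-- If `S` were a proper part of the link of `a`, then the function equal to the nontrivial element
of the group of order two on the edges from `a` to `S`, and trivial elsewhere, would be a cocycle.
Its primitive is constant along paths avoiding `a`. The part of `K` that cannot reach the collar off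
`a` carries no triangles, by the absence of 2-cycles, so all neighbours of `a` are connected to the
collar off `a` and have the same value; but the values on `S` and off `S` differ. -/
theorem collar_link_connected (hfin : K.faces.Finite) (hK : IsSimplyConnected K) (hcyc : NoCycle K)
    (a : V) (S : Set (Collar V n)) (hS : ∀ y ∈ S, (graph (collarComplex K v)).Adj (base a) y)
    (hne : S.Nonempty)
    (hcl : ∀ y ∈ S, ∀ z, ({base a, y, z} : Finset (Collar V n)) ∈ triangles (collarComplex K v) →
      z ∈ S) (y₁ : Collar V n) (hy₁ : (graph (collarComplex K v)).Adj (base a) y₁) : y₁ ∈ S := by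
  by_contra hy₁S
  let σ : Multiplicative (ZMod 2) := Multiplicative.ofAdd 1
  have hσ : σ * σ = 1 := by decide
  have hσ1 : σ ≠ 1 := by decide
  let g : Collar V n → Collar V n → Multiplicative (ZMod 2) := fun x y =>
    if (x = base a ∧ y ∈ S) ∨ (y = base a ∧ x ∈ S) then σ else 1
  have haS : base a ∉ S := fun h => (hS _ h).1 rfl
  have hSS : ∀ y z, ({base a, y, z} : Finset (Collar V n)) ∈ (collarComplex K v).faces →
      (graph (collarComplex K v)).Adj y z → base a ≠ y → base a ≠ z → (y ∈ S ↔ z ∈ S) := by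
    intro y z hf h hy hz
    refine ⟨fun hy' => hcl y hy' z (triangle_mem hf hy hz h.1), fun hz' => hcl z hz' y ?_⟩
    rw [Finset.pair_comm] at hf
    exact triangle_mem hf hz hy h.1.symm
  have hg : IsCocycle (collarComplex K v) g := by
    constructor
    · intro x y h
      by_cases h1 : (x = base a ∧ y ∈ S) ∨ (y = base a ∧ x ∈ S)
      · simp only [g, if_pos h1, if_pos (Or.symm h1), hσ]
      · simp only [g, if_neg h1, if_neg (fun h => h1 (Or.symm h)), mul_one]
    · intro x y z hxy hyz hxz hf
      by_cases hx : x = base a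
      · subst hx
        have := hSS y z hf hyz hxy.1 hxz.1
        have h2 := hxy.1.symm
        have h3 := hxz.1.symm
        by_cases hy : y ∈ S <;> simp_all [g]
      by_cases hy : y = base a
      · subst hy
        have := hSS x z (by rw [Finset.insert_comm]; exact hf) hxz hxy.1.symm hyz.1
        have h3 := hyz.1.symm
        by_cases hy : x ∈ S <;> simp_all [g]
      by_cases hz : z = base a
      · subst hz
        have := hSS x y (by rw [Finset.insert_comm, Finset.pair_comm] at hf
                            rw [Finset.pair_comm, Finset.insert_comm, Finset.pair_comm,
                              Finset.insert_comm]
                            convert hf using 1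
                            ext; simp; tauto) hxy hxz.1.symm hyz.1.symm
        by_cases hy : x ∈ S <;> simp_all [g]
      · simp [g, hx, hy, hz]
  obtain ⟨h, hh⟩ := (collar_isSimplyConnected hv hK).exists_primitive hg
  have hoff : ∀ x y, (graph (collarComplex K v)).Adj x y → x ≠ base a → y ≠ base a → h y = h x := by
    intro x y hxy hx hy
    rw [hh x y hxy]
    simp [g, hx, hy]
  have hinS : ∀ y ∈ S, h y = h (base a) * σ := by
    intro y hy
    rw [hh _ y (hS y hy)]
    simp [g, hy]
  have hninS : h y₁ = h (base a) := by
    rw [hh _ y₁ hy₁]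
    simp [g, hy₁S, haS]
  have hinf : ∀ i j, h (new i j) = h (new 0 0) := by
    have e1 : ∀ i j, h (new i j) = h (new i 0) := by
      intro i j
      induction j with
      | zero => rfl
      | succ j ih =>
        rw [← ih]
        exact hoff (new i j) (new i (j + 1)) (adj_collar_vertical i (j + 1)) (by simp) (by simp)
    have e2 : ∀ m : ℕ, h (new (m : ZMod n) 0) = h (new 0 0) := by
      intro m
      induction m with
      | zero => simp
      | succ m ih =>
        rw [← ih, Nat.cast_succ]
        exact hoff (new m 0) (new (m + 1) 0) (adj_collar_horizontal hv m 1) (by simp) (by simp)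
    intro i j
    rw [e1, ← ZMod.natCast_zmod_val i, e2]
  have key : ∀ y, (graph (collarComplex K v)).Adj (base a) y → h y = h (new 0 0) := by
    intro y hay
    by_contra hy
    cases y with
    | new i j => exact hy (hinf i j)
    | base y =>
    -- Vertices of `A` are not connected to the collar off `a`, hence do not lie on the boundary
    -- walk, and each of their edges is in two triangles of `K`. So the triangles touching `A` form
    -- a 2-cycle.
    let A : Set V := {x | x ≠ a ∧ h (base x) ≠ h (new 0 0)}
    have hyA : y ∈ A := ⟨fun e => hay.1 (e ▸ rfl), hy⟩
    have hstep : ∀ x x', (graph K).Adj x x' → x ∈ A → x' ≠ a → x' ∈ A := by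
      intro x x' hxx hx hx'
      refine ⟨hx', ?_⟩
      rw [hoff _ _ ((adj_collar_base hv).2 hxx) (by simpa using hx.1) (by simpa using hx')]
      exact hx.2
    have hcount : ∀ x x', (graph K).Adj x x' → x ∈ A → edgeSum K (fun _ => 1) x x' = 2 := by
      intro x x' hxx hx
      have h1 := hv.count x x' hxx
      rw [Finset.card_eq_zero.2, zero_add] at h1
      · exact h1
      · refine Finset.filter_eq_empty_iff.2 fun i _ hi => ?_
        have h2 : (graph (collarComplex K v)).Adj (base x) (new i 0) := by
          rcases Sym2.eq_iff.1 hi with ⟨h3, h4⟩ | ⟨h3, h4⟩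
          · rw [← h3]; exact adj_collar_vertical i 0
          · rw [← h4]; exact adj_collar_diagonal i 0
        have h5 := hoff _ _ h2 (by simpa using hx.1) (by simp)
        exact hx.2 (by rw [← h5, hinf])
    let f : Finset V → ZMod 2 := fun t => if ∃ x ∈ t, x ∈ A then 1 else 0
    have hfA : ∀ x x', (graph K).Adj x x' → x ∈ A → edgeSum K f x x' = 0 := by
      intro x x' hxx hx
      rw [edgeSum_congr hfin (g := fun _ => 1), edgeSum_one_cast, hcount x x' hxx hx]
      · rfl
      · intro t _ hxt _
        exact if_pos ⟨x, hxt, hx⟩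
    have hf := hcyc f (by
      intro x x' hxx
      by_cases hx : x ∈ A
      · exact hfA x x' hxx hx
      by_cases hx' : x' ∈ A
      · rw [edgeSum_comm]
        exact hfA x' x hxx.symm hx'
      refine edgeSum_eq_zero hfin fun t ht hxt hxt' => if_neg ?_
      rintro ⟨z, hzt, hz⟩
      have hxa : x = a := by
        by_contra hxa
        exact hx (hstep z x (adj_of_face ht.1 hzt hxt (fun e => hx (e ▸ hz))) hz hxa)
      have hxa' : x' = a := by
        by_contra hxa
        exact hx' (hstep z x' (adj_of_face ht.1 hzt hxt' (fun e => hx' (e ▸ hz))) hz hxa)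
      exact hxx.1 (hxa.trans hxa'.symm))
    -- The edge from `y` to `a` lies in two triangles, so the 2-cycle just excluded would be
    -- nonzero.
    have h2 := hcount y a ((adj_collar_base hv).1 hay).symm hyA
    have h3 : ∃ t ∈ triangles K, y ∈ t := by
      by_contra hcon
      push Not at hcon
      rw [edgeSum_eq_zero hfin fun t ht hyt => absurd hyt (hcon t ht)] at h2
      exact absurd h2 (by norm_num)
    obtain ⟨t, ht, hyt⟩ := h3
    have h4 := hf t ht
    simp only [f, if_pos (⟨y, hyt, hyA⟩ : ∃ x ∈ t, x ∈ A)] at h4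
    exact one_ne_zero h4
  obtain ⟨y₀, hy₀⟩ := hne
  have h1 := key y₀ (hS y₀ hy₀)
  rw [hinS y₀ hy₀, ← key y₁ hy₁, hninS] at h1
  exact hσ1 (by simpa using h1)

theorem collar_isInterior_base (hfin : K.faces.Finite) (hcard : ∀ s ∈ K.faces, s.card ≤ 3)
    (hK : IsSimplyConnected K) (hcyc : NoCycle K) {a : V} (ha : a ∈ vertices K) :
    IsInterior (collarComplex K v) (base a) := by
  refine isInterior_of_link ?_ (fun s hs _ => collar_card_le hcard hs) ?_ ?_
    (fun y hy => collar_ncard_apex_base hv hfin hy)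
    (collar_link_connected hv hfin hK hcyc a)
  · have := (base_image_mem_collar hv (s := {a})).2 ha
    simpa [vertices] using this
  · refine Set.Finite.subset (((vertices_finite hfin).image base).union
      (Set.finite_range fun i : ZMod n => (new i 0 : Collar V n))) ?_
    intro y hy
    cases y with
    | base y =>
      exact .inl ⟨y, mem_vertices_of_adj ((adj_collar_base hv).1 hy).symm, rfl⟩
    | new i j =>
      obtain ⟨rfl, -⟩ := new_adj_base hy
      exact .inr ⟨i, rfl⟩
  · by_cases h : a = v 0
    · exact ⟨base (v (0 + 1)), by rw [h]; exact (adj_collar_base hv).2 (hv.edge 0)⟩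
    · obtain ⟨p⟩ := hK.connected a ha (v 0) (mem_vertices_of_adj (hv.edge 0))
      cases p with
      | nil => exact absurd rfl h
      | cons h' p => exact ⟨base _, (adj_collar_base hv).2 h'⟩

theorem collar_isPlaneTriangulation (hfin : K.faces.Finite) (hcard : ∀ s ∈ K.faces, s.card ≤ 3)
    (hK : IsSimplyConnected K) (hcyc : NoCycle K) : IsPlaneTriangulation (collarComplex K v) where
  simplyConnected := collar_isSimplyConnected hv hK
  infinite := collar_infinite hv
  interior a ha := by
    cases a with
    | base a =>
      refine collar_isInterior_base hv hfin hcard hK hcyc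
        ((base_image_mem_collar hv (s := {a})).1 ?_)
      simpa [vertices] using ha
    | new i j => exact collar_isInterior_new hv i j

theorem isSingularDisc_of_isBoundaryParam (hfin : K.faces.Finite)
    (hcard : ∀ s ∈ K.faces, s.card ≤ 3) (hK : IsSimplyConnected K) (hcyc : NoCycle K) :
    IsSingularDisc K where
  finite := hfin
  simplyConnected := hK
  planar := ⟨_, collarComplex K v, base, collar_isPlaneTriangulation hv hfin hcard hK hcyc,
    fun _ _ _ _ h => by injection h, collar_image_le⟩

end CollarBase

/-! ### Boundary walks -/

section BoundaryWalk

variable {V : Type u} {K : PreAbstractSimplicialComplex V}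

theorem edges_eq_map_range {G : SimpleGraph V} {x y : V} (c : G.Walk x y) :
    c.edges = (List.range c.length).map fun j => s(c.getVert j, c.getVert (j + 1)) := by
  induction c with
  | nil => rfl
  | cons h p ih =>
    rw [SimpleGraph.Walk.edges_cons, SimpleGraph.Walk.length_cons, List.range_succ_eq_map, ih]
    simp [Function.comp_def]

theorem IsBoundaryCycle.isBoundaryParam (hfin : K.faces.Finite) {p : V} {c : (graph K).Walk p p}
    (hc : IsBoundaryCycle K c) (h3 : 3 ≤ c.length) :
    haveI : NeZero c.length := ⟨by omega⟩
    IsBoundaryParam K (fun i : ZMod c.length => c.getVert i.val) := by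
  have : NeZero c.length := ⟨by omega⟩
  have hsucc : ∀ i : ZMod c.length, c.getVert (i + 1).val = c.getVert (i.val + 1) := by
    intro i
    have : Fact (1 < c.length) := ⟨by omega⟩
    have hlt := ZMod.val_lt i
    by_cases h : i.val + 1 < c.length
    · rw [ZMod.val_add_of_lt] <;> rw [ZMod.val_one]
      exact h
    · have h1 : i.val + 1 = c.length := by omega
      have h2 : (i + 1).val = 0 := by
        rw [ZMod.val_add, ZMod.val_one, h1, Nat.mod_self]
      rw [h1, h2, SimpleGraph.Walk.getVert_zero, SimpleGraph.Walk.getVert_length]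
  refine ⟨h3, fun i => ?_, fun x y hxy => ?_⟩
  · rw [hsucc]
    exact c.adj_getVert_succ (ZMod.val_lt i)
  · have h1 := hc.2 x y hxy
    rw [ncard_edge hfin] at h1
    rw [← h1]
    congr 1
    have h2 : c.edges.count s(x, y) = ((Finset.range c.length).filter
        fun j => s(c.getVert j, c.getVert (j + 1)) = s(x, y)).card := by
      rw [edges_eq_map_range, ← Multiset.coe_count, ← Multiset.map_coe, Multiset.count_map]
      simp only [eq_comm]
      rfl
    rw [h2]
    refine Finset.card_bij (fun i _ => i.val) ?_ ?_ ?_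
    · intro i hi
      simp only [Finset.mem_filter, Finset.mem_univ, true_and, hsucc] at hi
      exact Finset.mem_filter.2 ⟨Finset.mem_range.2 (ZMod.val_lt i), hi⟩
    · intro i _ j _ h
      exact ZMod.val_injective _ h
    · intro j hj
      simp only [Finset.mem_filter, Finset.mem_range] at hj
      refine ⟨(j : ZMod c.length), ?_, ZMod.val_cast_of_lt hj.1⟩
      simp only [Finset.mem_filter, Finset.mem_univ, true_and, hsucc]
      rw [ZMod.val_cast_of_lt hj.1]
      exact hj.2

/-- The characterization of singular discs among finite complexes with a boundary cycle. -/
theorem isSingularDisc_of_isBoundaryCycle (hfin : K.faces.Finite)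
    (hcard : ∀ s ∈ K.faces, s.card ≤ 3) (hK : IsSimplyConnected K) (hcyc : NoCycle K)
    {p : V} {c : (graph K).Walk p p} (hc : IsBoundaryCycle K c) (h3 : 3 ≤ c.length) :
    IsSingularDisc K := by
  have : NeZero c.length := ⟨by omega⟩
  exact isSingularDisc_of_isBoundaryParam (hc.isBoundaryParam hfin h3) hfin hcard hK hcyc

/-- A closed walk of length at most two passes every edge an even number of times. Then every edge
lies in an even number of triangles, and all the triangles together form a 2-cycle. -/
theorem three_le_length (hfin : K.faces.Finite) (hcyc : NoCycle K) {p : V}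
    {c : (graph K).Walk p p} (hc : IsBoundaryCycle K c) (ht : (triangles K).Nonempty) :
    3 ≤ c.length := by
  by_contra hlt
  obtain ⟨t, ht⟩ := ht
  refine one_ne_zero (hcyc (fun _ => 1) (fun x y hxy => ?_) t ht)
  have h1 := hc.2 x y hxy
  rw [ncard_edge hfin] at h1
  rw [edgeSum_one_cast]
  have h2 : Even (c.edges.count s(x, y)) := by
    match c, hlt with
    | .nil, _ => simp
    | .cons h .nil, _ => exact absurd rfl h.1
    | .cons h (.cons h' .nil), _ =>
      simp only [SimpleGraph.Walk.edges_cons, SimpleGraph.Walk.edges_nil, List.count_cons,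
        List.count_nil, Sym2.eq_swap]
      split_ifs <;> decide
    | .cons h (.cons h' (.cons h'' q)), hlt =>
      exact absurd (by simp) hlt
  rw [ZMod.natCast_eq_zero_iff_even]
  have h3 : Even (c.edges.count s(x, y) + edgeSum K (fun _ => 1) x y) := h1 ▸ even_two
  exact (Nat.even_add.1 h3).1 h2

end BoundaryWalk

/-! ### Combinatorial discs and replacement of triangles -/

section Replace

variable {V : Type u} {K K' : PreAbstractSimplicialComplex V}

/-- A singular disc with boundary cycle `w`, described without reference to the plane. -/
structure IsDisc (K : PreAbstractSimplicialComplex V) {p : V} (w : (graph K).Walk p p) : Prop where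
  finite : K.faces.Finite
  card_le : ∀ s ∈ K.faces, s.card ≤ 3
  simplyConnected : IsSimplyConnected K
  noCycle : NoCycle K
  boundary : IsBoundaryCycle K w

theorem IsDisc.isSingularDisc {p : V} {w : (graph K).Walk p p} (h : IsDisc K w)
    (h3 : 3 ≤ w.length) : IsSingularDisc K :=
  isSingularDisc_of_isBoundaryCycle h.finite h.card_le h.simplyConnected h.noCycle h.boundary h3

theorem IsSingularDisc.isDisc (hK : IsSingularDisc K) {p : V} {w : (graph K).Walk p p}
    (hw : IsBoundaryCycle K w) : IsDisc K w :=
  ⟨hK.finite, fun _ hs => hK.card_le hs, hK.simplyConnected, hK.noCycle, hw⟩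

theorem IsDisc.count {p : V} {w : (graph K).Walk p p} (h : IsDisc K w) {x y : V}
    (hxy : (graph K).Adj x y) : w.edges.count s(x, y) + edgeSum K (fun _ => 1) x y = 2 := by
  rw [← ncard_edge h.finite]
  exact h.boundary.2 x y hxy

theorem edgeSum_split {R : Type*} [AddCommMonoid R] (M : Finset V → Prop) [DecidablePred M] (f : Finset V → R)
    (x y : V) : edgeSum K f x y = edgeSum K (fun t => if M t then 0 else f t) x y +
      edgeSum K (fun t => if M t then f t else 0) x y := by
  unfold edgeSum
  rw [← Finset.sum_add_distrib]
  refine Finset.sum_congr rfl fun t _ => ?_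
  by_cases h : M t <;> simp [h]

/-- The bookkeeping of a move that deletes the triangles satisfying `M` and adds those in `A`. -/
theorem edgeSum_replace (hfin : K.faces.Finite) (hfin' : K'.faces.Finite) {M : Finset V → Prop}
    [DecidablePred M] {A : Finset (Finset V)} (hA : ∀ t ∈ A, t ∉ triangles K)
    (hK' : ∀ t, t ∈ triangles K' ↔ (t ∈ triangles K ∧ ¬ M t) ∨ t ∈ A)
    {R : Type*} [AddCommMonoid R] (f : Finset V → R) (x y : V) :
    edgeSum K' f x y = edgeSum K (fun t => if M t then 0 else f t) x y +
      ∑ t ∈ A, if x ∈ t ∧ y ∈ t then f t else 0 := by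
  have h : (triF K').filter (fun t => x ∈ t ∧ y ∈ t) =
      ((triF K).filter fun t => x ∈ t ∧ y ∈ t).filter (fun t => ¬ M t) ∪
        A.filter fun t => x ∈ t ∧ y ∈ t := by
    ext t
    simp only [Finset.mem_filter, Finset.mem_union, mem_triF hfin, mem_triF hfin', hK']
    tauto
  unfold edgeSum
  rw [h, Finset.sum_union, Finset.sum_filter (p := fun t => ¬ M t), Finset.sum_filter (s := A)]
  · congr 1
    refine Finset.sum_congr rfl fun t _ => ?_
    by_cases h : M t <;> simp [h]
  · rw [Finset.disjoint_left]
    intro t ht ht'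
    simp only [Finset.mem_filter, mem_triF hfin] at ht ht'
    exact hA t ht'.1 ht.1.1

theorem edgeSum_filter_eq (hfin : K.faces.Finite) {M : Finset V → Prop} [DecidablePred M]
    {A : Finset (Finset V)} (hM : ∀ t, t ∈ A ↔ t ∈ triangles K ∧ M t) {R : Type*} [AddCommMonoid R] (f : Finset V → R)
    (x y : V) : edgeSum K (fun t => if M t then f t else 0) x y =
      ∑ t ∈ A, if x ∈ t ∧ y ∈ t then f t else 0 := by
  unfold edgeSum
  rw [← Finset.sum_filter, ← Finset.sum_filter]
  congr 1
  ext t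
  simp only [Finset.mem_filter, mem_triF hfin, hM]
  tauto

/-- The boundary walk itself is kept: the counting condition survives if surviving edges keep their
number of triangles and new edges, which the walk cannot pass, lie in two. -/
theorem IsBoundaryCycle.exists_transfer (hfin' : K'.faces.Finite)
    (hfin : K.faces.Finite) {p : V} {w : (graph K).Walk p p} (hw : IsBoundaryCycle K w)
    (hp : p ∈ vertices K') (hedge : ∀ x y, s(x, y) ∈ w.edges → (graph K').Adj x y)
    (hcount : ∀ x y, (graph K').Adj x y →
      ((graph K).Adj x y ∧ edgeSum K' (fun _ => 1) x y = edgeSum K (fun _ => 1) x y) ∨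
      (¬ (graph K).Adj x y ∧ edgeSum K' (fun _ => 1) x y = 2)) :
    ∃ w' : (graph K').Walk p p, w'.edges = w.edges ∧ w'.support = w.support ∧
      IsBoundaryCycle K' w' := by
  refine ⟨w.transfer (graph K') ?_, SimpleGraph.Walk.edges_transfer _ _,
    SimpleGraph.Walk.support_transfer _ _, hp, ?_⟩
  · intro e he
    induction e with
    | _ x y => exact hedge x y he
  · intro x y hxy
    rw [SimpleGraph.Walk.edges_transfer, ncard_edge hfin']
    rcases hcount x y hxy with ⟨h1, h2⟩ | ⟨h1, h2⟩
    · rw [h2, ← ncard_edge hfin]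
      exact hw.2 x y h1
    · rw [h2, List.count_eq_zero.2]
      intro h
      exact h1 (w.adj_of_mem_edges h)

theorem IsLinkCycle.edgeSum_eq_two (hfin : K.faces.Finite) {a : V} {k : ℕ} {c : Fin k → V}
    (h : IsLinkCycle K a c) {y : V} (hy : (graph K).Adj a y) :
    edgeSum K (fun _ => 1) a y = 2 := by
  rw [← ncard_edge hfin]
  obtain ⟨i, rfl⟩ := h.exists_of_adj hy
  obtain ⟨j, rfl⟩ := (finRotate k).surjective i
  have : {t | t ∈ triangles K ∧ a ∈ t ∧ c (finRotate k j) ∈ t} =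
      {{a, c j, c (finRotate k j)}, {a, c (finRotate k j), c (finRotate k (finRotate k j))}} := by
    ext t
    simp only [Set.mem_ofPred_eq, Set.mem_insert_iff, Set.mem_singleton_iff]
    constructor
    · rintro ⟨ht, ha, hc⟩
      obtain ⟨l, rfl⟩ := h.exists_eq ht ha
      rcases h.mem_triangle_iff.1 hc with e | e
      · right; rw [e]
      · left; rw [(finRotate k).injective e]
    · rintro (rfl | rfl)
      · exact ⟨h.triangle_mem _, by simp, by simp⟩
      · exact ⟨h.triangle_mem _, by simp, by simp⟩
  rw [this]
  refine Set.ncard_pair fun e => ?_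
  exact finRotate_ne h.three_le j (h.triangle_inj e).symm

theorem IsInterior.edgeSum_eq_two (hfin : K.faces.Finite) {a : V} (h : IsInterior K a) {y : V}
    (hy : (graph K).Adj a y) : edgeSum K (fun _ => 1) a y = 2 := by
  obtain ⟨k, c, hc⟩ := h
  exact hc.edgeSum_eq_two hfin hy

theorem edgeSum_mul (r : ZMod 2) (f : Finset V → ZMod 2) (x y : V) :
    edgeSum K (fun t => r * f t) x y = r * edgeSum K f x y := by
  unfold edgeSum
  rw [Finset.mul_sum]

end Replace

/-! ### Filling an empty triangle -/

section AMove

variable {V : Type u} {K : PreAbstractSimplicialComplex V} {a b c : V}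

theorem IsEnclosed.isInterior {x : V} (h : IsEnclosed K a b c x) : IsInterior K x := by
  by_contra hx
  have := h.2.2.2.2 x h.1 hx .nil
  simp only [SimpleGraph.Walk.support_nil, List.mem_singleton] at this
  rcases this with e | e | e
  · exact h.2.1 e.symm
  · exact h.2.2.1 e.symm
  · exact h.2.2.2.1 e.symm

theorem IsEnclosed.notMem {x : V} (h : IsEnclosed K a b c x) : x ∉ ({a, b, c} : Finset V) := by
  simp only [Finset.mem_insert, Finset.mem_singleton, not_or]
  exact ⟨h.2.1, h.2.2.1, h.2.2.2.1⟩

theorem IsEnclosed.of_adj {x z : V} (h : IsEnclosed K a b c x) (hxz : (graph K).Adj x z)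
    (hz : z ∉ ({a, b, c} : Finset V)) : IsEnclosed K a b c z := by
  simp only [Finset.mem_insert, Finset.mem_singleton, not_or] at hz
  refine ⟨mem_vertices_of_adj hxz.symm, hz.1, hz.2.1, hz.2.2, fun y hy hy' p => ?_⟩
  have := h.2.2.2.2 y hy hy' (.cons hxz p)
  simp only [SimpleGraph.Walk.support_cons, List.mem_cons] at this
  rcases this with (e | e) | (e | e) | (e | e)
  · exact absurd e.symm h.2.1
  · exact .inl e
  · exact absurd e.symm h.2.2.1
  · exact .inr (.inl e)
  · exact absurd e.symm h.2.2.2.1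
  · exact .inr (.inr e)

variable (K a b c) in
/-- The set of simplices touching the region bounded by `a, b, c`. -/
def Touches (t : Finset V) : Prop := ∃ x ∈ t, IsEnclosed K a b c x

/-- Being enclosed spreads along edges to every vertex other than `a, b, c`. -/
theorem Touches.mem_of_notEnclosed {t : Finset V} (ht : t ∈ K.faces) (h : Touches K a b c t) {x : V}
    (hx : x ∈ t) (hx' : ¬ IsEnclosed K a b c x) : x ∈ ({a, b, c} : Finset V) := by
  by_contra hxT
  obtain ⟨z, hz, hzE⟩ := h
  exact hx' (hzE.of_adj (adj_of_face ht hz hx fun e => hx' (e ▸ hzE)) hxT)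

/-- A null-homotopy of the loop `a b c a` sweeps out a mod 2 chain with this boundary. -/
theorem exists_chain_of_triangle (hfin : K.faces.Finite) (hK : IsSimplyConnected K)
    (hab : (graph K).Adj a b) (hbc : (graph K).Adj b c) (hac : (graph K).Adj a c) :
    ∃ f : Finset V → ZMod 2, ∀ u v, (graph K).Adj u v → edgeSum K f u v =
      if u ∈ ({a, b, c} : Finset V) ∧ v ∈ ({a, b, c} : Finset V) then 1 else 0 := by
  obtain ⟨f, hf⟩ := (hK.trivial_loops a
    (.cons hab (.cons hbc (.cons hac.symm .nil)))).exists_chain hfin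
  refine ⟨f, fun u v huv => ?_⟩
  rw [hf u v huv]
  have h1 := hab.1
  have h2 := hbc.1
  have h3 := hac.1
  have h4 := huv.1
  simp only [SimpleGraph.Walk.edges_cons, SimpleGraph.Walk.edges_nil, List.count_cons,
    List.count_nil, Finset.mem_insert, Finset.mem_singleton, beq_iff_eq, Sym2.eq_iff]
  clear hf huv
  by_cases a1 : u = a
  · subst a1
    by_cases b2 : v = b
    · subst b2; simp [h1, h1.symm, h2, h3, h2.symm, h3.symm]
    by_cases b3 : v = c
    · subst b3; simp [h1, h1.symm, h2, h3, h2.symm, h3.symm]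
    simp [b2, b3, h1.symm, h3.symm, h4.symm, h1, h3, Ne.symm b2, Ne.symm b3]
  by_cases a2 : u = b
  · subst a2
    by_cases b2 : v = a
    · subst b2; simp [h1, h1.symm, h2, h3, h2.symm, h3.symm]
    by_cases b3 : v = c
    · subst b3; simp [h1, h1.symm, h2, h3, h2.symm, h3.symm]
    simp [b2, b3, h1.symm, h2.symm, h4.symm, h1, h2, Ne.symm b2, Ne.symm b3]
  by_cases a3 : u = c
  · subst a3
    by_cases b2 : v = a
    · subst b2; simp [h1, h1.symm, h2, h3, h2.symm, h3.symm]
    by_cases b3 : v = b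
    · subst b3; simp [h1, h1.symm, h2, h3, h2.symm, h3.symm]
    simp [b2, b3, h3.symm, h2.symm, h4.symm, h3, h2, Ne.symm b2, Ne.symm b3]
  simp [a1, a2, a3, Ne.symm a1, Ne.symm a2, Ne.symm a3]

/-- The disc bounded by an empty triangle consists of the triangles touching the enclosed
vertices. -/
theorem exists_chain_touches (hfin : K.faces.Finite) (hK : IsSimplyConnected K)
    (hcyc : NoCycle K) (hrigid : StarRigid K) (hab : (graph K).Adj a b) (hbc : (graph K).Adj b c)
    (hac : (graph K).Adj a c) (hempty : ({a, b, c} : Finset V) ∉ K.faces) (u v : V)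
    (huv : (graph K).Adj u v) :
    edgeSum K (fun t => if Touches K a b c t then (1 : ZMod 2) else 0) u v =
      if u ∈ ({a, b, c} : Finset V) ∧ v ∈ ({a, b, c} : Finset V) then 1 else 0 := by
  obtain ⟨f, hf⟩ := exists_chain_of_triangle hfin hK hab hbc hac
  set fE : Finset V → ZMod 2 := fun t => if Touches K a b c t then (1 : ZMod 2) else 0 with hfE
  have h0 : ∀ x y, (graph K).Adj x y → IsEnclosed K a b c x → edgeSum K fE x y = 0 := by
    intro x y hxy hx
    rw [edgeSum_congr hfin (g := fun _ => 1), edgeSum_one_cast,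
      hx.isInterior.edgeSum_eq_two hfin hxy]
    · rfl
    · intro t _ hxt _
      exact if_pos ⟨x, hxt, hx⟩
  have h1 : ∀ x y, (graph K).Adj x y → x ∉ ({a, b, c} : Finset V) → edgeSum K fE x y = 0 := by
    intro x y hxy hxT
    by_cases hx : IsEnclosed K a b c x
    · exact h0 x y hxy hx
    · refine edgeSum_eq_zero hfin fun t ht hxt _ => if_neg fun hM => hxT ?_
      exact hM.mem_of_notEnclosed ht.1 hxt hx
  -- The boundary of the chain of touching triangles is supported on the edges between `a, b, c`,
  -- and a boundary has even degree at each vertex. So it is `r` times the boundary of the triangle.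
  set r := edgeSum K fE a b with hr
  have hra : edgeSum K fE a c = r := by
    rw [hr]
    refine (edgeSum_eq_edgeSum_of_forall hfin hab.1 hac.1 hbc.1 fun y hay hyb hyc => ?_).symm
    rw [edgeSum_comm]
    exact h1 y a hay.symm (by simp [hay.1.symm, hyb, hyc])
  have hrb : edgeSum K fE b c = r := by
    rw [hr, edgeSum_comm fE a b]
    refine (edgeSum_eq_edgeSum_of_forall hfin hab.1.symm hbc.1 hac.1 fun y hby hya hyc => ?_).symm
    rw [edgeSum_comm]
    exact h1 y b hby.symm (by simp [hby.1.symm, hya, hyc])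
  have hT : ∀ x y, (graph K).Adj x y → edgeSum K fE x y = r *
      if x ∈ ({a, b, c} : Finset V) ∧ y ∈ ({a, b, c} : Finset V) then 1 else 0 := by
    intro x y hxy
    by_cases hx : x ∈ ({a, b, c} : Finset V)
    · by_cases hy : y ∈ ({a, b, c} : Finset V)
      · rw [if_pos ⟨hx, hy⟩, mul_one]
        simp only [Finset.mem_insert, Finset.mem_singleton] at hx hy
        rcases hx with rfl | rfl | rfl <;> rcases hy with rfl | rfl | rfl
        · exact absurd rfl hxy.1
        · rfl
        · exact hra
        · rw [edgeSum_comm]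
        · exact absurd rfl hxy.1
        · exact hrb
        · rw [edgeSum_comm]; exact hra
        · rw [edgeSum_comm]; exact hrb
        · exact absurd rfl hxy.1
      · rw [if_neg (fun h => hy h.2), mul_zero, edgeSum_comm]
        exact h1 y x hxy.symm hy
    · rw [if_neg (fun h => hx h.1), mul_zero]
      exact h1 x y hxy hx
  -- The sum has zero boundary, so it vanishes because there are no 2-cycles.
  have heq : ∀ t ∈ triangles K, fE t + r * f t = 0 := by
    refine hcyc (fun t => fE t + r * f t) fun x y hxy => ?_
    rw [edgeSum_add, edgeSum_mul, hT x y hxy, hf x y hxy]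
    exact CharTwo.add_self_eq_zero _
  have hr1 : r = 1 := by
    have hr01 : r = 0 ∨ r = 1 := by
      generalize r = r'
      revert r'
      decide
    -- If `r = 0`, no triangle touches an enclosed vertex. But `f` is nonzero on some triangle,
    -- which has a vertex `x` off `a, b, c` because the triangle is empty; it remains to see that
    -- `x` is enclosed.
    refine hr01.resolve_left fun hr0 => ?_
    obtain ⟨t, ht, hft⟩ : ∃ t ∈ triangles K, f t ≠ 0 := by
      by_contra hcon
      push Not at hcon
      have := hf a b hab
      rw [edgeSum_eq_zero hfin fun t ht _ _ => hcon t ht] at this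
      simp at this
    obtain ⟨x, hxt, hxT⟩ : ∃ x ∈ t, x ∉ ({a, b, c} : Finset V) := by
      by_contra hcon
      push Not at hcon
      have : t = {a, b, c} := Finset.eq_of_subset_of_card_le hcon (by
        rw [ht.2]; exact Finset.card_le_three)
      exact hempty (this ▸ ht.1)
    -- Off `a, b, c` the chain `f` has no boundary, so by star rigidity its support contains the
    -- full star of each of its vertices there. Hence a walk from `x` avoiding `a, b, c` stays among
    -- interior vertices.
    have hU : ∀ x, x ∉ ({a, b, c} : Finset V) → (∃ t ∈ triangles K, f t ≠ 0 ∧ x ∈ t) →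
        IsInterior K x ∧ ∀ t ∈ triangles K, x ∈ t → f t ≠ 0 := by
      rintro x hx ⟨t, ht, hft, hxt⟩
      obtain ⟨h2, h3⟩ := hrigid x {t | t ∈ triangles K ∧ f t ≠ 0 ∧ x ∈ t} (fun t ht => ht.1)
        ⟨t, ht, hft, hxt⟩ (fun t ht => ht.2.2) (by
          rintro s ⟨hs, hfs, hxs⟩ y hy hyx
          obtain ⟨t', ht', hts, hxt', hyt', hft'⟩ := exists_ne_of_edgeSum_eq_zero hfin (f := f)
            (x := x) (y := y) (by
              rw [hf x y (adj_of_face hs.1 hxs hy hyx.symm), if_neg fun h => hx h.1]) hs hxs hy hfs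
          exact ⟨t', ⟨ht', hft', hxt'⟩, hts, hyt'⟩)
      exact ⟨h2, fun t ht hxt => (h3 t ht hxt).2.1⟩
    have hE : IsEnclosed K a b c x := by
      have hx' := hxT
      simp only [Finset.mem_insert, Finset.mem_singleton, not_or] at hx'
      refine ⟨mem_vertices_of_face ht.1 hxt, hx'.1, hx'.2.1, hx'.2.2, fun y hyv hy p => ?_⟩
      have hxU : ∃ t ∈ triangles K, f t ≠ 0 ∧ x ∈ t := ⟨t, ht, hft, hxt⟩
      clear hx' hft hxt ht
      induction p with
      | nil => exact absurd (hU _ hxT hxU).1 hy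
      | @cons x z y hxz p ih =>
        rw [SimpleGraph.Walk.support_cons]
        by_cases hz : z ∈ ({a, b, c} : Finset V)
        · have hzp := p.start_mem_support
          simp only [Finset.mem_insert, Finset.mem_singleton] at hz
          rcases hz with rfl | rfl | rfl
          · exact .inl (List.mem_cons_of_mem _ hzp)
          · exact .inr (.inl (List.mem_cons_of_mem _ hzp))
          · exact .inr (.inr (List.mem_cons_of_mem _ hzp))
        · obtain ⟨⟨k, l, hl⟩, h3⟩ := hU x hxT hxU
          obtain ⟨i, rfl⟩ := hl.exists_of_adj hxz
          have := ih hz hyv hy ⟨_, hl.triangle_mem i, h3 _ (hl.triangle_mem i) (by simp), by simp⟩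
          exact this.imp (List.mem_cons_of_mem _)
            (Or.imp (List.mem_cons_of_mem _) (List.mem_cons_of_mem _))
    have h4 := heq t ht
    rw [hr0, zero_mul, add_zero, hfE] at h4
    change (if Touches K a b c t then (1 : ZMod 2) else 0) = 0 at h4
    rw [if_pos ⟨x, hxt, hE⟩] at h4
    exact one_ne_zero h4
  rw [hT u v huv, hr1, one_mul]

variable (K) in
/-- The result of an A-move. -/
def aMoveComplex (hab : (graph K).Adj a b) (hbc : (graph K).Adj b c) (hac : (graph K).Adj a c) :
    PreAbstractSimplicialComplex V where
  faces := {s | s ∈ K.faces ∧ ∀ x ∈ s, ¬ IsEnclosed K a b c x} ∪ {{a, b, c}}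
  isRelLowerSet_faces := by
    rintro s (⟨hs, hsE⟩ | rfl)
    · exact ⟨face_nonempty hs, fun t ht hne =>
        .inl ⟨face_mono hs ht hne, fun x hx => hsE x (ht hx)⟩⟩
    · refine ⟨⟨a, by simp⟩, fun t ht hne => ?_⟩
      by_cases hT : t = {a, b, c}
      · exact .inr hT
      · left
        refine ⟨?_, fun x hx h => h.notMem (ht hx)⟩
        have : t ⊆ {a, b} ∨ t ⊆ {b, c} ∨ t ⊆ {a, c} := by
          by_contra hcon
          simp only [not_or, Finset.not_subset, Finset.mem_insert, Finset.mem_singleton] at hcon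
          obtain ⟨⟨x, hx, hx'⟩, ⟨y, hy, hy'⟩, ⟨z, hz, hz'⟩⟩ := hcon
          have h1 := ht hx
          have h2 := ht hy
          have h3 := ht hz
          simp only [Finset.mem_insert, Finset.mem_singleton] at h1 h2 h3
          refine hT (ht.antisymm ?_)
          have e1 : x = c := by tauto
          have e2 : y = a := by tauto
          have e3 : z = b := by tauto
          subst e1 e2 e3
          intro w
          simp only [Finset.mem_insert, Finset.mem_singleton]
          rintro (rfl | rfl | rfl) <;> assumption
        rcases this with h | h | h
        · exact face_mono hab.2 h hne
        · exact face_mono hbc.2 h hne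
        · exact face_mono hac.2 h hne

/-- The removed triangles occupy exactly one side of each of the edges `ab`, `bc`, `ac`, and the new
triangle takes over that side; all other surviving edges are unaffected. -/
theorem IsDisc.aMove {p : V} {w : (graph K).Walk p p} (hD : IsDisc K w) (hrigid : StarRigid K)
    (hab : (graph K).Adj a b) (hbc : (graph K).Adj b c) (hac : (graph K).Adj a c)
    (hempty : ({a, b, c} : Finset V) ∉ K.faces) :
    (∃ w' : (graph (aMoveComplex K hab hbc hac)).Walk p p, w'.edges = w.edges ∧
      w'.support = w.support ∧ IsDisc (aMoveComplex K hab hbc hac) w') ∧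
    (triangles (aMoveComplex K hab hbc hac)).ncard < (triangles K).ncard := by
  set K' := aMoveComplex K hab hbc hac with hK'
  have hfin := hD.finite
  have hfin' : K'.faces.Finite :=
    (hfin.subset fun s (hs : s ∈ K.faces ∧ _) => hs.1).union (Set.finite_singleton _)
  have hchain := exists_chain_touches hfin hD.simplyConnected hD.noCycle hrigid hab hbc hac hempty
  set T : Finset V := {a, b, c} with hT
  have hTcard : T.card = 3 := Finset.card_eq_three.2 ⟨a, b, c, hab.1, hac.1, hbc.1, rfl⟩
  have htri : ∀ t, t ∈ triangles K' ↔ (t ∈ triangles K ∧ ¬ Touches K a b c t) ∨ t ∈ ({T} : Finset _) := by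
    intro t
    simp only [Touches, not_exists, not_and, Finset.mem_singleton]
    constructor
    · rintro ⟨⟨h1, h2⟩ | h1, h3⟩
      · exact .inl ⟨⟨h1, h3⟩, h2⟩
      · exact .inr h1
    · rintro (⟨⟨h1, h3⟩, h2⟩ | rfl)
      · exact ⟨.inl ⟨h1, h2⟩, h3⟩
      · exact ⟨.inr rfl, hTcard⟩
  have hA : ∀ t ∈ ({T} : Finset _), t ∉ triangles K := by
    intro t ht
    rw [Finset.mem_singleton] at ht
    exact ht ▸ fun h => hempty h.1
  have hsum := fun {R : Type} [AddCommMonoid R] (f : Finset V → R) (x y : V) =>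
    edgeSum_replace hfin hfin' hA htri f x y
  have hpair : ∀ x ∈ T, ∀ y ∈ T, x ≠ y → (graph K).Adj x y := by
    intro x hx y hy hxy
    simp only [hT, Finset.mem_insert, Finset.mem_singleton] at hx hy
    rcases hx with rfl | rfl | rfl <;> rcases hy with rfl | rfl | rfl <;>
      first
      | exact absurd rfl hxy
      | assumption
      | exact SimpleGraph.Adj.symm (by assumption)
  have hle2 : ∀ x y, (graph K).Adj x y → edgeSum K (fun _ => 1) x y ≤ 2 := by
    intro x y hxy
    have := hD.count hxy
    omega
  -- The number is odd by `exists_chain_touches` and at most two by the boundary count.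
  have hone : ∀ x ∈ T, ∀ y ∈ T, x ≠ y →
      edgeSum K (fun t => if Touches K a b c t then 1 else 0) x y = 1 := by
    intro x hx y hy hxy
    have h1 := hle2 x y (hpair x hx y hy hxy)
    rw [edgeSum_split (Touches K a b c)] at h1
    have h2 := hchain x y (hpair x hx y hy hxy)
    rw [if_pos ⟨hx, hy⟩] at h2
    have h3 : ((edgeSum K (fun t => if Touches K a b c t then 1 else 0) x y : ℕ) : ZMod 2) = 1 := by
      rw [← h2]
      simp [edgeSum]
    have h4 : edgeSum K (fun t => if Touches K a b c t then 1 else 0) x y ≤ 2 := by omega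
    interval_cases edgeSum K (fun t => if Touches K a b c t then 1 else 0) x y
    · exact absurd h3 (by decide)
    · rfl
    · exact absurd h3 (by decide)
  have hzero : ∀ {R : Type} [AddCommMonoid R] (f : Finset V → R) (x y : V),
      ¬ IsEnclosed K a b c x → ¬ IsEnclosed K a b c y → ¬ (x ∈ T ∧ y ∈ T) →
      edgeSum K (fun t => if Touches K a b c t then f t else 0) x y = 0 := by
    intro R _ f x y hx hy hxy
    refine edgeSum_eq_zero hfin fun t ht hxt hyt => if_neg fun hM => hxy ⟨?_, ?_⟩
    · exact hM.mem_of_notEnclosed ht.1 hxt hx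
    · exact hM.mem_of_notEnclosed ht.1 hyt hy
  have hadj' : ∀ x y, (graph K').Adj x y ↔
      (graph K).Adj x y ∧ ¬ IsEnclosed K a b c x ∧ ¬ IsEnclosed K a b c y := by
    intro x y
    constructor
    · rintro ⟨hne, ⟨h1, h2⟩ | h1⟩
      · exact ⟨⟨hne, h1⟩, h2 x (by simp), h2 y (by simp)⟩
      · have h2 : ({x, y} : Finset V).card = 3 := by
          rw [show ({x, y} : Finset V) = T from h1, hTcard]
        have := Finset.card_le_two (a := x) (b := y)
        omega
    · rintro ⟨h1, h2, h3⟩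
      refine ⟨h1.1, .inl ⟨h1.2, ?_⟩⟩
      intro z hz
      simp only [Finset.mem_insert, Finset.mem_singleton] at hz
      rcases hz with rfl | rfl <;> assumption
  have hTE : ∀ x ∈ T, ¬ IsEnclosed K a b c x := fun x hx h => h.notMem hx
  have hcount1 : ∀ x y, (graph K').Adj x y →
      edgeSum K' (fun _ => 1) x y = edgeSum K (fun _ => 1) x y := by
    intro x y hxy
    obtain ⟨h1, h2, h3⟩ := (hadj' x y).1 hxy
    rw [hsum (R := ℕ), edgeSum_split (Touches K a b c) (fun _ => 1), Finset.sum_singleton]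
    congr 1
    by_cases h : x ∈ T ∧ y ∈ T
    · rw [if_pos h, hone x h.1 y h.2 h1.1]
    · rw [if_neg h, hzero _ x y h2 h3 h]
  have hvert : ∀ x, x ∈ vertices K' ↔ x ∈ vertices K ∧ ¬ IsEnclosed K a b c x := by
    intro x
    constructor
    · rintro (⟨h1, h2⟩ | h1)
      · exact ⟨h1, h2 x (by simp)⟩
      · have h2 : ({x} : Finset V).card = 3 := by
          rw [show ({x} : Finset V) = T from h1, hTcard]
        simp at h2
    · rintro ⟨h1, h2⟩
      exact .inl ⟨h1, by simpa using h2⟩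
  have hbd : ∀ x y, s(x, y) ∈ w.edges → (graph K).Adj x y ∧ ¬ IsEnclosed K a b c x := by
    intro x y h
    have hxy : (graph K).Adj x y := w.adj_of_mem_edges h
    refine ⟨hxy, fun hx => ?_⟩
    have h1 := hD.count hxy
    have h2 := hx.isInterior.edgeSum_eq_two hfin hxy
    have h3 := List.count_pos_iff.2 h
    omega
  have hedge : ∀ x y, s(x, y) ∈ w.edges → (graph K').Adj x y := fun x y h =>
    (hadj' x y).2 ⟨(hbd x y h).1, (hbd x y h).2, (hbd y x (by rwa [Sym2.eq_swap])).2⟩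
  have hp' : p ∈ vertices K' := by
    -- Enclosed vertices are on no edge of the boundary walk; for the base point `p` to survive, the
    -- walk must have an edge.
    have h3 : 3 ≤ w.length := by
      refine three_le_length hfin hD.noCycle hD.boundary ?_
      by_contra hcon
      have h1 := hone a (by simp [hT]) b (by simp [hT]) hab.1
      rw [edgeSum_eq_zero hfin fun t ht => absurd ⟨t, ht⟩ hcon] at h1
      exact zero_ne_one h1
    have h4 := w.adj_getVert_succ (i := 0) (by omega)
    have h5 : s(w.getVert 0, w.getVert 1) ∈ w.edges := by
      rw [edges_eq_map_range]
      exact List.mem_map.2 ⟨0, List.mem_range.2 (by omega), rfl⟩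
    have h6 := mem_vertices_of_adj (hedge _ _ h5)
    rwa [SimpleGraph.Walk.getVert_zero] at h6
  obtain ⟨w', he, hs, hw'⟩ := hD.boundary.exists_transfer hfin' hfin hp' hedge
    fun x y hxy => .inl ⟨((hadj' x y).1 hxy).1, hcount1 x y hxy⟩
  obtain ⟨t₁, ht₁, hat₁, hbt₁, hM₁⟩ : ∃ t ∈ triangles K, a ∈ t ∧ b ∈ t ∧ Touches K a b c t := by
    by_contra hcon
    push Not at hcon
    have h1 := hone a (by simp [hT]) b (by simp [hT]) hab.1
    rw [edgeSum_eq_zero hfin fun t ht hx hy => if_neg (hcon t ht hx hy)] at h1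
    exact zero_ne_one h1
  obtain ⟨t₂, ht₂, hbt₂, hct₂, hM₂⟩ : ∃ t ∈ triangles K, b ∈ t ∧ c ∈ t ∧ Touches K a b c t := by
    by_contra hcon
    push Not at hcon
    have h1 := hone b (by simp [hT]) c (by simp [hT]) hbc.1
    rw [edgeSum_eq_zero hfin fun t ht hx hy => if_neg (hcon t ht hx hy)] at h1
    exact zero_ne_one h1
  -- A triangle containing `a, b, c` would fill the empty triangle. So at least two triangles are
  -- removed and only one is added.
  have ht₁₂ : t₁ ≠ t₂ := by
    rintro rfl
    refine hempty (face_mono ht₁.1 ?_ ⟨a, by simp [hT]⟩)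
    intro x hx
    simp only [hT, Finset.mem_insert, Finset.mem_singleton] at hx
    rcases hx with rfl | rfl | rfl <;> assumption
  refine ⟨⟨w', he, hs, hfin', ?_, ?_, ?_, hw'⟩, ?_⟩
  · rintro s (⟨hs, -⟩ | rfl)
    · exact hD.card_le s hs
    · exact Finset.card_le_three
  -- Sending all enclosed vertices to `a` is a simplicial retraction of `K` onto the new complex,
  -- along which cocycles pull back.
  · let φ : V → V := fun x => if IsEnclosed K a b c x then a else x
    have hφ : ∀ s ∈ K.faces, s.image φ ∈ K'.faces := by
      intro s hs
      by_cases hM : Touches K a b c s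
      · refine face_mono (K := K') (s := T) (.inr rfl) ?_ ((face_nonempty hs).image _)
        intro z hz
        obtain ⟨x, hx, rfl⟩ := Finset.mem_image.1 hz
        by_cases hxE : IsEnclosed K a b c x
        · simp [φ, hxE, hT]
        · simp only [φ, if_neg hxE]
          exact hM.mem_of_notEnclosed hs hx hxE
      · have : s.image φ = s := by
          conv_rhs => rw [← Finset.image_id (s := s)]
          refine Finset.image_congr fun x hx => if_neg fun h => hM ⟨x, hx, h⟩
        rw [this]
        exact .inl ⟨hs, fun x hx h => hM ⟨x, hx, h⟩⟩
    have hφid : ∀ x, ¬ IsEnclosed K a b c x → φ x = x := fun x h => if_neg h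
    refine isSimplyConnected_of_exists_primitive ⟨p, hp'⟩ ?_ ?_
    · intro x hx y hy
      have h1 := (hvert x).1 hx
      have h2 := (hvert y).1 hy
      have h3 := reachable_of_forall_adj (B := graph K') (φ := φ) (fun u v huv => ?_)
        (hD.simplyConnected.connected x h1.1 y h2.1)
      · rwa [hφid x h1.2, hφid y h2.2] at h3
      · by_cases h : φ u = φ v
        · rw [h]
        · have h4 := hφ _ huv.2
          rw [Finset.image_insert, Finset.image_singleton] at h4
          exact SimpleGraph.Adj.reachable ⟨h, h4⟩
    · intro H _ g hg
      obtain ⟨h, hh⟩ := hD.simplyConnected.exists_primitive (hg.pullback hφ)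
      refine ⟨h, fun x y hxy => ?_⟩
      obtain ⟨h1, h2, h3⟩ := (hadj' x y).1 hxy
      rw [hh x y h1, pullback, hφid x h2, hφid y h3, if_neg hxy.1]
  · intro f' hf'
    -- A 2-cycle of the new complex becomes one of `K` by spreading its value on the new triangle
    -- over all removed triangles.
    let F : Finset V → ZMod 2 := fun t => if Touches K a b c t then f' T else f' t
    have hF := hD.noCycle F (by
      have hEnc : ∀ x y, (graph K).Adj x y → IsEnclosed K a b c x → edgeSum K F x y = 0 := by
        intro x y hxy hx
        rw [edgeSum_congr hfin (g := fun _ => f' T * 1), edgeSum_mul, edgeSum_one_cast,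
          hx.isInterior.edgeSum_eq_two hfin hxy]
        · exact mul_zero _
        · intro t _ hxt _
          rw [mul_one]
          exact if_pos ⟨x, hxt, hx⟩
      intro x y hxy
      by_cases hx : IsEnclosed K a b c x
      · exact hEnc x y hxy hx
      by_cases hy : IsEnclosed K a b c y
      · rw [edgeSum_comm]
        exact hEnc y x hxy.symm hy
      have h1 := hf' x y ((hadj' x y).2 ⟨hxy, hx, hy⟩)
      rw [hsum (R := ZMod 2), Finset.sum_singleton] at h1
      rw [edgeSum_split (Touches K a b c)]
      refine Eq.trans ?_ h1
      congr 1
      · refine edgeSum_congr hfin fun t _ _ _ => ?_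
        by_cases hM : Touches K a b c t <;> simp [F, hM]
      · by_cases h : x ∈ T ∧ y ∈ T
        · rw [if_pos h, edgeSum_congr hfin
            (g := fun t => f' T * if Touches K a b c t then 1 else 0), edgeSum_mul,
            hchain x y hxy, if_pos h, mul_one]
          intro t _ _ _
          by_cases hM : Touches K a b c t <;> simp [F, hM]
        · rw [if_neg h, hzero _ x y hx hy h])
    intro t ht
    rcases (htri t).1 ht with ⟨h1, h2⟩ | h1
    · have := hF t h1
      simpa only [F, if_neg h2] using this
    · rw [Finset.mem_singleton.1 h1]
      have := hF t₁ ht₁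
      simpa only [F, if_pos hM₁] using this
  · rw [ncard_triangles hfin, ncard_triangles hfin']
    have h1 : triF K' = insert T ((triF K).filter fun t => ¬ Touches K a b c t) := by
      ext t
      rw [mem_triF hfin', htri, Finset.mem_insert, Finset.mem_filter, mem_triF hfin,
        Finset.mem_singleton, or_comm]
    have h2 := Finset.card_filter_add_card_filter_not (s := triF K) (Touches K a b c)
    have h3 : 2 ≤ ((triF K).filter (Touches K a b c)).card := by
      rw [← Finset.card_pair ht₁₂]
      refine Finset.card_le_card ?_
      intro t ht
      simp only [Finset.mem_insert, Finset.mem_singleton] at ht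
      rcases ht with rfl | rfl
      · exact Finset.mem_filter.2 ⟨(mem_triF hfin).2 ht₁, hM₁⟩
      · exact Finset.mem_filter.2 ⟨(mem_triF hfin).2 ht₂, hM₂⟩
    rw [h1]
    have h4 := Finset.card_insert_le T ((triF K).filter fun t => ¬ Touches K a b c t)
    omega

end AMove

/-! ### Flipping an edge -/

section Flip

variable {V : Type u} {K : PreAbstractSimplicialComplex V} {a b c d : V}

theorem edgeSum_indicator (hfin : K.faces.Finite) {R : Type*} [AddCommMonoid R] {t₀ : Finset V}
    (ht₀ : t₀ ∈ triangles K) (r : R) (x y : V) :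
    edgeSum K (fun t => if t = t₀ then r else 0) x y = if x ∈ t₀ ∧ y ∈ t₀ then r else 0 := by
  unfold edgeSum
  rw [Finset.sum_ite_eq']
  simp [mem_triF hfin, ht₀]

/-- Every edge of a tetrahedron lies in two of its faces. -/
theorem tetrahedron_mod_two (hab : a ≠ b) (hac : a ≠ c) (had : a ≠ d) (hbc : b ≠ c) (hbd : b ≠ d)
    (hcd : c ≠ d) {x y : V} (hxy : x ≠ y) (r : ZMod 2) :
    ((if x ∈ ({a, b, c} : Finset V) ∧ y ∈ ({a, b, c} : Finset V) then r else 0) +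
      (if x ∈ ({a, b, d} : Finset V) ∧ y ∈ ({a, b, d} : Finset V) then r else 0)) +
    ((if x ∈ ({a, c, d} : Finset V) ∧ y ∈ ({a, c, d} : Finset V) then r else 0) +
      (if x ∈ ({b, c, d} : Finset V) ∧ y ∈ ({b, c, d} : Finset V) then r else 0)) = 0 := by
  have hr : r + r = 0 := CharTwo.add_self_eq_zero r
  have hyx := hxy.symm
  simp only [Finset.mem_insert, Finset.mem_singleton]
  by_cases a1 : x = a
  · subst a1
    by_cases b2 : y = b
    · subst b2; simp [*]
    by_cases b3 : y = c
    · subst b3; simp [*]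
    by_cases b4 : y = d
    · subst b4; simp [*]
    simp [b2, b3, b4, hxy.symm]
  by_cases a2 : x = b
  · subst a2
    by_cases b2 : y = a
    · subst b2; simp [*]
    by_cases b3 : y = c
    · subst b3; simp [*]
    by_cases b4 : y = d
    · subst b4; simp [*]
    simp [b2, b3, b4, hxy.symm]
  by_cases a3 : x = c
  · subst a3
    by_cases b2 : y = a
    · subst b2; simp [*]
    by_cases b3 : y = b
    · subst b3; simp [*]
    by_cases b4 : y = d
    · subst b4; simp [*]
    simp [b2, b3, b4, hxy.symm]
  by_cases a4 : x = d
  · subst a4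
    by_cases b2 : y = a
    · subst b2; simp [*]
    by_cases b3 : y = b
    · subst b3; simp [*]
    by_cases b4 : y = c
    · subst b4; simp [*]
    simp [b2, b3, b4, hxy.symm]
  simp [a1, a2, a3, a4]

/-- Each of the four edges other than `ab` and `cd` lies in one of the two old triangles and in one
of the two new ones. -/
theorem flip_count (hab : a ≠ b) (hac : a ≠ c) (had : a ≠ d) (hbc : b ≠ c) (hbd : b ≠ d)
    (hcd : c ≠ d) {x y : V} (hxy : x ≠ y) (h1 : ¬ (a ∈ ({x, y} : Finset V) ∧ b ∈ ({x, y} : Finset V)))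
    (h2 : ¬ (c ∈ ({x, y} : Finset V) ∧ d ∈ ({x, y} : Finset V))) :
    ((if x ∈ ({a, b, c} : Finset V) ∧ y ∈ ({a, b, c} : Finset V) then 1 else 0) +
      (if x ∈ ({a, b, d} : Finset V) ∧ y ∈ ({a, b, d} : Finset V) then 1 else 0)) =
    ((if x ∈ ({a, c, d} : Finset V) ∧ y ∈ ({a, c, d} : Finset V) then 1 else 0) +
      (if x ∈ ({b, c, d} : Finset V) ∧ y ∈ ({b, c, d} : Finset V) then 1 else 0)) := by
  have hyx := hxy.symm
  simp only [Finset.mem_insert, Finset.mem_singleton] at h1 h2 ⊢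
  by_cases a1 : x = a
  · subst a1
    have b2 : y ≠ b := fun e => h1 (by simp [e])
    by_cases b3 : y = c
    · subst b3; simp [*]
    by_cases b4 : y = d
    · subst b4; simp [*]
    simp [b2, b3, b4, hxy.symm]
  by_cases a2 : x = b
  · subst a2
    have b2 : y ≠ a := fun e => h1 (by simp [e])
    by_cases b3 : y = c
    · subst b3; simp [*]
    by_cases b4 : y = d
    · subst b4; simp [*]
    simp [b2, b3, b4, hxy.symm]
  by_cases a3 : x = c
  · subst a3
    have b4 : y ≠ d := fun e => h2 (by simp [e])
    by_cases b2 : y = a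
    · subst b2; simp [*]
    by_cases b3 : y = b
    · subst b3; simp [*]
    simp [b2, b3, b4, hxy.symm]
  by_cases a4 : x = d
  · subst a4
    have b4 : y ≠ c := fun e => h2 (by simp [e])
    by_cases b2 : y = a
    · subst b2; simp [*]
    by_cases b3 : y = b
    · subst b3; simp [*]
    simp [b2, b3, b4, hxy.symm]
  simp [a1, a2, a3, a4]

theorem face_of_not_hasEmptyTriangle (hE : ¬ HasEmptyTriangle K) {x y z : V}
    (hxy : (graph K).Adj x y) (hyz : (graph K).Adj y z) (hxz : (graph K).Adj x z) :
    ({x, y, z} : Finset V) ∈ triangles K := by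
  refine triangle_mem ?_ hxy.1 hxz.1 hyz.1
  by_contra h
  exact hE ⟨x, y, z, hxy, hyz, hxz, h⟩

/-- The apices of two adjacent triangles are not adjacent, since there are no tetrahedra. -/
theorem not_adj_apex (hfin : K.faces.Finite) (hcyc : NoCycle K) (hE : ¬ HasEmptyTriangle K)
    (h₁ : ({a, b, c} : Finset V) ∈ triangles K) (h₂ : ({a, b, d} : Finset V) ∈ triangles K)
    (hcd : c ≠ d) : ¬ (graph K).Adj c d := by
  intro hadj
  obtain ⟨hab, hac, hbc⟩ := ne_of_triangle h₁
  obtain ⟨-, had, hbd⟩ := ne_of_triangle h₂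
  have e : ∀ {x y z : V}, ({x, y, z} : Finset V) ∈ triangles K → (graph K).Adj x z := fun h =>
    adj_of_face h.1 (by simp) (by simp) (ne_of_triangle h).2.1
  have e' : ∀ {x y z : V}, ({x, y, z} : Finset V) ∈ triangles K → (graph K).Adj y z := fun h =>
    adj_of_face h.1 (by simp) (by simp) (ne_of_triangle h).2.2
  have h₃ := face_of_not_hasEmptyTriangle hE (e h₁) hadj (e h₂)
  have h₄ := face_of_not_hasEmptyTriangle hE (e' h₁) hadj (e' h₂)
  -- If `c` and `d` were adjacent, the four faces of the tetrahedron `abcd` would form a 2-cycle.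
  have h := hcyc (fun t => ((if t = {a, b, c} then 1 else 0) + (if t = {a, b, d} then 1 else 0)) +
      ((if t = {a, c, d} then 1 else 0) + (if t = {b, c, d} then 1 else 0))) (fun x y hxy => by
    rw [edgeSum_add, edgeSum_add, edgeSum_add, edgeSum_indicator hfin h₁, edgeSum_indicator hfin h₂,
      edgeSum_indicator hfin h₃, edgeSum_indicator hfin h₄]
    exact tetrahedron_mod_two hab hac had hbc hbd hcd hxy.1 1) _ h₁
  have n : ∀ {s t : Finset V} (x : V), x ∉ s → x ∈ t → s ≠ t := fun x h h' e => h (e ▸ h')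
  rw [if_pos rfl, if_neg (n d (by simp [had.symm, hbd.symm, hcd.symm]) (by simp)),
    if_neg (n d (by simp [had.symm, hbd.symm, hcd.symm]) (by simp)),
    if_neg (n d (by simp [had.symm, hbd.symm, hcd.symm]) (by simp))] at h
  exact absurd h (by decide)

theorem subset_of_notMem {s t : Finset V} {x : V} (h : s ⊆ insert x t) (hx : x ∉ s) : s ⊆ t :=
  (Finset.subset_insert_iff_of_notMem hx).1 h

variable (K) in
/-- The result of replacing the edge `ab` by `cd`. -/
def flipComplex (h₁ : ({a, b, c} : Finset V) ∈ triangles K)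
    (h₂ : ({a, b, d} : Finset V) ∈ triangles K) : PreAbstractSimplicialComplex V where
  faces := flipFaces K a b c d
  isRelLowerSet_faces := by
    obtain ⟨hab, hac, hbc⟩ := ne_of_triangle h₁
    obtain ⟨-, had, hbd⟩ := ne_of_triangle h₂
    have key : ∀ x ∈ ({a, b} : Finset V), ∀ t : Finset V, t.Nonempty → t ⊆ {x, c, d} →
        t ∈ flipFaces K a b c d := by
      intro x hx t hne ht
      have hxc : ({x, c} : Finset V) ∈ K.faces := face_mono h₁.1 (by
        intro z; simp at hx ⊢; rcases hx with rfl | rfl <;> tauto) ⟨x, by simp⟩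
      have hxd : ({x, d} : Finset V) ∈ K.faces := face_mono h₂.1 (by
        intro z; simp at hx ⊢; rcases hx with rfl | rfl <;> tauto) ⟨x, by simp⟩
      have hnab : ¬ (a ∈ t ∧ b ∈ t) := by
        rintro ⟨h1, h2⟩
        have h3 := ht h1
        have h4 := ht h2
        simp at h3 h4 hx
        rcases hx with rfl | rfl <;> simp_all
      by_cases hc : c ∈ t
      · by_cases hd : d ∈ t
        · right
          have hcd : ({c, d} : Finset V) ⊆ t := by
            intro z; simp only [Finset.mem_insert, Finset.mem_singleton]
            rintro (rfl | rfl) <;> assumption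
          by_cases hxt : x ∈ t
          · have e : t = {x, c, d} := ht.antisymm (Finset.insert_subset hxt hcd)
            simp only [Finset.mem_insert, Finset.mem_singleton] at hx
            rcases hx with rfl | rfl
            · exact .inr (.inl e)
            · exact .inr (.inr e)
          · exact .inl ((subset_of_notMem ht hxt).antisymm hcd)
        · left
          refine ⟨face_mono hxc ?_ hne, hnab⟩
          refine subset_of_notMem (x := d) (ht.trans ?_) hd
          intro z; simp; tauto
      · left
        refine ⟨face_mono hxd ?_ hne, hnab⟩
        refine subset_of_notMem (x := c) (ht.trans ?_) hc
        intro z; simp; tauto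
    rintro s (⟨hs, hsab⟩ | rfl | rfl | rfl)
    · exact ⟨face_nonempty hs, fun t ht hne =>
        .inl ⟨face_mono hs ht hne, fun h => hsab ⟨ht h.1, ht h.2⟩⟩⟩
    · exact ⟨⟨c, by simp⟩, fun t ht hne => key a (by simp) t hne
        (ht.trans (Finset.subset_insert _ _))⟩
    · exact ⟨⟨a, by simp⟩, fun t ht hne => key a (by simp) t hne ht⟩
    · exact ⟨⟨b, by simp⟩, fun t ht hne => key b (by simp) t hne ht⟩

theorem vertices_flipComplex (h₁ : ({a, b, c} : Finset V) ∈ triangles K)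
    (h₂ : ({a, b, d} : Finset V) ∈ triangles K) :
    vertices (flipComplex K h₁ h₂) = vertices K := by
  have hab := (ne_of_triangle h₁).1
  ext x
  constructor
  · intro hx
    have hcv : c ∈ vertices K := mem_vertices_of_face h₁.1 (by simp)
    rcases hx with ⟨h1, -⟩ | h1 | h1 | h1
    · exact h1
    · have : c ∈ ({x} : Finset V) := (show ({x} : Finset V) = {c, d} from h1) ▸ (by simp)
      rwa [← Finset.mem_singleton.1 this]
    · have : c ∈ ({x} : Finset V) := (show ({x} : Finset V) = {a, c, d} from h1) ▸ (by simp)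
      rwa [← Finset.mem_singleton.1 this]
    · have : c ∈ ({x} : Finset V) := (show ({x} : Finset V) = {b, c, d} from h1) ▸ (by simp)
      rwa [← Finset.mem_singleton.1 this]
  · intro hx
    refine Or.inl ⟨hx, ?_⟩
    rintro ⟨h1, h2⟩
    exact hab ((Finset.mem_singleton.1 h1).trans (Finset.mem_singleton.1 h2).symm)

/-- A cocycle on the flipped complex is carried back to `K` by giving the deleted edge `ab` its
value along the detour through `c`. The detour through `d` gives the same value, so the relations on
the two old triangles hold. A primitive on `K` then also fits the new edge `cd`, by the relation on
`acd`. -/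
theorem exists_primitive_flip (hK : IsSimplyConnected K)
    {K' : PreAbstractSimplicialComplex V} (hab : a ≠ b)
    (h3 : ({a, c, d} : Finset V) ∈ triangles K') (h4 : ({b, c, d} : Finset V) ∈ triangles K')
    (hold : ∀ s ∈ K.faces, ¬ (a ∈ s ∧ b ∈ s) → s ∈ K'.faces)
    (hnew : ∀ x y, (graph K').Adj x y → (graph K).Adj x y ∧ ¬ (a ∈ ({x, y} : Finset V) ∧
      b ∈ ({x, y} : Finset V)) ∨ (x = c ∧ y = d ∨ x = d ∧ y = c))
    (habt : ∀ z, ({a, b, z} : Finset V) ∈ K.faces → a ≠ z → b ≠ z → z = c ∨ z = d)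
    {H : Type*} [Group H] {g : V → V → H} (hg : IsCocycle K' g) :
    ∃ h, IsPrimitive K' g h := by
  obtain ⟨hac, had, hcd⟩ := ne_of_triangle h3
  obtain ⟨hbc, hbd, -⟩ := ne_of_triangle h4
  have acd : (graph K').Adj c d := adj_of_face h3.1 (by simp) (by simp) hcd
  have aac : (graph K').Adj a c := adj_of_face h3.1 (by simp) (by simp) hac
  have aad : (graph K').Adj a d := adj_of_face h3.1 (by simp) (by simp) had
  have abc : (graph K').Adj b c := adj_of_face h4.1 (by simp) (by simp) hbc
  have abd : (graph K').Adj b d := adj_of_face h4.1 (by simp) (by simp) hbd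
  have e3 : g a d = g a c * g c d := (hg.mul a c d aac acd aad h3.1).symm
  have e4 : g b d = g b c * g c d := (hg.mul b c d abc acd abd h4.1).symm
  have hzc : ∀ z, z = c ∨ z = d → g a z * g z b = g a c * g c b := by
    rintro z (rfl | rfl)
    · rfl
    · rw [hg.inv_eq abd, hg.inv_eq abc, e3, e4, mul_inv_rev]
      group
  have hzadj : ∀ z, z = c ∨ z = d → (graph K').Adj a z ∧ (graph K').Adj b z := by
    rintro z (rfl | rfl)
    · exact ⟨aac, abc⟩
    · exact ⟨aad, abd⟩
  let k : V → V → H := fun x y => if x = a ∧ y = b then g a c * g c b else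
    if x = b ∧ y = a then g b c * g c a else g x y
  have hkab : k a b = g a c * g c b := by simp [k]
  have hkba : k b a = g b c * g c a := by simp [k, hab, hab.symm]
  have hk : ∀ x y, ¬ (a ∈ ({x, y} : Finset V) ∧ b ∈ ({x, y} : Finset V)) → k x y = g x y := by
    intro x y h
    have h1 : ¬ (x = a ∧ y = b) := by rintro ⟨rfl, rfl⟩; exact h (by simp)
    have h2 : ¬ (x = b ∧ y = a) := by rintro ⟨rfl, rfl⟩; exact h (by simp)
    simp [k, h1, h2]
  have hkinv : ∀ x y, (graph K).Adj x y → k x y * k y x = 1 := by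
    intro x y hxy
    by_cases h : a ∈ ({x, y} : Finset V) ∧ b ∈ ({x, y} : Finset V)
    · have : (x = a ∧ y = b) ∨ (x = b ∧ y = a) := by
        simp only [Finset.mem_insert, Finset.mem_singleton] at h
        rcases h with ⟨rfl | rfl, rfl | rfl⟩
        · exact absurd rfl hab
        · exact .inl ⟨rfl, rfl⟩
        · exact .inr ⟨rfl, rfl⟩
        · exact absurd rfl hab
      rcases this with ⟨rfl, rfl⟩ | ⟨rfl, rfl⟩
      · rw [hkab, hkba, hg.inv_eq aac, hg.inv_eq abc]; group
      · rw [hkab, hkba, hg.inv_eq aac, hg.inv_eq abc]; group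
    · rw [hk x y h, hk y x (by rwa [Finset.pair_comm])]
      exact hg.inv x y ⟨hxy.1, hold _ hxy.2 h⟩
  have base : ∀ z, ({a, b, z} : Finset V) ∈ K.faces → a ≠ z → b ≠ z →
      k a b * k b z = k a z := by
    intro z hz haz hbz
    have hz' := habt z hz haz hbz
    rw [hkab, hk b z (by simp [hab, haz]), hk a z (by simp [hab.symm, hbz]), ← hzc z hz',
      mul_assoc, hg.inv _ _ (hzadj z hz').2.symm, mul_one]
  have hkc : IsCocycle K k := by
    refine ⟨hkinv, fun x y z hxy hyz hxz hf => ?_⟩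
    have ikxy := hkinv x y hxy
    have ikyz := hkinv y z hyz
    have ikxz := hkinv x z hxz
    have ikyx := hkinv y x hxy.symm
    have ikzy := hkinv z y hyz.symm
    have ikzx := hkinv z x hxz.symm
    -- The cocycle relation for one ordering of a triangle implies it for the other five; only the
    -- ordering `a, b, z` is checked directly.
    have cyc : ∀ {x y z : V}, k x y * k y x = 1 → k y z * k z y = 1 → k x z * k z x = 1 →
        k y x * k x y = 1 → k z y * k y z = 1 → k z x * k x z = 1 →
        k x y * k y z = k x z → (k y x * k x z = k y z ∧ k y z * k z x = k y x ∧
          k x z * k z y = k x y ∧ k z x * k x y = k z y ∧ k z y * k y x = k z x) := by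
      intro x y z h1 h2 h3 h4 h5 h6 h
      have i1 := eq_inv_of_mul_eq_one_left h4
      have i2 := eq_inv_of_mul_eq_one_left h5
      have i3 := eq_inv_of_mul_eq_one_left h6
      rw [i1, i2, i3, ← h]
      refine ⟨?_, ?_, ?_, ?_, ?_⟩ <;> group
    by_cases h : a ∈ ({x, y, z} : Finset V) ∧ b ∈ ({x, y, z} : Finset V)
    · have perm : ∀ {p q r : V}, ({p, q, r} : Finset V) = {x, y, z} →
          ({p, q, r} : Finset V) ∈ K.faces := fun e => e ▸ hf
      simp only [Finset.mem_insert, Finset.mem_singleton] at h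
      rcases h with ⟨rfl | rfl | rfl, rfl | rfl | rfl⟩
      · exact absurd rfl hab
      · exact base z hf hxz.1 hyz.1
      · have := base y (perm (by ext; simp; tauto)) hxy.1 hyz.1.symm
        exact (cyc ikxz ikzy ikxy ikzx ikyz ikyx this).2.2.1
      · have := base z (perm (by ext; simp; tauto)) hyz.1 hxz.1
        exact (cyc ikyx ikxz ikyz ikxy ikzx ikzy this).1
      · exact absurd rfl hab
      · have := base x (perm (by ext; simp; tauto)) hxy.1.symm hxz.1.symm
        exact (cyc ikyz ikzx ikyx ikzy ikxz ikxy this).2.2.2.1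
      · have := base y (perm (by ext; simp; tauto)) hyz.1.symm hxy.1
        exact (cyc ikzx ikxy ikzy ikxz ikyx ikyz this).2.1
      · have := base x (perm (by ext; simp; tauto)) hxz.1.symm hxy.1.symm
        exact (cyc ikzy ikyx ikzx ikyz ikxy ikxz this).2.2.2.2
      · exact absurd rfl hab
    · have sub : ∀ {p q : V}, p ∈ ({x, y, z} : Finset V) → q ∈ ({x, y, z} : Finset V) →
          ¬ (a ∈ ({p, q} : Finset V) ∧ b ∈ ({p, q} : Finset V)) := by
        intro p q hp hq h'
        have : ({p, q} : Finset V) ⊆ {x, y, z} := by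
          intro w hw
          simp only [Finset.mem_insert, Finset.mem_singleton] at hw
          rcases hw with rfl | rfl <;> assumption
        exact h ⟨this h'.1, this h'.2⟩
      have hxy' := sub (p := x) (q := y) (by simp) (by simp)
      have hyz' := sub (p := y) (q := z) (by simp) (by simp)
      have hxz' := sub (p := x) (q := z) (by simp) (by simp)
      rw [hk _ _ hxy', hk _ _ hyz', hk _ _ hxz']
      exact hg.mul x y z ⟨hxy.1, hold _ hxy.2 hxy'⟩ ⟨hyz.1, hold _ hyz.2 hyz'⟩
        ⟨hxz.1, hold _ hxz.2 hxz'⟩ (hold _ hf h)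
  obtain ⟨h, hh⟩ := hK.exists_primitive hkc
  refine ⟨h, ?_⟩
  have hprim : ∀ x y, (graph K).Adj x y → ¬ (a ∈ ({x, y} : Finset V) ∧ b ∈ ({x, y} : Finset V)) →
      h y = h x * g x y := by
    intro x y hxy hn
    rw [hh x y hxy, hk x y hn]
  have back : ∀ x y, (graph K').Adj x y → ¬ (x = c ∧ y = d) → ¬ (x = d ∧ y = c) →
      h y = h x * g x y := by
    intro x y hxy n1 n2
    rcases hnew x y hxy with ⟨h1, h2⟩ | h1
    · exact hprim x y h1 h2
    · tauto
  have pac := back a c aac (fun h => hac h.1) (fun h => had h.1)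
  have pad := back a d aad (fun h => hac h.1) (fun h => had h.1)
  have pcd : h d = h c * g c d := by rw [pad, pac, e3, mul_assoc]
  intro x y hxy
  by_cases h1 : x = c ∧ y = d
  · rw [h1.1, h1.2, pcd]
  by_cases h2 : x = d ∧ y = c
  · rw [h2.1, h2.2, pcd, mul_assoc, hg.inv _ _ acd, mul_one]
  exact back x y hxy h1 h2

theorem triangle_ne_of_apex_ne (h₁ : ({a, b, c} : Finset V) ∈ triangles K)
    (hcd : c ≠ d) : ({a, b, c} : Finset V) ≠ {a, b, d} := by
  intro e
  have h : c ∈ ({a, b, d} : Finset V) := e ▸ (by simp)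
  simp [(ne_of_triangle h₁).2.1.symm, (ne_of_triangle h₁).2.2.symm, hcd] at h

/-- The boundary count leaves room for at most two triangles on an edge, so the two given ones are
all. -/
theorem IsDisc.mem_pair_iff {p : V} {w : (graph K).Walk p p} (hD : IsDisc K w)
    (h₁ : ({a, b, c} : Finset V) ∈ triangles K) (h₂ : ({a, b, d} : Finset V) ∈ triangles K)
    (hcd : c ≠ d) (t : Finset V) : t ∈ ({{a, b, c}, {a, b, d}} : Finset (Finset V)) ↔
      t ∈ triangles K ∧ (a ∈ t ∧ b ∈ t) := by
  have hsub : ({{a, b, c}, {a, b, d}} : Finset (Finset V)) ⊆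
      (triF K).filter fun t => a ∈ t ∧ b ∈ t := by
    intro t ht
    simp only [Finset.mem_insert, Finset.mem_singleton] at ht
    rw [Finset.mem_filter, mem_triF hD.finite]
    rcases ht with rfl | rfl
    · exact ⟨h₁, by simp, by simp⟩
    · exact ⟨h₂, by simp, by simp⟩
  have hcard : ((triF K).filter fun t => a ∈ t ∧ b ∈ t).card ≤ 2 := by
    have h1 := hD.count (adj_of_face h₁.1 (by simp) (by simp) (ne_of_triangle h₁).1)
    unfold edgeSum at h1
    rw [Finset.sum_const, smul_eq_mul, mul_one] at h1
    omega
  have heq := Finset.eq_of_subset_of_card_le hsub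
    (by rwa [Finset.card_pair (triangle_ne_of_apex_ne h₁ hcd)])
  rw [heq, Finset.mem_filter, mem_triF hD.finite]

/-- The old and the new pair of triangles have the same boundary, apart from the edges `ab` and `cd`
themselves. Both of these are interior, so the boundary walk is not affected. -/
theorem IsDisc.flip {p : V} {w : (graph K).Walk p p} (hD : IsDisc K w)
    (h₁ : ({a, b, c} : Finset V) ∈ triangles K) (h₂ : ({a, b, d} : Finset V) ∈ triangles K)
    (hcd : c ≠ d) (hncd : ¬ (graph K).Adj c d) :
    (∃ w' : (graph (flipComplex K h₁ h₂)).Walk p p, w'.edges = w.edges ∧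
      w'.support = w.support ∧ IsDisc (flipComplex K h₁ h₂) w') ∧
    (∀ t, t ∈ triangles (flipComplex K h₁ h₂) ↔ (t ∈ triangles K ∧ t ≠ {a, b, c} ∧ t ≠ {a, b, d}) ∨
      t = {a, c, d} ∨ t = {b, c, d}) ∧
    (triangles (flipComplex K h₁ h₂)).ncard = (triangles K).ncard := by
  obtain ⟨hab, hac, hbc⟩ := ne_of_triangle h₁
  obtain ⟨-, had, hbd⟩ := ne_of_triangle h₂
  set K' := flipComplex K h₁ h₂ with hK'
  have hfin := hD.finite
  have hfin' : K'.faces.Finite :=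
    (hfin.subset fun s (hs : s ∈ K.faces ∧ _) => hs.1).union (Set.toFinite _)
  have n : ∀ {s t : Finset V} (x : V), x ∉ s → x ∈ t → s ≠ t := fun x h h' e => h (e ▸ h')
  have h₁₂ := triangle_ne_of_apex_ne h₁ hcd
  have h₃₄ : ({a, c, d} : Finset V) ≠ {b, c, d} := n b (by simp [hab.symm, hbc, hbd]) (by simp)
  have hM := hD.mem_pair_iff h₁ h₂ hcd
  have hMne : ∀ t ∈ triangles K, (¬ (a ∈ t ∧ b ∈ t) ↔ t ≠ {a, b, c} ∧ t ≠ {a, b, d}) := by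
    intro t ht
    have := hM t
    simp only [Finset.mem_insert, Finset.mem_singleton, ht, true_and] at this
    rw [← this, not_or]
  have hnT : ∀ t, c ∈ t → d ∈ t → t ∉ K.faces := fun t hc hd ht => hncd (adj_of_face ht hc hd hcd)
  have hA : ∀ t ∈ ({{a, c, d}, {b, c, d}} : Finset (Finset V)), t ∉ triangles K := by
    intro t ht h
    simp only [Finset.mem_insert, Finset.mem_singleton] at ht
    rcases ht with rfl | rfl <;> exact hnT _ (by simp) (by simp) h.1
  have htri : ∀ t, t ∈ triangles K' ↔ (t ∈ triangles K ∧ ¬ (a ∈ t ∧ b ∈ t)) ∨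
      t ∈ ({{a, c, d}, {b, c, d}} : Finset (Finset V)) := by
    intro t
    simp only [Finset.mem_insert, Finset.mem_singleton]
    constructor
    · rintro ⟨⟨h1, h2⟩ | h1 | h1 | h1, h3⟩
      · exact .inl ⟨⟨h1, h3⟩, h2⟩
      · rw [h1] at h3
        have := Finset.card_le_two (a := c) (b := d)
        omega
      · exact .inr (.inl h1)
      · exact .inr (.inr h1)
    · rintro (⟨h1, h2⟩ | rfl | rfl)
      · exact ⟨.inl ⟨h1.1, h2⟩, h1.2⟩
      · exact triangle_mem (.inr (.inr (.inl rfl))) hac had hcd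
      · exact triangle_mem (.inr (.inr (.inr rfl))) hbc hbd hcd
  have h₃ : ({a, c, d} : Finset V) ∈ triangles K' := (htri _).2 (.inr (by simp))
  have h₄ : ({b, c, d} : Finset V) ∈ triangles K' := (htri _).2 (.inr (by simp))
  have hadj' : ∀ x y, (graph K').Adj x y → (graph K).Adj x y ∧ ¬ (a ∈ ({x, y} : Finset V) ∧
      b ∈ ({x, y} : Finset V)) ∨ (x = c ∧ y = d ∨ x = d ∧ y = c) := by
    rintro x y ⟨hne, ⟨h1, h2⟩ | h1 | h1 | h1⟩
    · exact .inl ⟨⟨hne, h1⟩, h2⟩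
    · right
      have hx : x ∈ ({c, d} : Finset V) := (show ({x, y} : Finset V) = {c, d} from h1) ▸ (by simp)
      have hy : y ∈ ({c, d} : Finset V) := (show ({x, y} : Finset V) = {c, d} from h1) ▸ (by simp)
      simp only [Finset.mem_insert, Finset.mem_singleton] at hx hy
      rcases hx with rfl | rfl <;> rcases hy with rfl | rfl
      · exact absurd rfl hne
      · exact .inl ⟨rfl, rfl⟩
      · exact .inr ⟨rfl, rfl⟩
      · exact absurd rfl hne
    · have h2 := h₃.2
      rw [← h1] at h2
      have := Finset.card_le_two (a := x) (b := y)
      omega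
    · have h2 := h₄.2
      rw [← show ({x, y} : Finset V) = {b, c, d} from h1] at h2
      have := Finset.card_le_two (a := x) (b := y)
      omega
  have hsum := fun {R : Type} [AddCommMonoid R] (f : Finset V → R) (x y : V) =>
    edgeSum_replace hfin hfin' hA htri f x y
  have hsumM := fun {R : Type} [AddCommMonoid R] (f : Finset V → R) (x y : V) =>
    edgeSum_filter_eq hfin hM f x y
  have hcount : ∀ x y, (graph K').Adj x y →
      ((graph K).Adj x y ∧ edgeSum K' (fun _ => 1) x y = edgeSum K (fun _ => 1) x y) ∨
      (¬ (graph K).Adj x y ∧ edgeSum K' (fun _ => 1) x y = 2) := by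
    have hcdcount : edgeSum K' (fun _ => 1) c d = 2 := by
      rw [hsum (R := ℕ), Finset.sum_pair h₃₄, edgeSum_eq_zero hfin
        fun t ht h h' => absurd ht.1 (hnT t h h')]
      simp
    intro x y hxy
    rcases hadj' x y hxy with ⟨h1, h2⟩ | ⟨rfl, rfl⟩ | ⟨rfl, rfl⟩
    · left
      refine ⟨h1, ?_⟩
      rw [hsum (R := ℕ), edgeSum_split (fun t => a ∈ t ∧ b ∈ t) (fun _ => 1), hsumM (R := ℕ),
        Finset.sum_pair h₁₂, Finset.sum_pair h₃₄]
      congr 1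
      refine (flip_count hab hac had hbc hbd hcd hxy.1 h2 fun h => ?_).symm
      refine hnT _ h.1 h.2 h1.2
    · exact .inr ⟨hncd, hcdcount⟩
    · exact .inr ⟨fun h => hncd h.symm, by rw [edgeSum_comm]; exact hcdcount⟩
  have hold : ∀ s ∈ K.faces, ¬ (a ∈ s ∧ b ∈ s) → s ∈ K'.faces := fun s hs h => .inl ⟨hs, h⟩
  have hvert : vertices K' = vertices K := vertices_flipComplex h₁ h₂
  have hedge : ∀ x y, s(x, y) ∈ w.edges → (graph K').Adj x y := by
    intro x y h
    have hxy : (graph K).Adj x y := w.adj_of_mem_edges h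
    refine ⟨hxy.1, hold _ hxy.2 ?_⟩
    intro hab'
    have h1 := hD.count hxy
    have h2 := List.count_pos_iff.2 h
    have h3 : edgeSum K (fun _ => 1) x y = 2 := by
      rw [edgeSum_split (fun t => a ∈ t ∧ b ∈ t) (fun _ => 1), hsumM (R := ℕ),
        Finset.sum_pair h₁₂]
      have : (x = a ∧ y = b) ∨ (x = b ∧ y = a) := by
        simp only [Finset.mem_insert, Finset.mem_singleton] at hab'
        rcases hab' with ⟨rfl | rfl, rfl | rfl⟩
        · exact absurd rfl hab
        · exact .inl ⟨rfl, rfl⟩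
        · exact .inr ⟨rfl, rfl⟩
        · exact absurd rfl hab
      have hz : edgeSum K (fun t => if a ∈ t ∧ b ∈ t then 0 else (1 : ℕ)) x y = 0 := by
        refine edgeSum_eq_zero hfin fun t _ hx hy => if_pos ?_
        rcases this with ⟨rfl, rfl⟩ | ⟨rfl, rfl⟩
        · exact ⟨hx, hy⟩
        · exact ⟨hy, hx⟩
      rw [hz]
      rcases this with ⟨rfl, rfl⟩ | ⟨rfl, rfl⟩ <;> simp
    omega
  obtain ⟨w', he, hs, hw'⟩ := hD.boundary.exists_transfer hfin' hfin (hvert ▸ hD.boundary.1) hedge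
    hcount
  refine ⟨⟨w', he, hs, hfin', ?_, ?_, ?_, hw'⟩, ?_, ?_⟩
  · rintro s (⟨hs, -⟩ | rfl | rfl | rfl)
    · exact hD.card_le s hs
    · exact Finset.card_le_two.trans (by norm_num)
    · exact Finset.card_le_three
    · exact Finset.card_le_three
  · refine isSimplyConnected_of_exists_primitive (hvert ▸ hD.simplyConnected.nonempty) ?_ ?_
    · intro x hx y hy
      rw [hvert] at hx hy
      refine reachable_of_forall_adj (B := graph K') (φ := id) (fun u v huv => ?_)
        (hD.simplyConnected.connected x hx y hy)
      by_cases h : a ∈ ({u, v} : Finset V) ∧ b ∈ ({u, v} : Finset V)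
      · have hr : (graph K').Reachable a b :=
          (adj_of_face h₃.1 (x := a) (y := c) (by simp) (by simp) hac).reachable.trans
            (adj_of_face h₄.1 (x := c) (y := b) (by simp) (by simp) hbc.symm).reachable
        simp only [Finset.mem_insert, Finset.mem_singleton] at h
        rcases h with ⟨rfl | rfl, rfl | rfl⟩
        · exact absurd rfl hab
        · exact hr
        · exact hr.symm
        · exact absurd rfl hab
      · exact SimpleGraph.Adj.reachable ⟨huv.1, hold _ huv.2 h⟩
    · intro H _ g hg
      refine exists_primitive_flip hD.simplyConnected hab h₃ h₄ hold hadj' ?_ hg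
      intro z hz haz hbz
      have h1 := (hM {a, b, z}).2 ⟨triangle_mem hz hab haz hbz, by simp, by simp⟩
      have hzz : z ∈ ({a, b, z} : Finset V) := by simp
      simp only [Finset.mem_insert, Finset.mem_singleton] at h1
      rcases h1 with h1 | h1 <;> rw [h1] at hzz <;>
        simp only [Finset.mem_insert, Finset.mem_singleton, haz.symm, hbz.symm, false_or] at hzz
      · exact .inl hzz
      · exact .inr hzz
  · intro f' hf'
    -- The new edge `cd` lies only in these two triangles, so a 2-cycle takes equal values on them;
    -- this common value is given to the two old triangles.
    have hfeq : f' {a, c, d} = f' {b, c, d} := by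
      have h1 := hf' c d (adj_of_face h₃.1 (by simp) (by simp) hcd)
      rw [hsum (R := ZMod 2), Finset.sum_pair h₃₄, edgeSum_eq_zero hfin
        fun t ht h h' => absurd ht.1 (hnT t h h')] at h1
      simp only [Finset.mem_insert, Finset.mem_singleton, true_or, or_true, and_self, if_true,
        zero_add] at h1
      exact CharTwo.add_eq_zero.1 h1
    let F : Finset V → ZMod 2 := fun t => if a ∈ t ∧ b ∈ t then f' {a, c, d} else f' t
    have hF := hD.noCycle F (by
      intro x y hxy
      rw [edgeSum_split (fun t => a ∈ t ∧ b ∈ t), hsumM (R := ZMod 2), Finset.sum_pair h₁₂]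
      have e1 : F {a, b, c} = f' {a, c, d} := if_pos (by simp)
      have e2 : F {a, b, d} = f' {a, c, d} := if_pos (by simp)
      have e3 : edgeSum K (fun t => if a ∈ t ∧ b ∈ t then 0 else F t) x y =
          edgeSum K (fun t => if a ∈ t ∧ b ∈ t then 0 else f' t) x y := by
        refine edgeSum_congr hfin fun t _ _ _ => ?_
        by_cases h : a ∈ t ∧ b ∈ t <;> simp [F, h]
      rw [e1, e2, e3]
      have htet := tetrahedron_mod_two hab hac had hbc hbd hcd hxy.1 (f' {a, c, d})
      rw [CharTwo.add_eq_zero] at htet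
      rw [htet]
      by_cases h : a ∈ ({x, y} : Finset V) ∧ b ∈ ({x, y} : Finset V)
      · have hsub : ∀ t : Finset V, x ∈ t → y ∈ t → a ∈ t ∧ b ∈ t := by
          intro t hx hy
          have : ({x, y} : Finset V) ⊆ t := by
            intro z hz
            rcases Finset.mem_insert.1 hz with rfl | hz
            · exact hx
            · rwa [Finset.mem_singleton.1 hz]
          exact ⟨this h.1, this h.2⟩
        have hz : edgeSum K (fun t => if a ∈ t ∧ b ∈ t then 0 else f' t) x y = 0 :=
          edgeSum_eq_zero hfin fun t _ hx hy => if_pos (hsub t hx hy)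
        rw [hz, if_neg, if_neg, add_zero, add_zero]
        · rintro ⟨hx, hy⟩
          have := (hsub _ hx hy).1
          simp [hab, hac, had] at this
        · rintro ⟨hx, hy⟩
          have := (hsub _ hx hy).2
          simp [hab.symm, hbc, hbd] at this
      · have h1 := hf' x y ⟨hxy.1, hold _ hxy.2 h⟩
        rw [hsum (R := ZMod 2), Finset.sum_pair h₃₄, ← hfeq] at h1
        exact h1)
    intro t ht
    rcases (htri t).1 ht with ⟨h1, h2⟩ | h1
    · have := hF t h1
      simpa only [F, if_neg h2] using this
    · have h0 := hF _ h₁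
      have e1 : F {a, b, c} = f' {a, c, d} := if_pos (by simp)
      rw [e1] at h0
      simp only [Finset.mem_insert, Finset.mem_singleton] at h1
      rcases h1 with rfl | rfl
      · exact h0
      · rw [← hfeq, h0]
  · intro t
    rw [htri t]
    simp only [Finset.mem_insert, Finset.mem_singleton]
    refine or_congr_left (and_congr_right fun ht => hMne t ht)
  · rw [ncard_triangles hfin, ncard_triangles hfin']
    have e1 : triF K' = ((triF K).filter fun t => ¬ (a ∈ t ∧ b ∈ t)) ∪ {{a, c, d}, {b, c, d}} := by
      ext t
      rw [mem_triF hfin', htri, Finset.mem_union, Finset.mem_filter, mem_triF hfin]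
    have e2 : (triF K).filter (fun t => a ∈ t ∧ b ∈ t) = {{a, b, c}, {a, b, d}} := by
      ext t
      rw [hM, Finset.mem_filter, mem_triF hfin]
    have e3 := Finset.card_filter_add_card_filter_not (s := triF K) (fun t => a ∈ t ∧ b ∈ t)
    rw [e1, Finset.card_union_of_disjoint, Finset.card_pair h₃₄]
    · rw [e2, Finset.card_pair h₁₂] at e3
      omega
    · rw [Finset.disjoint_left]
      intro t ht ht'
      exact hA t ht' ((mem_triF hfin).1 (Finset.mem_filter.1 ht).1)

end Flip

/-! ### Contracting an edge -/

section Contraction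

variable {V : Type u} {K : PreAbstractSimplicialComplex V} {a b c d : V}

theorem exists_walk_map {V' : Type*} {A : SimpleGraph V} {B : SimpleGraph V'} (φ : V → V') {x y : V}
    (w : A.Walk x y) (hφ : ∀ u v, s(u, v) ∈ w.edges → B.Adj (φ u) (φ v)) :
    ∃ w' : B.Walk (φ x) (φ y), w'.edges = w.edges.map (Sym2.map φ) ∧
      w'.support = w.support.map φ := by
  induction w with
  | nil => exact ⟨.nil, rfl, rfl⟩
  | @cons x z y h w ih =>
    obtain ⟨w', h1, h2⟩ := ih fun u v huv => hφ u v (by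
      rw [SimpleGraph.Walk.edges_cons]
      exact List.mem_cons_of_mem _ huv)
    exact ⟨.cons (hφ x z (by simp)) w', by simp [h1], by simp [h2]⟩

theorem count_map_eq {α β : Type*} [BEq α] [LawfulBEq α] [BEq β]
    [LawfulBEq β] {g : α → β} {z : β} {u : α} (l : List α)
    (h : ∀ e ∈ l, g e = z ↔ e = u) : (l.map g).count z = l.count u := by
  induction l with
  | nil => rfl
  | cons e l ih =>
    have h1 := h e (by simp)
    rw [List.map_cons, List.count_cons, List.count_cons,
      ih fun e he => h e (List.mem_cons_of_mem _ he)]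
    simp only [beq_iff_eq, h1]

theorem count_map_eq_add {α β : Type*} [BEq α] [LawfulBEq α] [BEq β]
    [LawfulBEq β] {g : α → β} {z : β} {u v : α} (huv : u ≠ v) (l : List α)
    (h : ∀ e ∈ l, g e = z ↔ e = u ∨ e = v) : (l.map g).count z = l.count u + l.count v := by
  induction l with
  | nil => rfl
  | cons e l ih =>
    have h1 := h e (by simp)
    rw [List.map_cons, List.count_cons, List.count_cons, List.count_cons,
      ih fun e he => h e (List.mem_cons_of_mem _ he)]
    simp only [beq_iff_eq, h1]
    by_cases he : e = u
    · subst he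
      simp only [true_or, if_true, huv, if_false]
      omega
    · simp only [he, false_or, if_false]
      omega

/-- The map that collapses the edge `ab` to `a`. -/
def collapse (a b : V) : V → V := fun x => if x = a ∨ x = b then a else x

theorem collapse_of_ne {x : V} (h : ¬ (x = a ∨ x = b)) : collapse a b x = x := if_neg h

theorem collapse_left : collapse a b a = a := if_pos (.inl rfl)

theorem collapse_right : collapse a b b = a := if_pos (.inr rfl)

theorem collapse_eq_iff_of_ne {x y : V} (hy : y ≠ a) : collapse a b x = y ↔ x = y ∧ y ≠ b := by
  unfold collapse
  split_ifs with h
  · constructor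
    · intro e
      exact absurd e.symm hy
    · rintro ⟨rfl, h1⟩
      tauto
  · constructor
    · rintro rfl
      exact ⟨rfl, fun e => h (.inr e)⟩
    · exact And.left

theorem collapse_eq_left {x : V} : collapse a b x = a ↔ x = a ∨ x = b := by
  unfold collapse
  split_ifs with h
  · simp [h]
  · simpa [h] using fun e => h (.inl e)

theorem mem_image_collapse {x : V} {t : Finset V} (hx : x ≠ a) :
    x ∈ t.image (collapse a b) ↔ x ∈ t ∧ x ≠ b := by
  simp only [Finset.mem_image, collapse_eq_iff_of_ne hx]
  constructor
  · rintro ⟨y, hy, rfl, h⟩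
    exact ⟨hy, h⟩
  · rintro ⟨h1, h2⟩
    exact ⟨x, h1, rfl, h2⟩

theorem left_mem_image_collapse {t : Finset V} :
    a ∈ t.image (collapse a b) ↔ a ∈ t ∨ b ∈ t := by
  simp only [Finset.mem_image, collapse_eq_left]
  constructor
  · rintro ⟨y, hy, rfl | rfl⟩
    · exact .inl hy
    · exact .inr hy
  · rintro (h | h)
    · exact ⟨a, h, .inl rfl⟩
    · exact ⟨b, h, .inr rfl⟩

theorem injOn_collapse {t : Finset V} (h : ¬ (a ∈ t ∧ b ∈ t)) :
    Set.InjOn (collapse a b) (t : Set V) := by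
  intro x hx y hy e
  rw [Finset.mem_coe] at hx hy
  by_cases h' : collapse a b y = a
  · have h1 := collapse_eq_left.1 h'
    have h2 := collapse_eq_left.1 (e.trans h')
    rcases h1 with rfl | rfl <;> rcases h2 with rfl | rfl <;> tauto
  · have h1 := (collapse_eq_iff_of_ne h').1 e
    have h2 := (collapse_eq_iff_of_ne (b := b) h').1 rfl
    exact h1.1.trans h2.1.symm

theorem not_injOn_collapse {t : Finset V} (hab : a ≠ b) (h : a ∈ t ∧ b ∈ t) :
    (t.image (collapse a b)).card < t.card := by
  refine lt_of_le_of_ne Finset.card_image_le fun e => hab ?_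
  exact Finset.card_image_iff.1 e (Finset.mem_coe.2 h.1) (Finset.mem_coe.2 h.2)
    (collapse_left.trans collapse_right.symm)

variable (K) in
/-- The links of the end points of the edge `ab` meet only in the apices of the triangles `abc` and
`abd`, which are not adjacent. -/
structure IsContractible (a b c d : V) : Prop where
  left : ({a, b, c} : Finset V) ∈ triangles K
  right : ({a, b, d} : Finset V) ∈ triangles K
  ne : c ≠ d
  not_adj : ¬ (graph K).Adj c d
  eq_or_eq : ∀ x, (graph K).Adj a x → (graph K).Adj b x → x = c ∨ x = d

theorem IsContractible.swap (h : IsContractible K a b c d) : IsContractible K b a c d :=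
  ⟨triangle_perm h.left, triangle_perm h.right, h.ne, h.not_adj, fun x h1 h2 => h.eq_or_eq x h2 h1⟩

/-- If the triangles differed, one would contain `a`, the other `b`, and they would share the
opposite edge. Its ends are common neighbours of `a` and `b`, hence are `c` and `d`, which are not
adjacent. -/
theorem IsContractible.image_injOn (h : IsContractible K a b c d) {s t : Finset V}
    (hs : s ∈ triangles K) (ht : t ∈ triangles K) (hs' : ¬ (a ∈ s ∧ b ∈ s))
    (ht' : ¬ (a ∈ t ∧ b ∈ t)) (e : s.image (collapse a b) = t.image (collapse a b)) : s = t := by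
  have key : ∀ x ∈ s, ¬ (x = a ∨ x = b) → x ∈ t := by
    intro x hx hn
    rw [not_or] at hn
    have h1 := (mem_image_collapse hn.1).2 ⟨hx, hn.2⟩
    rw [e] at h1
    exact ((mem_image_collapse hn.1).1 h1).1
  refine Finset.eq_of_subset_of_card_le (fun x hx => ?_) (by rw [hs.2, ht.2])
  by_contra hxt
  obtain ⟨v, hv, hadj⟩ : ∃ v ∈ t, ∀ y ∈ s, y ≠ x →
      (y ≠ v ∧ ((graph K).Adj x y → (graph K).Adj v y → y = c ∨ y = d) ∧ y ∈ t) := by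
    have hx' : x = a ∨ x = b := by
      by_contra hn
      exact hxt (key x hx hn)
    have h1 : a ∈ t ∨ b ∈ t := by
      rw [← left_mem_image_collapse, ← e, left_mem_image_collapse]
      rcases hx' with rfl | rfl <;> tauto
    rcases hx' with rfl | rfl
    · have hb := h1.resolve_left hxt
      refine ⟨b, hb, fun y hy hyx => ?_⟩
      have hyb : y ≠ b := by rintro rfl; exact hs' ⟨hx, hy⟩
      exact ⟨hyb, h.eq_or_eq y, key y hy (by tauto)⟩
    · have ha := h1.resolve_right hxt
      refine ⟨a, ha, fun y hy hyx => ?_⟩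
      have hya : y ≠ a := by rintro rfl; exact hs' ⟨hy, hx⟩
      exact ⟨hya, h.swap.eq_or_eq y, key y hy (by tauto)⟩
  have hcd : ∀ y ∈ s, y ≠ x → y = c ∨ y = d := fun y hy hyx =>
    (hadj y hy hyx).2.1 (adj_of_face hs.1 hx hy hyx.symm)
      (adj_of_face ht.1 hv (hadj y hy hyx).2.2 (hadj y hy hyx).1.symm)
  obtain ⟨y, z, hxy, hxz, hyz, rfl⟩ := exists_triangle_eq hs hx
  have hyz' : (graph K).Adj y z := adj_of_face hs.1 (by simp) (by simp) hyz
  rcases hcd y (by simp) hxy.symm with rfl | rfl <;>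
    rcases hcd z (by simp) hxz.symm with rfl | rfl
  · exact hyz rfl
  · exact h.not_adj hyz'
  · exact h.not_adj hyz'.symm
  · exact hyz rfl

theorem mem_triangles_map_collapse (hcard : ∀ s ∈ K.faces, s.card ≤ 3) (hab : a ≠ b)
    {t' : Finset V} : t' ∈ triangles (K.map (collapse a b)) ↔
      ∃ t ∈ triangles K, ¬ (a ∈ t ∧ b ∈ t) ∧ t.image (collapse a b) = t' := by
  constructor
  · rintro ⟨⟨s, hs, rfl⟩, h⟩
    have h1 := hcard s hs
    have h2 : (s.image (collapse a b)).card ≤ s.card := Finset.card_image_le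
    have h : (s.image (collapse a b)).card = 3 := h
    refine ⟨s, ⟨hs, by omega⟩, fun h3 => ?_, rfl⟩
    have := not_injOn_collapse hab h3
    omega
  · rintro ⟨s, hs, h, rfl⟩
    exact ⟨⟨s, hs.1, rfl⟩, by rw [Finset.card_image_of_injOn (injOn_collapse h), hs.2]⟩

theorem exists_adj_of_adj_map {V' : Type*} {φ : V → V'} {x y : V'} (h : (graph (K.map φ)).Adj x y) :
    ∃ u v, (graph K).Adj u v ∧ φ u = x ∧ φ v = y := by
  obtain ⟨hne, s, hs, he⟩ := h
  have he : s.image φ = {x, y} := he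
  have hx : x ∈ s.image φ := he ▸ (by simp)
  have hy : y ∈ s.image φ := he ▸ (by simp)
  obtain ⟨u, hu, rfl⟩ := Finset.mem_image.1 hx
  obtain ⟨v, hv, rfl⟩ := Finset.mem_image.1 hy
  exact ⟨u, v, adj_of_face hs hu hv fun e => hne (e ▸ rfl), rfl, rfl⟩

theorem adj_map {V' : Type*} {φ : V → V'} {x y : V} (h : (graph K).Adj x y) (hne : φ x ≠ φ y) :
    (graph (K.map φ)).Adj (φ x) (φ y) :=
  ⟨hne, _, h.2, by simp [Finset.image_insert]⟩

theorem IsContractible.triF_eq (h : IsContractible K a b c d) (hfin : K.faces.Finite)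
    (hcard : ∀ s ∈ K.faces, s.card ≤ 3) : triF (K.map (collapse a b)) =
      ((triF K).filter fun t => ¬ (a ∈ t ∧ b ∈ t)).image fun t => t.image (collapse a b) := by
  have hfin' : (K.map (collapse a b)).faces.Finite := hfin.image _
  ext t'
  rw [mem_triF hfin', mem_triangles_map_collapse hcard (ne_of_triangle h.left).1]
  simp only [Finset.mem_image, Finset.mem_filter, mem_triF hfin, and_assoc]

theorem IsContractible.edgeSum_map (h : IsContractible K a b c d) (hfin : K.faces.Finite)
    (hcard : ∀ s ∈ K.faces, s.card ≤ 3) {R : Type*} [AddCommMonoid R] (f : Finset V → R) (x y : V) :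
    edgeSum (K.map (collapse a b)) f x y = ∑ t ∈ triF K, if ¬ (a ∈ t ∧ b ∈ t) then
      if x ∈ t.image (collapse a b) ∧ y ∈ t.image (collapse a b) then
        f (t.image (collapse a b)) else 0 else 0 := by
  unfold edgeSum
  rw [Finset.sum_filter, h.triF_eq hfin hcard]
  refine (Finset.sum_image ?_).trans (Finset.sum_filter _ _)
  intro s hs t ht e
  simp only [Finset.coe_filter, mem_triF hfin, Set.mem_ofPred_eq] at hs ht
  exact h.image_injOn hs.1 ht.1 hs.2 ht.2 e

theorem IsContractible.edgeSum_map_of_ne (h : IsContractible K a b c d) (hfin : K.faces.Finite)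
    (hcard : ∀ s ∈ K.faces, s.card ≤ 3) {R : Type*} [AddCommMonoid R] (f : Finset V → R) {x y : V}
    (hxa : x ≠ a) (hxb : x ≠ b) (hya : y ≠ a) (hyb : y ≠ b) :
    edgeSum (K.map (collapse a b)) f x y =
      edgeSum K (fun t => if a ∈ t ∧ b ∈ t then 0 else f (t.image (collapse a b))) x y := by
  rw [h.edgeSum_map hfin hcard]
  unfold edgeSum
  rw [Finset.sum_filter]
  refine Finset.sum_congr rfl fun t _ => ?_
  simp only [mem_image_collapse hxa, mem_image_collapse hya, hxb, hyb, ne_eq, not_false_eq_true,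
    and_true]
  by_cases h1 : a ∈ t ∧ b ∈ t <;> simp [h1]

/-- The edges `ay` and `by` are identified, so the new edge inherits the triangles of both, except
for the collapsed `abc` and `abd`. -/
theorem IsContractible.edgeSum_map_left (h : IsContractible K a b c d) (hfin : K.faces.Finite)
    (hcard : ∀ s ∈ K.faces, s.card ≤ 3) {R : Type*} [AddCommMonoid R] (f : Finset V → R) {y : V}
    (hya : y ≠ a) (hyb : y ≠ b) :
    edgeSum (K.map (collapse a b)) f a y =
      edgeSum K (fun t => if a ∈ t ∧ b ∈ t then 0 else f (t.image (collapse a b))) a y +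
      edgeSum K (fun t => if a ∈ t ∧ b ∈ t then 0 else f (t.image (collapse a b))) b y := by
  rw [h.edgeSum_map hfin hcard]
  unfold edgeSum
  rw [Finset.sum_filter, Finset.sum_filter, ← Finset.sum_add_distrib]
  refine Finset.sum_congr rfl fun t _ => ?_
  simp only [left_mem_image_collapse, mem_image_collapse hya, hyb, ne_eq, not_false_eq_true,
    and_true]
  by_cases h1 : a ∈ t <;> by_cases h2 : b ∈ t <;> simp [h1, h2]

theorem mem_edges_collapse_iff {e : Sym2 V} {x y : V} (hxa : x ≠ a) (hxb : x ≠ b) (hya : y ≠ a)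
    (hyb : y ≠ b) : Sym2.map (collapse a b) e = s(x, y) ↔ e = s(x, y) := by
  induction e with
  | _ u v =>
    simp only [Sym2.map_mk, Sym2.eq_iff, collapse_eq_iff_of_ne hxa, collapse_eq_iff_of_ne hya, hxb,
      hyb, ne_eq, not_false_eq_true, and_true]

theorem mem_edges_collapse_left_iff {e : Sym2 V} {y : V} (hya : y ≠ a)
    (hyb : y ≠ b) : Sym2.map (collapse a b) e = s(a, y) ↔ e = s(a, y) ∨ e = s(b, y) := by
  induction e with
  | _ u v =>
    simp only [Sym2.map_mk, Sym2.eq_iff, collapse_eq_iff_of_ne hya, collapse_eq_left,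
      hyb, ne_eq, not_false_eq_true, and_true]
    tauto

/-- The link condition guarantees that only `ac, bc` and `ad, bd` are identified as edges, and that
no two surviving triangles are identified. The edge `ab` is off the boundary walk, so the image of
the walk is again a walk. -/
theorem IsDisc.contract {p : V} {w : (graph K).Walk p p} (hD : IsDisc K w)
    (h : IsContractible K a b c d) (hw : s(a, b) ∉ w.edges) :
    (∃ w' : (graph (K.map (collapse a b))).Walk (collapse a b p) (collapse a b p),
      w'.support = w.support.map (collapse a b) ∧ IsDisc (K.map (collapse a b)) w') ∧
    (triangles (K.map (collapse a b))).ncard < (triangles K).ncard := by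
  have hfin := hD.finite
  have hcard := hD.card_le
  set K' := K.map (collapse a b) with hK'
  have hfin' : K'.faces.Finite := hfin.image _
  obtain ⟨hab, hac, hbc⟩ := ne_of_triangle h.left
  obtain ⟨-, had, hbd⟩ := ne_of_triangle h.right
  have aab : (graph K).Adj a b := adj_of_face h.left.1 (by simp) (by simp) hab
  have hM := hD.mem_pair_iff h.left h.right h.ne
  have hcd := h.ne
  have h₁₂ := triangle_ne_of_apex_ne h.left h.ne
  have hsumM := fun {R : Type} [AddCommMonoid R] (f : Finset V → R) (x y : V) =>
    edgeSum_filter_eq hfin hM f x y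
  have hsplit : ∀ {R : Type} [AddCommMonoid R] (f : Finset V → R) (x y : V),
      edgeSum K f x y = edgeSum K (fun t => if a ∈ t ∧ b ∈ t then 0 else f t) x y +
        ((if x ∈ ({a, b, c} : Finset V) ∧ y ∈ ({a, b, c} : Finset V) then f {a, b, c} else 0) +
        (if x ∈ ({a, b, d} : Finset V) ∧ y ∈ ({a, b, d} : Finset V) then f {a, b, d} else 0)) := by
    intro R _ f x y
    rw [edgeSum_split (fun t => a ∈ t ∧ b ∈ t) f, hsumM f, Finset.sum_pair h₁₂]
  have hoff : ∀ {R : Type} [AddCommMonoid R] (f : Finset V → R) {x y : V}, x ≠ y → x ≠ a → x ≠ b →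
      y ≠ a → y ≠ b → edgeSum K f x y =
        edgeSum K (fun t => if a ∈ t ∧ b ∈ t then 0 else f t) x y := by
    intro R _ f x y hxy hxa hxb hya hyb
    rw [hsplit, if_neg, if_neg, add_zero, add_zero] <;>
    · simp only [Finset.mem_insert, Finset.mem_singleton, hxa, hxb, hya, hyb, false_or]
      rintro ⟨rfl, rfl⟩
      exact hxy rfl
  have hne : ∀ {x y : V}, (graph K').Adj x y → x ≠ b := by
    rintro x y hxy rfl
    obtain ⟨u, v, -, hu, -⟩ := exists_adj_of_adj_map hxy
    exact ((collapse_eq_iff_of_ne hab.symm).1 hu).2 rfl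
  have hadj_off : ∀ {x y : V}, (graph K').Adj x y → x ≠ a → y ≠ a → (graph K).Adj x y := by
    intro x y hxy hx hy
    obtain ⟨u, v, huv, hu, hv⟩ := exists_adj_of_adj_map hxy
    rwa [((collapse_eq_iff_of_ne hx).1 hu).1, ((collapse_eq_iff_of_ne hy).1 hv).1] at huv
  have hadj_left : ∀ {y : V}, (graph K').Adj a y → (graph K).Adj a y ∨ (graph K).Adj b y := by
    intro y hay
    obtain ⟨u, v, huv, hu, hv⟩ := exists_adj_of_adj_map hay
    rw [((collapse_eq_iff_of_ne hay.1.symm).1 hv).1] at huv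
    rcases collapse_eq_left.1 hu with rfl | rfl
    · exact .inl huv
    · exact .inr huv
  obtain ⟨w', hwe, hws⟩ := exists_walk_map (B := graph K') (collapse a b) w (by
    intro u v huv
    have huv' : (graph K).Adj u v := w.adj_of_mem_edges huv
    refine adj_map huv' fun e => ?_
    by_cases hv : collapse a b v = a
    · have h1 := collapse_eq_left.1 hv
      have h2 := collapse_eq_left.1 (e.trans hv)
      rcases h1 with rfl | rfl <;> rcases h2 with rfl | rfl
      · exact huv'.1 rfl
      · exact hw (by rwa [Sym2.eq_swap])
      · exact hw huv
      · exact huv'.1 rfl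
    · have h1 := (collapse_eq_iff_of_ne hv).1 e
      have h2 := (collapse_eq_iff_of_ne (b := b) hv).1 rfl
      exact huv'.1 (h1.1.trans h2.1.symm))
  have htot : ∀ x y, x ≠ y → ¬ (graph K).Adj x y →
      w.edges.count s(x, y) + edgeSum K (fun _ => 1) x y = 0 := by
    intro x y hne hxy
    rw [List.count_eq_zero.2 fun h => hxy (w.adj_of_mem_edges h), zero_add]
    exact edgeSum_eq_zero hfin fun t ht hx hy => absurd (adj_of_face ht.1 hx hy hne) hxy
  -- For `y = c` or `y = d` the two identified edges account for four sides, two of which were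
  -- occupied by the collapsed triangle. For any other `y` only one of `ay`, `by` is an edge.
  have hcount_left : ∀ y, (graph K').Adj a y →
      w'.edges.count s(a, y) + edgeSum K' (fun _ => 1) a y = 2 := by
    intro y hay
    have hya := hay.1.symm
    have hyb := hne hay.symm
    rw [hwe, count_map_eq_add (g := Sym2.map (collapse a b)) (u := s(a, y)) (v := s(b, y))
      (by simp [hab, hya.symm]) _ (fun e _ => mem_edges_collapse_left_iff hya hyb), h.edgeSum_map_left hfin hcard _ hya hyb]
    have e1 := hsplit (fun _ => 1) a y
    have e2 := hsplit (fun _ => 1) b y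
    simp only [Finset.mem_insert, Finset.mem_singleton, true_or, or_true, true_and, hya, hyb,
      false_or] at e1 e2
    by_cases h1 : (graph K).Adj a y
    · have c1 := hD.count h1
      by_cases h2 : (graph K).Adj b y
      · have c2 := hD.count h2
        rcases h.eq_or_eq y h1 h2 with rfl | rfl
        · simp only [if_true, hcd, if_false] at e1 e2
          omega
        · simp only [if_true, hcd.symm, if_false] at e1 e2
          omega
      · have c2 := htot b y hyb.symm h2
        omega
    · have c1 := htot a y hya.symm h1
      have c2 := hD.count ((hadj_left hay).resolve_left h1)
      have hyc : y ≠ c := by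
        rintro rfl
        exact h1 (adj_of_face h.left.1 (by simp) (by simp) hac)
      have hyd : y ≠ d := by
        rintro rfl
        exact h1 (adj_of_face h.right.1 (by simp) (by simp) had)
      simp only [hyc, hyd, if_false] at e1 e2
      omega
  refine ⟨⟨w', hws, hfin', ?_, ?_, ?_, ?_, ?_⟩, ?_⟩
  · rintro _ ⟨s, hs, rfl⟩
    exact Finset.card_image_le.trans (hcard s hs)
  · have hφ : ∀ s ∈ K.faces, s.image (collapse a b) ∈ K'.faces := fun s hs => ⟨s, hs, rfl⟩
    have hv : ∀ x ∈ vertices K', ∃ u ∈ vertices K, collapse a b u = x := by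
      rintro x ⟨s, hs, e⟩
      have hx : x ∈ s.image (collapse a b) := by
        rw [show s.image (collapse a b) = {x} from e]
        simp
      obtain ⟨u, hu, rfl⟩ := Finset.mem_image.1 hx
      exact ⟨u, mem_vertices_of_face hs hu, rfl⟩
    refine isSimplyConnected_of_exists_primitive ?_ ?_ ?_
    · obtain ⟨x, hx⟩ := hD.simplyConnected.nonempty
      exact ⟨collapse a b x, by simpa [vertices] using hφ _ hx⟩
    · intro x hx y hy
      obtain ⟨u, hu, rfl⟩ := hv x hx
      obtain ⟨v, hv, rfl⟩ := hv y hy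
      refine reachable_of_forall_adj (B := graph K') (fun x y hxy => ?_)
        (hD.simplyConnected.connected u hu v hv)
      by_cases e : collapse a b x = collapse a b y
      · rw [e]
      · exact (adj_map hxy e).reachable
    · intro H _ g hg
      obtain ⟨k, hk⟩ := hD.simplyConnected.exists_primitive (hg.pullback hφ)
      -- The pulled-back cocycle is trivial on the collapsed edge, so its primitive descends to the
      -- quotient.
      have hk' : ∀ x, k (collapse a b x) = k x := by
        intro x
        by_cases hx : x = a ∨ x = b
        · rcases hx with rfl | rfl
          · rw [collapse_left]
          · rw [collapse_right, hk a x aab, pullback, collapse_left, collapse_right, if_pos rfl,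
              mul_one]
        · rw [collapse_of_ne hx]
      refine ⟨k, fun x y hxy => ?_⟩
      obtain ⟨u, v, huv, rfl, rfl⟩ := exists_adj_of_adj_map hxy
      rw [hk', hk', hk u v huv, pullback, if_neg hxy.1]
  · intro f' hf'
    let S : V → V → ZMod 2 := fun x y =>
      edgeSum K (fun t => if a ∈ t ∧ b ∈ t then 0 else f' (t.image (collapse a b))) x y
    -- To lift a 2-cycle, the values on `abc` and `abd` are chosen so as to cancel the boundary on
    -- `ac` and `ad`. It then vanishes on `bc` and `bd` because it vanished on the identified edges,
    -- and on `ab` because a boundary has even degree at `a`.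
    let F : Finset V → ZMod 2 := fun t =>
      if t = {a, b, c} then S a c else if t = {a, b, d} then S a d else
        f' (t.image (collapse a b))
    have hFc : F {a, b, c} = S a c := if_pos rfl
    have hFd : F {a, b, d} = S a d := (if_neg h₁₂.symm).trans (if_pos rfl)
    have hFS : ∀ x y, edgeSum K (fun t => if a ∈ t ∧ b ∈ t then 0 else F t) x y = S x y := by
      intro x y
      refine edgeSum_congr hfin fun t _ _ _ => ?_
      by_cases h1 : a ∈ t ∧ b ∈ t
      · simp [h1]
      · have h2 : t ≠ {a, b, c} := by rintro rfl; simp at h1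
        have h3 : t ≠ {a, b, d} := by rintro rfl; simp at h1
        simp only [F, if_neg h1, if_neg h2, if_neg h3]
    have hS : ∀ y, (graph K').Adj a y → S a y + S b y = 0 := by
      intro y hay
      have h1 := hf' a y hay
      rwa [h.edgeSum_map_left hfin hcard _ hay.1.symm (hne hay.symm)] at h1
    have hadj_l : ∀ {y : V}, y ≠ a → y ≠ b → (graph K).Adj a y → (graph K').Adj a y := by
      intro y h1 h2 h3
      have h4 := adj_map (φ := collapse a b) h3
      rw [collapse_left, collapse_of_ne (not_or.2 ⟨h1, h2⟩)] at h4
      exact h4 h1.symm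
    have hadj_r : ∀ {y : V}, y ≠ a → y ≠ b → (graph K).Adj b y → (graph K').Adj a y := by
      intro y h1 h2 h3
      have h4 := adj_map (φ := collapse a b) h3
      rw [collapse_right, collapse_of_ne (not_or.2 ⟨h1, h2⟩)] at h4
      exact h4 h1.symm
    have hS0 : ∀ {x y : V}, x ≠ y → ¬ (graph K).Adj x y → S x y = 0 := fun hxy hn =>
      edgeSum_eq_zero hfin fun t ht hx hy => absurd (adj_of_face ht.1 hx hy hxy) hn
    have hSc := hS c (hadj_l hac.symm hbc.symm (adj_of_face h.left.1 (by simp) (by simp) hac))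
    have hSd := hS d (hadj_l had.symm hbd.symm (adj_of_face h.right.1 (by simp) (by simp) had))
    rw [CharTwo.add_eq_zero] at hSc hSd
    have hFa : ∀ y, (graph K).Adj a y → y ≠ b → edgeSum K F a y = 0 := by
      intro y hay hyb
      have hya := hay.1.symm
      rw [hsplit, hFS, hFc, hFd]
      simp only [Finset.mem_insert, Finset.mem_singleton, true_or, true_and, hya, hyb, false_or]
      by_cases hyc : y = c
      · subst hyc
        simp [hcd, CharTwo.add_self_eq_zero]
      by_cases hyd : y = d
      · subst hyd
        simp [hcd.symm, CharTwo.add_self_eq_zero]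
      have h1 := hS y (hadj_l hya hyb hay)
      rw [hS0 hyb.symm fun h' => (h.eq_or_eq y hay h').elim hyc hyd] at h1
      simpa [hyc, hyd] using h1
    have hFb : ∀ y, (graph K).Adj b y → y ≠ a → edgeSum K F b y = 0 := by
      intro y hby hya
      have hyb := hby.1.symm
      rw [hsplit, hFS, hFc, hFd]
      simp only [Finset.mem_insert, Finset.mem_singleton, true_or, or_true, true_and, hya, hyb,
        false_or]
      by_cases hyc : y = c
      · subst hyc
        simp [hcd, hSc, CharTwo.add_self_eq_zero]
      by_cases hyd : y = d
      · subst hyd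
        simp [hcd.symm, hSd, CharTwo.add_self_eq_zero]
      have h1 := hS y (hadj_r hya hyb hby)
      rw [hS0 hya.symm fun h' => (h.eq_or_eq y h' hby).elim hyc hyd] at h1
      simpa [hyc, hyd] using h1
    have hFab : edgeSum K F a b = 0 := edgeSum_eq_zero_of_forall hfin hab hFa
    have hF := hD.noCycle F (by
      intro x y hxy
      by_cases hxa : x = a
      · subst hxa
        by_cases hyb : y = b
        · rw [hyb, hFab]
        · exact hFa y hxy hyb
      by_cases hxb : x = b
      · subst hxb
        by_cases hya : y = a
        · rw [hya, edgeSum_comm, hFab]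
        · exact hFb y hxy hya
      by_cases hya : y = a
      · subst hya
        rw [edgeSum_comm]
        exact hFa x hxy.symm hxb
      by_cases hyb : y = b
      · subst hyb
        rw [edgeSum_comm]
        exact hFb x hxy.symm hxa
      have h1 := adj_map (φ := collapse a b) hxy
      rw [collapse_of_ne (not_or.2 ⟨hxa, hxb⟩), collapse_of_ne (not_or.2 ⟨hya, hyb⟩)] at h1
      have h2 := hf' x y (h1 hxy.1)
      rw [h.edgeSum_map_of_ne hfin hcard _ hxa hxb hya hyb] at h2
      rw [hoff F hxy.1 hxa hxb hya hyb, hFS]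
      exact h2)
    intro t' ht'
    obtain ⟨t, ht, htn, rfl⟩ := (mem_triangles_map_collapse hcard hab).1 ht'
    have h1 := hF t ht
    have h2 : t ≠ {a, b, c} := by rintro rfl; simp at htn
    have h3 : t ≠ {a, b, d} := by rintro rfl; simp at htn
    simpa only [F, if_neg h2, if_neg h3] using h1
  · have h1 := hD.boundary.1
    exact ⟨_, h1, by simp⟩
  · intro x y hxy
    rw [ncard_edge hfin']
    by_cases hxa : x = a
    · subst hxa
      exact hcount_left y hxy
    by_cases hya : y = a
    · subst hya
      rw [Sym2.eq_swap, edgeSum_comm]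
      exact hcount_left x hxy.symm
    have hxb := hne hxy
    have hyb := hne hxy.symm
    rw [hwe, count_map_eq (g := Sym2.map (collapse a b)) _ fun e _ =>
      mem_edges_collapse_iff hxa hxb hya hyb,
      h.edgeSum_map_of_ne hfin hcard _ hxa hxb hya hyb]
    have h1 := hD.count (hadj_off hxy hxa hya)
    rwa [hoff _ hxy.1 hxa hxb hya hyb] at h1
  · rw [ncard_triangles hfin, ncard_triangles hfin', h.triF_eq hfin hcard]
    refine Finset.card_image_le.trans_lt (Finset.card_lt_card ?_)
    refine Finset.filter_ssubset.2 ⟨_, (mem_triF hfin).2 h.left, ?_⟩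
    simp

/-- Off the boundary walk, `ab` lies in two triangles. Without empty triangles every common
neighbour of `a` and `b` spans a triangle with them, hence is one of the two apices. -/
theorem IsDisc.exists_isContractible {p : V} {w : (graph K).Walk p p} (hD : IsDisc K w)
    (hE : ¬ HasEmptyTriangle K) (hab : (graph K).Adj a b) (hw : s(a, b) ∉ w.edges) :
    ∃ c d, IsContractible K a b c d := by
  have h1 := hD.count hab
  rw [List.count_eq_zero.2 hw, zero_add, edgeSum, Finset.sum_const, smul_eq_mul, mul_one] at h1
  obtain ⟨s, t, hst, e⟩ := Finset.card_eq_two.1 h1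
  have hs : s ∈ triangles K ∧ a ∈ s ∧ b ∈ s := by
    rw [← mem_triF hD.finite]
    exact Finset.mem_filter.1 (e.symm ▸ Finset.mem_insert_self s _)
  have ht : t ∈ triangles K ∧ a ∈ t ∧ b ∈ t := by
    rw [← mem_triF hD.finite]
    exact Finset.mem_filter.1 (e.symm ▸ Finset.mem_insert_of_mem (Finset.mem_singleton_self t))
  obtain ⟨c, -, -, rfl⟩ := exists_triangle_eq' hs.1 hs.2.1 hs.2.2 hab.1
  obtain ⟨d, -, -, rfl⟩ := exists_triangle_eq' ht.1 ht.2.1 ht.2.2 hab.1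
  have hcd : c ≠ d := by
    rintro rfl
    exact hst rfl
  refine ⟨c, d, hs.1, ht.1, hcd, not_adj_apex hD.finite hD.noCycle hE hs.1 ht.1 hcd,
    fun x hax hbx => ?_⟩
  have h2 := (hD.mem_pair_iff hs.1 ht.1 hcd {a, b, x}).2
    ⟨face_of_not_hasEmptyTriangle hE hab hbx hax, by simp, by simp⟩
  have hx : x ∈ ({a, b, x} : Finset V) := by simp
  simp only [Finset.mem_insert, Finset.mem_singleton] at h2
  rcases h2 with h2 | h2 <;> rw [h2] at hx <;>
    simp only [Finset.mem_insert, Finset.mem_singleton, hax.1.symm, hbx.1.symm, false_or] at hx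
  · exact .inl hx
  · exact .inr hx

end Contraction

/-! ### Short cycles in links -/

section Ears

variable {W : Type w} (X : MetricComplex W)

theorem MetricComplex.angle_nonneg (a x y : W) : 0 ≤ X.angle a x y := Real.arccos_nonneg _

theorem MetricComplex.angle_comm (a x y : W) : X.angle a x y = X.angle a y x := by
  unfold MetricComplex.angle euclideanAngle
  rw [Sym2.eq_swap (a := x) (b := y)]
  congr 1
  ring

variable {X}

theorem MetricComplex.angle_triangle {a x y z : W} (hx : (graph X.complex).Adj a x)
    (hy : (graph X.complex).Adj a y) (hz : (graph X.complex).Adj a z)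
    (hxy : (graph X.complex).Adj x y) (hyz : (graph X.complex).Adj y z)
    (hxz : (graph X.complex).Adj x z) : X.angle a x z ≤ X.angle a x y + X.angle a y z :=
  X.angle_le a x y z hx hy hz hxy hyz hxz

/-- A short simple cycle in a link, based at an edge, has a diagonal cutting off a vertex that is
not an end point of that edge. -/
theorem MetricComplex.IsLinkLarge.exists_ear {a : W} (ha : X.IsLinkLarge a) {n : ℕ} (hn : 3 ≤ n)
    (x : ℕ → W) (hinj : ∀ i < n, ∀ j < n, x i = x j → i = j)
    (hax : ∀ i < n, (graph X.complex).Adj a (x i))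
    (hx : ∀ i, i + 1 < n → (graph X.complex).Adj (x i) (x (i + 1)))
    (hclose : (graph X.complex).Adj (x (n - 1)) (x 0))
    (hsum : ∑ i ∈ Finset.range (n - 1), X.angle a (x i) (x (i + 1)) + X.angle a (x (n - 1)) (x 0) <
      2 * Real.pi) :
    ∃ m, m + 2 < n ∧ (graph X.complex).Adj (x m) (x (m + 2)) := by
  induction n, hn using Nat.le_induction generalizing x with
  -- In a 3-cycle the base edge itself joins the two neighbours of the middle vertex.
  | base => exact ⟨0, by omega, hclose.symm⟩
  | succ n hn ih =>
    simp only [Nat.add_sub_cancel] at hclose hsum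
    have hrot : ∀ i : Fin (n + 1), x (finRotate (n + 1) i : ℕ) =
        if (i : ℕ) + 1 < n + 1 then x (i + 1) else x 0 := by
      intro i
      rw [finRotate_apply]
      split_ifs with h
      · rw [Fin.val_add_one_of_lt' h]
      · have : i = Fin.last n := Fin.ext (by have := i.2; simp only [Fin.val_last]; omega)
        subst this
        simp
    obtain ⟨i, hi⟩ : ∃ i : Fin (n + 1), (graph X.complex).Adj (x i)
        (x (finRotate (n + 1) (finRotate (n + 1) i) : ℕ)) := by
      by_contra hcon
      push Not at hcon
      have h1 := ha (n + 1) (fun i => x i) (by omega)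
        (fun i j e => Fin.ext (hinj i i.2 j j.2 e)) (fun i => hax i i.2) (fun i => ?_) hcon
      · rw [Fin.sum_univ_castSucc] at h1
        simp only [hrot, Fin.val_castSucc, Fin.val_last, lt_irrefl, if_false, add_lt_add_iff_right,
          Fin.is_lt, if_true] at h1
        rw [Finset.sum_range] at hsum
        exact absurd hsum (not_lt.2 h1)
      · rw [hrot]
        split_ifs with h
        · exact hx i h
        · have : (i : ℕ) = n := by have := i.2; omega
          rwa [this]
    have hi2 := i.2
    rcases lt_trichotomy ((i : ℕ) + 1) n with h | h | h
    -- The diagonal found cuts off a vertex that is not an end of the base edge.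
    · refine ⟨i, by omega, ?_⟩
      have e : (finRotate (n + 1) i : ℕ) = i + 1 := by
        rw [finRotate_apply, Fin.val_add_one_of_lt' (by omega)]
      rw [hrot, e, if_pos (by omega)] at hi
      exact hi
    -- The diagonal cuts off the last vertex. It becomes the base edge of the shorter cycle, whose
    -- length has not grown by the angle inequality.
    · have e : (finRotate (n + 1) i : ℕ) = i + 1 := by
        rw [finRotate_apply, Fin.val_add_one_of_lt' (by omega)]
      rw [hrot, e, if_neg (by omega)] at hi
      have e' : (i : ℕ) = n - 1 := by omega
      rw [e'] at hi
      obtain ⟨n, rfl⟩ : ∃ l, n = l + 1 := ⟨n - 1, by omega⟩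
      simp only [Nat.add_sub_cancel] at hi ih
      rw [Finset.sum_range_succ] at hsum
      have h1 := MetricComplex.angle_triangle (hax n (by omega)) (hax (n + 1) (by omega))
        (hax 0 (by omega)) (hx n (by omega)) hclose hi
      obtain ⟨m, hm, hm'⟩ := ih x (fun i hi j hj => hinj i (by omega) j (by omega))
        (fun i hi => hax i (by omega)) (fun i hi => hx i (by omega)) hi (by linarith)
      exact ⟨m, by omega, hm'⟩
    -- The diagonal cuts off the first vertex; the shorter cycle starts at `x 1`.
    · have e' : (i : ℕ) = n := by omega
      have e : (finRotate (n + 1) i : ℕ) = 0 := by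
        have : i = Fin.last n := Fin.ext e'
        rw [finRotate_apply, this]
        simp
      rw [hrot, e, if_pos (by omega), e'] at hi
      obtain ⟨n, rfl⟩ : ∃ l, n = l + 1 := ⟨n - 1, by omega⟩
      simp only [Nat.add_sub_cancel] at ih
      rw [Finset.sum_range_succ'] at hsum
      have h1 := MetricComplex.angle_triangle (hax (n + 1) (by omega)) (hax 0 (by omega))
        (hax 1 (by omega)) hclose (hx 0 (by omega)) hi
      obtain ⟨m, hm, hm'⟩ := ih (fun i => x (i + 1))
        (fun i hi j hj e => Nat.succ_injective (hinj _ (by omega) _ (by omega) e))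
        (fun i hi => hax _ (by omega)) (fun i hi => hx _ (by omega)) hi (by
          simp only [zero_add] at hsum h1 ⊢
          linarith)
      exact ⟨m + 1, by omega, hm'⟩

theorem sum_range_add_of_periodic {g : ℕ → ℝ} {k : ℕ} (hg : ∀ j, g (j + k) = g j) (i : ℕ) :
    ∑ j ∈ Finset.range k, g (i + j) = ∑ j ∈ Finset.range k, g j := by
  induction i with
  | zero => simp
  | succ i ih =>
    rw [← ih]
    have h1 := Finset.sum_range_succ (fun j => g (i + j)) k
    have h2 := Finset.sum_range_succ' (fun j => g (i + j)) k
    rw [h1, hg] at h2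
    simp only [add_zero, ← add_assoc] at h2
    have h3 := add_right_cancel h2
    rw [h3]
    refine Finset.sum_congr rfl fun j _ => ?_
    congr 1
    omega

/-- A short closed path without backtracking in a link has two vertices at distance two along it
that are adjacent. -/
theorem MetricComplex.IsLinkLarge.exists_adj_finRotate {a : W} (ha : X.IsLinkLarge a) {k : ℕ}
    (hk : 0 < k) (c : Fin k → W) (hac : ∀ i, (graph X.complex).Adj a (c i))
    (hc : ∀ i, (graph X.complex).Adj (c i) (c (finRotate k i)))
    (hc' : ∀ i, c i ≠ c (finRotate k (finRotate k i)))
    (hsum : ∑ i, X.angle a (c i) (c (finRotate k i)) < 2 * Real.pi) :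
    ∃ i, (graph X.complex).Adj (c i) (c (finRotate k (finRotate k i))) := by
  let v : ℕ → Fin k := fun j => ⟨j % k, Nat.mod_lt j hk⟩
  have hv : ∀ j, finRotate k (v j) = v (j + 1) := by
    intro j
    obtain ⟨k, rfl⟩ : ∃ l, k = l + 1 := ⟨k - 1, by omega⟩
    rw [finRotate_apply]
    ext
    simp [v, Fin.val_add]
  have hvk : ∀ j, v (j + k) = v j := fun j => Fin.ext (Nat.add_mod_right j k)
  have hvi : ∀ i : Fin k, v i = i := fun i => Fin.ext (Nat.mod_eq_of_lt i.2)
  let x : ℕ → W := fun j => c (v j)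
  have hx1 : ∀ j, (graph X.complex).Adj (x j) (x (j + 1)) := by
    intro j
    have := hc (v j)
    rwa [hv] at this
  have hx2 : ∀ j, x j ≠ x (j + 2) := by
    intro j
    have := hc' (v j)
    rwa [hv, hv] at this
  -- The image path may meet itself. A shortest return gives a simple cycle, of length at least
  -- three since there is no backtracking, and its angular length is at most that of one turn.
  have hex : ∃ l, 0 < l ∧ ∃ i, x i = x (i + l) := ⟨k, hk, 0, by simp only [x, hvk]⟩
  obtain ⟨hl0, i, hi⟩ := Nat.find_spec hex
  set l := Nat.find hex with hl
  have hlk : l ≤ k := Nat.find_min' hex ⟨hk, 0, by simp only [x, hvk]⟩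
  have hl3 : 3 ≤ l := by
    by_contra hlt
    have : l = 1 ∨ l = 2 := by omega
    rcases this with e | e
    · rw [e] at hi
      exact (hx1 i).1 hi
    · rw [e] at hi
      exact hx2 i hi
  have hinj : ∀ s t, s < t → t < l → x (i + s) ≠ x (i + t) := by
    intro s t hst htl e
    refine Nat.find_min hex (m := t - s) (by omega) ⟨by omega, i + s, ?_⟩
    rw [e]
    congr 1
    omega
  let g : ℕ → ℝ := fun j => X.angle a (x j) (x (j + 1))
  have hg : ∀ j, g (j + k) = g j := by
    intro j
    simp only [g, x]
    rw [show j + k + 1 = j + 1 + k by omega, hvk, hvk]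
  have hgsum : ∑ j ∈ Finset.range l, g (i + j) < 2 * Real.pi := by
    refine lt_of_le_of_lt ?_ hsum
    have h1 : ∑ j ∈ Finset.range k, g (i + j) = ∑ i, X.angle a (c i) (c (finRotate k i)) := by
      rw [sum_range_add_of_periodic hg, Finset.sum_range]
      refine Finset.sum_congr rfl fun i _ => ?_
      simp only [g, x, ← hv, hvi]
    rw [← h1]
    exact Finset.sum_le_sum_of_subset_of_nonneg (Finset.range_subset_range.2 hlk)
      fun _ _ _ => X.angle_nonneg _ _ _
  have hlast : x (i + (l - 1) + 1) = x i := by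
    rw [hi]
    congr 1
    omega
  -- At the point where the subcycle closes up, its consecutive vertices need not be consecutive on
  -- the path. The ear avoids this point, so it comes from three consecutive vertices of the path.
  obtain ⟨m, -, hm⟩ := ha.exists_ear hl3 (fun j => x (i + j)) (by
      intro s hs t ht e
      rcases lt_trichotomy s t with h | h | h
      · exact absurd e (hinj s t h ht)
      · exact h
      · exact absurd e.symm (hinj t s h hs))
    (fun j _ => hac _) (fun j _ => hx1 _) (by
      have := hx1 (i + (l - 1))
      rwa [hlast] at this) (by
      obtain ⟨l', e⟩ : ∃ l', l = l' + 1 := ⟨l - 1, by omega⟩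
      rw [e, Finset.sum_range_succ] at hgsum
      rw [e] at hlast ⊢
      simp only [Nat.add_sub_cancel, add_zero] at hlast ⊢
      simp only [g, hlast] at hgsum
      exact hgsum)
  refine ⟨v (i + m), ?_⟩
  rw [hv, hv]
  exact hm

end Ears

/-! ### Moves of diagrams -/

section Moves

variable {V : Type u} {W : Type w} {X : PreAbstractSimplicialComplex W} {q : W}
  {C : (graph X).Walk q q} {K : PreAbstractSimplicialComplex V} {f : V → W}

theorem isDiscDiagram_of_isDisc {p : V} {w : (graph K).Walk p p} (hD : IsDisc K w)
    (h3 : 3 ≤ w.length) (hf : ∀ s ∈ K.faces, s.image f ∈ X.faces)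
    (hw : w.support.map f = C.support) : Diagram.IsDiscDiagram ⟨K, f⟩ X C :=
  ⟨hD.isSingularDisc h3, hf, p, w, hD.boundary, hw⟩

theorem length_eq_of_support_map {V' : Type*} {A : SimpleGraph V} {B : SimpleGraph V'} {x y : V}
    {x' y' : V'} {w : A.Walk x y} {w' : B.Walk x' y'} {φ : V → V'}
    (h : w'.support = w.support.map φ) : w'.length = w.length := by
  have := congrArg List.length h
  rw [List.length_map, SimpleGraph.Walk.length_support, SimpleGraph.Walk.length_support] at this
  omega

theorem of_isChain_support {R : V → V → Prop} (hR : ∀ x y, R x y → R y x) {A : SimpleGraph V}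
    {x y : V} (w : A.Walk x y) (h : w.support.IsChain R) {u v : V} (huv : s(u, v) ∈ w.edges) :
    R u v := by
  induction w with
  | nil => simp at huv
  | @cons x z y hxz w ih =>
    rw [SimpleGraph.Walk.support_cons, ← SimpleGraph.Walk.cons_tail_support,
      List.isChain_cons_cons, SimpleGraph.Walk.cons_tail_support] at h
    rw [SimpleGraph.Walk.edges_cons, List.mem_cons, Sym2.eq_iff] at huv
    rcases huv with (⟨rfl, rfl⟩ | ⟨rfl, rfl⟩) | huv
    · exact h.1
    · exact hR _ _ h.1
    · exact ih h.2 huv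

/-- Successive vertices of the boundary walk are mapped to successive vertices of `C`, which are
adjacent and therefore distinct. -/
theorem notMem_edges_of_map_eq {p : V} {w : (graph K).Walk p p} (hw : w.support.map f = C.support)
    {x y : V} (hxy : f x = f y) : s(x, y) ∉ w.edges := by
  intro h
  have h1 : (w.support.map f).IsChain (graph X).Adj := hw ▸ C.isChain_adj_support
  rw [List.isChain_map] at h1
  exact (of_isChain_support (fun _ _ h => h.symm) w h1 h).ne hxy

variable (C f) in
/-- A move between singular disc diagrams for `C` that agree on the vertices. -/
def MoveStep (K K' : PreAbstractSimplicialComplex V) : Prop :=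
  Diagram.Move X ⟨K, f⟩ ⟨K', f⟩ ∧ Diagram.IsDiscDiagram ⟨K', f⟩ X C ∧ vertices K' ⊆ vertices K

theorem vertices_subset_of_reflTransGen {K' : PreAbstractSimplicialComplex V}
    (h : Relation.ReflTransGen (MoveStep C f) K K') : vertices K' ⊆ vertices K := by
  induction h with
  | refl => exact subset_rfl
  | tail _ h ih => exact h.2.2.trans ih

variable (C f) in
/-- `K'` is obtained from `K` by moves, with fewer triangles. -/
def Improves (K K' : PreAbstractSimplicialComplex V) : Prop :=
  Relation.ReflTransGen (MoveStep C f) K K' ∧ Diagram.IsDiscDiagram ⟨K', f⟩ X C ∧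
    (triangles K').ncard < (triangles K).ncard

theorem MoveStep.improves {K' : PreAbstractSimplicialComplex V} (h : MoveStep C f K K')
    (hlt : (triangles K').ncard < (triangles K).ncard) : Improves C f K K' :=
  ⟨.single h, h.2.1, hlt⟩

theorem MoveStep.improves_trans {K' K'' : PreAbstractSimplicialComplex V} (h : MoveStep C f K K')
    (heq : (triangles K').ncard = (triangles K).ncard) (h' : Improves C f K' K'') :
    Improves C f K K'' :=
  ⟨h'.1.head h, h'.2.1, heq ▸ h'.2.2⟩

theorem exists_improves_of_hasEmptyTriangle (hX : IsFlag X)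
    (hG : Diagram.IsDiscDiagram ⟨K, f⟩ X C) (hE : HasEmptyTriangle K) :
    ∃ K', Improves C f K K' := by
  obtain ⟨a, b, c, hab, hbc, hac, habc⟩ := hE
  obtain ⟨p, w, hw, hs⟩ := hG.boundary
  have hD : IsDisc K w := hG.singularDisc.isDisc hw
  obtain ⟨⟨w', -, hs', hD'⟩, hlt⟩ := hD.aMove hG.singularDisc.starRigid hab hbc hac habc
  have hne : (triangles K).Nonempty := by
    by_contra h
    rw [Set.not_nonempty_iff_eq_empty.1 h, Set.ncard_empty] at hlt
    exact absurd hlt (Nat.not_lt_zero _)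
  have h3 := three_le_length hD.finite hD.noCycle hw hne
  have hlen : w'.length = w.length := length_eq_of_support_map (φ := id) (by rw [hs', List.map_id])
  have hpair : ∀ x ∈ ({a, b, c} : Finset V), ∀ y ∈ ({a, b, c} : Finset V),
      ({f x, f y} : Finset W) ∈ X.faces := by
    have key : ∀ {x y : V}, (graph K).Adj x y → ({f x, f y} : Finset W) ∈ X.faces := by
      intro x y h
      simpa [Finset.image_insert] using hG.simplicial _ h.2
    have key' : ∀ {x y : V}, (graph K).Adj x y → ({f x, f x} : Finset W) ∈ X.faces := by
      intro x y h
      simpa using hG.simplicial _ (mem_vertices_of_adj h)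
    intro x hx y hy
    simp only [Finset.mem_insert, Finset.mem_singleton] at hx hy
    rcases hx with rfl | rfl | rfl <;> rcases hy with rfl | rfl | rfl
    · exact key' hab
    · exact key hab
    · exact key hac
    · exact key hab.symm
    · exact key' hbc
    · exact key hbc
    · exact key hac.symm
    · exact key hbc.symm
    · exact key' hac.symm
  refine ⟨aMoveComplex K hab hbc hac, MoveStep.improves ⟨?_, isDiscDiagram_of_isDisc hD' ?_ ?_ ?_,
    ?_⟩ hlt⟩
  · exact .inl ⟨a, b, c, hab, hbc, hac, habc, rfl, fun _ _ => rfl⟩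
  · rw [hlen]
    exact h3
  · rintro s (⟨hs, -⟩ | rfl)
    · exact hG.simplicial s hs
    · refine hX _ ⟨f a, by simp⟩ ?_
      intro x hx y hy
      obtain ⟨u, hu, rfl⟩ := Finset.mem_image.1 hx
      obtain ⟨v, hv, rfl⟩ := Finset.mem_image.1 hy
      exact hpair u hu v hv
  · rw [hs']
    exact hs
  · rintro x (⟨hx, -⟩ | hx)
    · exact hx
    · have : x ∈ ({a, b, c} : Finset V) := (show ({x} : Finset V) = {a, b, c} from hx) ▸ (by simp)
      simp only [Finset.mem_insert, Finset.mem_singleton] at this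
      rcases this with rfl | rfl | rfl
      · exact mem_vertices_of_adj hab
      · exact mem_vertices_of_adj hbc
      · exact mem_vertices_of_adj hac.symm

theorem exists_improves_of_adj (hG : Diagram.IsDiscDiagram ⟨K, f⟩ X C) (hE : ¬ HasEmptyTriangle K)
    {a b : V} (hab : (graph K).Adj a b) (hf : f a = f b) : ∃ K', Improves C f K K' := by
  obtain ⟨p, w, hw, hs⟩ := hG.boundary
  have hD : IsDisc K w := hG.singularDisc.isDisc hw
  have hnw := notMem_edges_of_map_eq hs hf
  obtain ⟨c, d, h⟩ := hD.exists_isContractible hE hab hnw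
  obtain ⟨⟨w', hs', hD'⟩, hlt⟩ := hD.contract h hnw
  have h3 := three_le_length hD.finite hD.noCycle hw ⟨_, h.left⟩
  have hlen : w'.length = w.length := length_eq_of_support_map hs'
  have hfφ : f ∘ collapse a b = f := by
    funext x
    by_cases hx : x = a ∨ x = b
    · rcases hx with rfl | rfl
      · rw [Function.comp_apply, collapse_left]
      · rw [Function.comp_apply, collapse_right, hf]
    · rw [Function.comp_apply, collapse_of_ne hx]
  refine ⟨K.map (collapse a b), MoveStep.improves ⟨?_, isDiscDiagram_of_isDisc hD' ?_ ?_ ?_, ?_⟩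
    hlt⟩
  -- The collapsed vertex keeps the name `a`, so the same map `f` serves the new diagram.
  · exact .inr (.inr (.inl ⟨a, b, hE, hab, hf, a, .inl rfl, rfl, rfl, fun _ _ _ => rfl⟩))
  · rw [hlen]
    exact h3
  · rintro _ ⟨s, hs, rfl⟩
    rw [Finset.image_image, hfφ]
    exact hG.simplicial s hs
  · rw [hs', List.map_map, hfφ]
    exact hs
  · rintro x ⟨s, hs, e⟩
    have hx : x ∈ s.image (collapse a b) := by
      rw [show s.image (collapse a b) = {x} from e]
      simp
    obtain ⟨u, hu, rfl⟩ := Finset.mem_image.1 hx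
    by_cases hu' : u = a ∨ u = b
    · rw [collapse_eq_left.2 hu']
      exact mem_vertices_of_adj hab
    · rw [collapse_of_ne hu']
      exact mem_vertices_of_face hs hu

/-- The images of the new triangles have pairwise adjacent or equal vertices, so they are simplices
because `X` is flag. The condition on `f c` and `f d` covers both the B-move (equal) and the D-move
(adjacent). -/
theorem isDiscDiagram_flip (hX : IsFlag X) (hG : Diagram.IsDiscDiagram ⟨K, f⟩ X C) {a b c d : V}
    (h₁ : ({a, b, c} : Finset V) ∈ triangles K) (h₂ : ({a, b, d} : Finset V) ∈ triangles K)
    (hcd : c ≠ d) (hncd : ¬ (graph K).Adj c d) (hf : ({f c, f d} : Finset W) ∈ X.faces) :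
    Diagram.IsDiscDiagram ⟨flipComplex K h₁ h₂, f⟩ X C := by
  obtain ⟨p, w, hw, hs⟩ := hG.boundary
  have hD : IsDisc K w := hG.singularDisc.isDisc hw
  obtain ⟨⟨w', -, hs', hD'⟩, -⟩ := hD.flip h₁ h₂ hcd hncd
  have h3 := three_le_length hD.finite hD.noCycle hw ⟨_, h₁⟩
  have hlen : w'.length = w.length := length_eq_of_support_map (φ := id) (by rw [hs', List.map_id])
  have hself : ∀ {x y : W}, ({x, y} : Finset W) ∈ X.faces → ({x, x} : Finset W) ∈ X.faces :=
    fun h => face_mono h (by simp) (by simp)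
  have key : ∀ z : V, ({f z, f c} : Finset W) ∈ X.faces → ({f z, f d} : Finset W) ∈ X.faces →
      ({z, c, d} : Finset V).image f ∈ X.faces := by
    intro z hc hd
    rw [Finset.image_insert, Finset.image_insert, Finset.image_singleton]
    refine hX _ ⟨f z, by simp⟩ ?_
    have hc' := Finset.pair_comm (f z) (f c) ▸ hc
    have hd' := Finset.pair_comm (f z) (f d) ▸ hd
    have hf' := Finset.pair_comm (f c) (f d) ▸ hf
    intro x hx y hy
    simp only [Finset.mem_insert, Finset.mem_singleton] at hx hy
    rcases hx with rfl | rfl | rfl <;> rcases hy with rfl | rfl | rfl <;>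
      first | assumption | exact hself hc | exact hself hf | exact hself hf'
  have hpair : ∀ {s : Finset V} {x y : V}, s ∈ triangles K → x ∈ s → y ∈ s → x ≠ y →
      ({f x, f y} : Finset W) ∈ X.faces := by
    intro s x y hs hx hy hxy
    simpa [Finset.image_insert] using hG.simplicial _ (adj_of_face hs.1 hx hy hxy).2
  obtain ⟨hab, hac, hbc⟩ := ne_of_triangle h₁
  obtain ⟨-, had, hbd⟩ := ne_of_triangle h₂
  refine isDiscDiagram_of_isDisc hD' (by rw [hlen]; exact h3) ?_ (by rw [hs']; exact hs)
  have ha := key a (hpair h₁ (by simp) (by simp) hac) (hpair h₂ (by simp) (by simp) had)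
  have hb := key b (hpair h₁ (by simp) (by simp) hbc) (hpair h₂ (by simp) (by simp) hbd)
  rintro s (⟨hs, -⟩ | rfl | rfl | rfl)
  · exact hG.simplicial s hs
  · simpa [Finset.image_insert] using hf
  · exact ha
  · exact hb

/-- The B-move keeps the area but creates the edge `cd`, which is mapped to a vertex. An A-move, if
an empty triangle has appeared, or else a C-move on `cd` then lowers the area. -/
theorem exists_improves_of_map_eq (hX : IsFlag X) (hG : Diagram.IsDiscDiagram ⟨K, f⟩ X C)
    (hE : ¬ HasEmptyTriangle K) {a b c d : V} (h₁ : ({a, b, c} : Finset V) ∈ triangles K)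
    (h₂ : ({a, b, d} : Finset V) ∈ triangles K) (hcd : c ≠ d) (hf : f c = f d) :
    ∃ K', Improves C f K K' := by
  obtain ⟨p, w, hw, hs⟩ := hG.boundary
  have hD : IsDisc K w := hG.singularDisc.isDisc hw
  have hncd := not_adj_apex hD.finite hD.noCycle hE h₁ h₂ hcd
  have hG' := isDiscDiagram_flip hX hG h₁ h₂ hcd hncd (by
    have := hG.simplicial _ (mem_vertices_of_face h₁.1 (x := c) (by simp))
    simpa [← hf] using this)
  have hstep : MoveStep C f K (flipComplex K h₁ h₂) :=
    ⟨.inr (.inl ⟨a, b, hE, c, d, hcd, h₁, h₂, hf, rfl, fun _ _ => rfl⟩), hG',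
      (vertices_flipComplex h₁ h₂).subset⟩
  have heq := (hD.flip h₁ h₂ hcd hncd).2.2
  by_cases hE' : HasEmptyTriangle (flipComplex K h₁ h₂)
  · obtain ⟨K', h⟩ := exists_improves_of_hasEmptyTriangle hX hG' hE'
    exact ⟨K', hstep.improves_trans heq h⟩
  · obtain ⟨K', h⟩ := exists_improves_of_adj hG' hE' (a := c) (b := d)
      ⟨hcd, .inr (.inl rfl)⟩ hf
    exact ⟨K', hstep.improves_trans heq h⟩

theorem exists_improves_of_not_isNondegenerate (hX : IsFlag X)
    (hG : Diagram.IsDiscDiagram ⟨K, f⟩ X C)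
    (hn : ¬ Diagram.IsNondegenerate ⟨K, f⟩) : ∃ K', Improves C f K K' := by
  by_cases hE : HasEmptyTriangle K
  · exact exists_improves_of_hasEmptyTriangle hX hG hE
  simp only [Diagram.IsNondegenerate, Set.InjOn, not_forall] at hn
  obtain ⟨s, hs, x, hx, y, hy, hf, hxy⟩ := hn
  exact exists_improves_of_adj hG hE (adj_of_face hs hx hy hxy) hf

theorem exists_improves_of_not_isReduced (hX : IsFlag X)
    (hG : Diagram.IsDiscDiagram ⟨K, f⟩ X C)
    (hr : ¬ Diagram.IsReduced ⟨K, f⟩) : ∃ K', Improves C f K K' := by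
  by_cases hE : HasEmptyTriangle K
  · exact exists_improves_of_hasEmptyTriangle hX hG hE
  by_cases hn : Diagram.IsNondegenerate ⟨K, f⟩
  swap
  · exact exists_improves_of_not_isNondegenerate hX hG hn
  simp only [Diagram.IsReduced, not_forall, not_not] at hr
  obtain ⟨s, hs, t, ht, hst, h2, he⟩ := hr
  change s.image f = t.image f at he
  obtain ⟨a, b, hab, e⟩ := Finset.card_eq_two.1 h2
  have ha : a ∈ s ∩ t := by simp [e]
  have hb : b ∈ s ∩ t := by simp [e]
  rw [Finset.mem_inter] at ha hb
  obtain ⟨c, hac, hbc, rfl⟩ := exists_triangle_eq' hs ha.1 hb.1 hab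
  obtain ⟨d, had, hbd, rfl⟩ := exists_triangle_eq' ht ha.2 hb.2 hab
  have hcd : c ≠ d := by
    rintro rfl
    exact hst rfl
  have hfc : f c ∈ ({a, b, d} : Finset V).image f := he ▸ Finset.mem_image_of_mem f (by simp)
  simp only [Finset.image_insert, Finset.image_singleton, Finset.mem_insert,
    Finset.mem_singleton] at hfc
  -- Nondegeneracy leaves only `f c = f d`.
  rcases hfc with h | h | h
  · exact absurd (hn _ hs.1 (by simp) (by simp) h) hac.symm
  · exact absurd (hn _ hs.1 (by simp) (by simp) h) hbc.symm
  · exact exists_improves_of_map_eq hX hG hE hs ht hcd h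

end Moves

/-! ### Angle sums -/

section AngleSum

variable {V : Type u} {W : Type w} (X : MetricComplex W) {K : PreAbstractSimplicialComplex V}
  (f : V → W)

/-- The angle at the vertex `a` of a triangle containing `a`, in the metric pulled back by `f`. -/
def angleAt (a : V) (t : Finset V) : ℝ :=
  -- Both orders of the remaining two vertices occur in the sum, hence the division by two.
  (∑ x ∈ t.erase a, ∑ y ∈ (t.erase a).erase x, X.angle (f a) (f x) (f y)) / 2

theorem angleAt_triangle {a x y : V} (hx : a ≠ x) (hy : a ≠ y) (hxy : x ≠ y) :
    angleAt X f a {a, x, y} = X.angle (f a) (f x) (f y) := by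
  have e1 : ({a, x, y} : Finset V).erase a = {x, y} :=
    Finset.erase_insert (by simp [hx, hy])
  have e2 : ({x, y} : Finset V).erase x = {y} := Finset.erase_insert (by simp [hxy])
  have e3 : ({x, y} : Finset V).erase y = {x} := by
    rw [Finset.pair_comm]
    exact Finset.erase_insert (by simp [hxy.symm])
  rw [angleAt, e1, Finset.sum_pair hxy, e2, e3, Finset.sum_singleton, Finset.sum_singleton,
    X.angle_comm (f a) (f y)]
  ring

theorem IsLinkCycle.edgeSum_self (hfin : K.faces.Finite) {a : V} {k : ℕ} {c : Fin k → V}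
    (h : IsLinkCycle K a c) {R : Type*} [AddCommMonoid R] (g : Finset V → R) :
    edgeSum K g a a = ∑ i, g {a, c i, c (finRotate k i)} := by
  have e : (triF K).filter (fun t => a ∈ t ∧ a ∈ t) =
      Finset.univ.image fun i => ({a, c i, c (finRotate k i)} : Finset V) := by
    ext t
    simp only [Finset.mem_filter, mem_triF hfin, and_self, Finset.mem_image, Finset.mem_univ,
      true_and]
    constructor
    · rintro ⟨ht, ha⟩
      obtain ⟨i, rfl⟩ := h.exists_eq ht ha
      exact ⟨i, rfl⟩
    · rintro ⟨i, rfl⟩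
      exact ⟨h.triangle_mem i, by simp⟩
  rw [edgeSum, e, Finset.sum_image fun i _ j _ hij => h.triangle_inj hij]

theorem IsLinkCycle.edgeSum_angleAt (hfin : K.faces.Finite) {a : V} {k : ℕ} {c : Fin k → V}
    (h : IsLinkCycle K a c) : edgeSum K (angleAt X f a) a a =
      ∑ i, X.angle (f a) (f (c i)) (f (c (finRotate k i))) := by
  rw [h.edgeSum_self hfin]
  refine Finset.sum_congr rfl fun i _ => ?_
  obtain ⟨h1, h2, h3⟩ := ne_of_triangle (h.triangle_mem i)
  exact angleAt_triangle X f h1 h2 h3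

/-- With both arguments equal to `a`, `edgeSum` runs over all triangles at `a`; the flip replaces
two of them by one. This is applied to the angle sum and to the number of triangles. -/
theorem edgeSum_flip_self {a b c d : V} {p : V} {w : (graph K).Walk p p} (hD : IsDisc K w)
    (h₁ : ({a, b, c} : Finset V) ∈ triangles K) (h₂ : ({a, b, d} : Finset V) ∈ triangles K)
    (hcd : c ≠ d) (hncd : ¬ (graph K).Adj c d) {R : Type*} [AddCommMonoid R] (g : Finset V → R) :
    ∃ r, edgeSum K g a a = r + (g {a, b, c} + g {a, b, d}) ∧
      edgeSum (flipComplex K h₁ h₂) g a a = r + g {a, c, d} := by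
  obtain ⟨hab, hac, hbc⟩ := ne_of_triangle h₁
  obtain ⟨-, had, hbd⟩ := ne_of_triangle h₂
  obtain ⟨⟨w', -, -, hD'⟩, htri, -⟩ := hD.flip h₁ h₂ hcd hncd
  have hnT : ∀ t, c ∈ t → d ∈ t → t ∉ triangles K := fun t hc hd ht =>
    hncd (adj_of_face ht.1 hc hd hcd)
  refine ⟨edgeSum K (fun t => if t = {a, b, c} ∨ t = {a, b, d} then 0 else g t) a a, ?_, ?_⟩
  · rw [edgeSum_split (fun t => t = {a, b, c} ∨ t = {a, b, d}) g,
      edgeSum_filter_eq hD.finite (A := {{a, b, c}, {a, b, d}}), Finset.sum_pair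
        (triangle_ne_of_apex_ne h₁ hcd)]
    · simp
    · intro t
      simp only [Finset.mem_insert, Finset.mem_singleton]
      constructor
      · rintro (rfl | rfl)
        · exact ⟨h₁, .inl rfl⟩
        · exact ⟨h₂, .inr rfl⟩
      · exact And.right
  · have h₃₄ : ({a, c, d} : Finset V) ≠ {b, c, d} := by
      intro e
      have : a ∈ ({b, c, d} : Finset V) := e ▸ (by simp)
      simp [hab, hac, had] at this
    rw [edgeSum_replace hD.finite hD'.finite (M := fun t => t = {a, b, c} ∨ t = {a, b, d})
      (A := {{a, c, d}, {b, c, d}}), Finset.sum_pair h₃₄]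
    · simp [hab, hac, had]
    · intro t ht
      simp only [Finset.mem_insert, Finset.mem_singleton] at ht
      rcases ht with rfl | rfl <;> exact hnT _ (by simp) (by simp)
    · intro t
      rw [htri t]
      simp only [Finset.mem_insert, Finset.mem_singleton, not_or]

end AngleSum

/-! ### Nonpositive curvature -/

section Curvature

variable {V : Type u} {W : Type w} {X : MetricComplex W} {q : W}
  {C : (graph X.complex).Walk q q} {K : PreAbstractSimplicialComplex V} {f : V → W}

/-- No edge of the boundary walk ends at an interior vertex, and the flip keeps the edges of the
walk. Hence every edge at `a` still lies in two triangles, and star rigidity applies to the set of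
all triangles at `a`. -/
theorem isInterior_flip {a b c d : V} {p : V} {w : (graph K).Walk p p} (hD : IsDisc K w)
    (h₁ : ({a, b, c} : Finset V) ∈ triangles K) (h₂ : ({a, b, d} : Finset V) ∈ triangles K)
    (hcd : c ≠ d) (hncd : ¬ (graph K).Adj c d) (hrigid : StarRigid (flipComplex K h₁ h₂))
    (ha : IsInterior K a) : IsInterior (flipComplex K h₁ h₂) a := by
  obtain ⟨⟨w', he, -, hD'⟩, htri, -⟩ := hD.flip h₁ h₂ hcd hncd
  refine (hrigid a {t | t ∈ triangles (flipComplex K h₁ h₂) ∧ a ∈ t} (fun t ht => ht.1)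
    ⟨{a, c, d}, (htri _).2 (.inr (.inl rfl)), by simp⟩ (fun t ht => ht.2) ?_).1
  rintro s ⟨hs, has⟩ y hy hya
  have hay : (graph (flipComplex K h₁ h₂)).Adj a y := adj_of_face hs.1 has hy hya.symm
  have h1 := hD'.count hay
  have h2 : w'.edges.count s(a, y) = 0 := by
    rw [he, List.count_eq_zero]
    intro h
    have hadj : (graph K).Adj a y := w.adj_of_mem_edges h
    have h3 := hD.count hadj
    have h4 := ha.edgeSum_eq_two hD.finite hadj
    have h5 := List.count_pos_iff.2 h
    omega
  rw [h2, zero_add, edgeSum, Finset.sum_const, smul_eq_mul, mul_one] at h1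
  obtain ⟨t, ht, hts⟩ := Finset.exists_mem_ne (by rw [h1]; norm_num) s
  rw [Finset.mem_filter, mem_triF hD'.finite] at ht
  exact ⟨t, ⟨ht.1, ht.2.1⟩, hts, ht.2.2⟩

theorem map_adj (hG : Diagram.IsDiscDiagram ⟨K, f⟩ X.complex C)
    (hn : Diagram.IsNondegenerate (⟨K, f⟩ : Diagram V W)) {x y : V} (h : (graph K).Adj x y) :
    (graph X.complex).Adj (f x) (f y) := by
  refine ⟨fun e => h.1 (hn _ h.2 (by simp) (by simp) e), ?_⟩
  simpa [Finset.image_insert] using hG.simplicial _ h.2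

theorem ne_of_isReduced (hr : Diagram.IsReduced (⟨K, f⟩ : Diagram V W)) {a b c d : V}
    (h₁ : ({a, b, c} : Finset V) ∈ triangles K) (h₂ : ({a, b, d} : Finset V) ∈ triangles K)
    (hcd : c ≠ d) : f c ≠ f d := by
  intro e
  obtain ⟨hab, hac, hbc⟩ := ne_of_triangle h₁
  refine hr _ h₁ _ h₂ (triangle_ne_of_apex_ne h₁ hcd) ?_ ?_
  · have : ({a, b, c} : Finset V) ∩ {a, b, d} = {a, b} := by
      ext x
      simp only [Finset.mem_inter, Finset.mem_insert, Finset.mem_singleton]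
      constructor
      · rintro ⟨rfl | rfl | rfl, h⟩
        · exact .inl rfl
        · exact .inr rfl
        · rcases h with h | h | h
          · exact .inl h
          · exact .inr h
          · exact absurd h hcd
      · tauto
    rw [this, Finset.card_pair hab]
  · change Finset.image f _ = Finset.image f _
    simp [Finset.image_insert, e]

/-- An interior vertex with too small an angle admits a D-move, unless the diagram can be improved
otherwise. -/
theorem exists_dMove (hX : ∀ a ∈ vertices X.complex, X.IsLinkLarge a)
    (hG : Diagram.IsDiscDiagram ⟨K, f⟩ X.complex C)
    (hn : Diagram.IsNondegenerate (⟨K, f⟩ : Diagram V W))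
    (hr : Diagram.IsReduced (⟨K, f⟩ : Diagram V W)) {a : V} (ha : IsInterior K a)
    (hsum : edgeSum K (angleAt X f a) a a < 2 * Real.pi) :
    ∃ b c d, ({a, b, c} : Finset V) ∈ triangles K ∧ ({a, b, d} : Finset V) ∈ triangles K ∧
      c ≠ d ∧ (graph X.complex).Adj (f c) (f d) := by
  obtain ⟨k, c, hc⟩ := ha
  rw [hc.edgeSum_angleAt X f hG.singularDisc.finite] at hsum
  have hadj : ∀ i, (graph K).Adj a (c i) := fun i =>
    adj_of_face (hc.triangle_mem i).1 (by simp) (by simp) (hc.ne i).symm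
  have h1 : ∀ i, ({a, c (finRotate k i), c i} : Finset V) ∈ triangles K := by
    intro i
    rw [Finset.pair_comm]
    exact hc.triangle_mem i
  have h2 : ∀ i, c i ≠ c (finRotate k (finRotate k i)) := fun i =>
    hc.injective.ne (finRotate_finRotate_ne hc.three_le i).symm
  obtain ⟨i, hi⟩ := (hX (f a) (mem_vertices_of_adj (map_adj hG hn
      (hadj ⟨0, by have := hc.three_le; omega⟩)))).exists_adj_finRotate
    (by have := hc.three_le; omega) (fun i => f (c i)) (fun i => map_adj hG hn (hadj i))
    (fun i => map_adj hG hn (adj_of_face (hc.triangle_mem i).1 (by simp) (by simp)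
      (ne_of_triangle (hc.triangle_mem i)).2.2))
    (fun i => ne_of_isReduced hr (h1 i) (hc.triangle_mem _) (h2 i)) hsum
  exact ⟨_, _, _, h1 i, hc.triangle_mem _, h2 i, hi⟩

/-- Induction on the number of triangles at `a`. As long as no other improvement is available, a
D-move at `a` lowers this number by one, does not increase the angle sum, and keeps the area and the
interior vertex `a`. This cannot go on, since an interior vertex lies in at least three triangles.
-/
theorem exists_improves_of_angle_lt (hX : ∀ a ∈ vertices X.complex, X.IsLinkLarge a)
    (n : ℕ) (K : PreAbstractSimplicialComplex V) (hG : Diagram.IsDiscDiagram ⟨K, f⟩ X.complex C)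
    {a : V} (ha : IsInterior K a) (hsum : edgeSum K (angleAt X f a) a a < 2 * Real.pi)
    (hcard : edgeSum K (fun _ => 1) a a = n) : ∃ K', Improves C f K K' := by
  induction n generalizing K with
  | zero =>
    obtain ⟨k, c, hc⟩ := ha
    rw [hc.edgeSum_self hG.singularDisc.finite] at hcard
    have := hc.three_le
    simp at hcard
    omega
  | succ n ih =>
    by_cases hE : HasEmptyTriangle K
    · exact exists_improves_of_hasEmptyTriangle X.flag hG hE
    by_cases hn : Diagram.IsNondegenerate (⟨K, f⟩ : Diagram V W)
    swap
    · exact exists_improves_of_not_isNondegenerate X.flag hG hn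
    by_cases hr : Diagram.IsReduced (⟨K, f⟩ : Diagram V W)
    swap
    · exact exists_improves_of_not_isReduced X.flag hG hr
    obtain ⟨b, c, d, h₁, h₂, hcd, hadj⟩ := exists_dMove hX hG hn hr ha hsum
    obtain ⟨p, w, hw, -⟩ := hG.boundary
    have hD : IsDisc K w := hG.singularDisc.isDisc hw
    have hncd := not_adj_apex hD.finite hD.noCycle hE h₁ h₂ hcd
    have hG' := isDiscDiagram_flip X.flag hG h₁ h₂ hcd hncd hadj.2
    have hstep : MoveStep C f K (flipComplex K h₁ h₂) :=
      ⟨.inr (.inr (.inr ⟨a, b, hE, ha, c, d, hcd, h₁, h₂, hadj, rfl, fun _ _ => rfl⟩)), hG',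
        (vertices_flipComplex h₁ h₂).subset⟩
    obtain ⟨hab, hac, hbc⟩ := ne_of_triangle h₁
    obtain ⟨-, had, hbd⟩ := ne_of_triangle h₂
    have ha' := isInterior_flip hD h₁ h₂ hcd hncd hG'.singularDisc.starRigid ha
    obtain ⟨r, hr1, hr2⟩ := edgeSum_flip_self hD h₁ h₂ hcd hncd (angleAt X f a)
    obtain ⟨m, hm1, hm2⟩ := edgeSum_flip_self hD h₁ h₂ hcd hncd (fun _ => 1)
    rw [angleAt_triangle X f hab hac hbc, angleAt_triangle X f hab had hbd,
      X.angle_comm _ (f b) (f c)] at hr1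
    rw [angleAt_triangle X f hac had hcd] at hr2
    have hmap : ∀ {t : Finset V} {x y : V}, t ∈ triangles K → x ∈ t → y ∈ t → x ≠ y →
        (graph X.complex).Adj (f x) (f y) := fun ht hx hy hxy =>
      map_adj hG hn (adj_of_face ht.1 hx hy hxy)
    have hle := MetricComplex.angle_triangle (hmap h₁ (x := a) (y := c) (by simp) (by simp) hac)
      (hmap h₁ (x := a) (y := b) (by simp) (by simp) hab)
      (hmap h₂ (x := a) (y := d) (by simp) (by simp) had)
      (hmap h₁ (x := c) (y := b) (by simp) (by simp) hbc.symm)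
      (hmap h₂ (x := b) (y := d) (by simp) (by simp) hbd) hadj
    obtain ⟨K', h⟩ := ih (flipComplex K h₁ h₂) hG' ha' (by linarith) (by omega)
    exact ⟨K', hstep.improves_trans (hD.flip h₁ h₂ hcd hncd).2.2 h⟩

theorem exists_improves (hX : ∀ a ∈ vertices X.complex, X.IsLinkLarge a)
    (hG : Diagram.IsDiscDiagram ⟨K, f⟩ X.complex C)
    (h : ¬ (Diagram.IsNondegenerate (⟨K, f⟩ : Diagram V W) ∧
      Diagram.IsReduced (⟨K, f⟩ : Diagram V W) ∧ Diagram.IsCAT0 (⟨K, f⟩ : Diagram V W) X)) :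
    ∃ K', Improves C f K K' := by
  by_cases hn : Diagram.IsNondegenerate (⟨K, f⟩ : Diagram V W)
  swap
  · exact exists_improves_of_not_isNondegenerate X.flag hG hn
  by_cases hr : Diagram.IsReduced (⟨K, f⟩ : Diagram V W)
  swap
  · exact exists_improves_of_not_isReduced X.flag hG hr
  have hc : ¬ Diagram.IsCAT0 (⟨K, f⟩ : Diagram V W) X := fun hc => h ⟨hn, hr, hc⟩
  simp only [Diagram.IsCAT0, not_forall, not_le] at hc
  obtain ⟨a, k, c, hl, hlt⟩ := hc
  refine exists_improves_of_angle_lt hX _ K hG ⟨k, c, hl⟩ ?_ rfl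
  rw [hl.edgeSum_angleAt X f hG.singularDisc.finite]
  exact hlt

/-- Strong induction on the area, which each improvement lowers. -/
theorem exists_reflTransGen_moveStep (hX : ∀ a ∈ vertices X.complex, X.IsLinkLarge a)
    (hG : Diagram.IsDiscDiagram ⟨K, f⟩ X.complex C) :
    ∃ K', Relation.ReflTransGen (MoveStep C f) K K' ∧
      Diagram.IsDiscDiagram ⟨K', f⟩ X.complex C ∧
      (Diagram.IsNondegenerate (⟨K', f⟩ : Diagram V W) ∧
        Diagram.IsReduced (⟨K', f⟩ : Diagram V W) ∧ Diagram.IsCAT0 (⟨K', f⟩ : Diagram V W) X) ∧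
      (triangles K').ncard ≤ (triangles K).ncard := by
  induction h : (triangles K).ncard using Nat.strong_induction_on generalizing K with
  | _ n ih =>
    by_cases hgood : Diagram.IsNondegenerate (⟨K, f⟩ : Diagram V W) ∧
      Diagram.IsReduced (⟨K, f⟩ : Diagram V W) ∧ Diagram.IsCAT0 (⟨K, f⟩ : Diagram V W) X
    · exact ⟨K, .refl, hG, hgood, h.le⟩
    · obtain ⟨K₁, hK₁, hG₁, hlt⟩ := exists_improves hX hG hgood
      obtain ⟨K', hK', hG', hgood', hle⟩ := ih _ (h ▸ hlt) hG₁ rfl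
      exact ⟨K', hK₁.trans hK', hG', hgood', by omega⟩

end Curvature

end MetricSystolic

end

theorem theorem2p5 {V : Type*} {W : Type*} (X : MetricSystolic.MetricComplex W)
    (hX : X.IsMetricallySystolic) {q : W} (C : (MetricSystolic.graph X.complex).Walk q q)
    (G : MetricSystolic.Diagram V W) (hG : G.IsDiscDiagram X.complex C) :
    (∃ G' : MetricSystolic.Diagram V W,
      MetricSystolic.Diagram.MovesTo X.complex C G G' ∧
      G'.IsDiscDiagram X.complex C ∧ G'.IsNondegenerate ∧ G'.IsReduced ∧ G'.IsCAT0 X ∧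
      (∃ i : V → V,
        Set.MapsTo i (MetricSystolic.vertices G'.complex) (MetricSystolic.vertices G.complex) ∧
        Set.InjOn i (MetricSystolic.vertices G'.complex) ∧
        ∀ x ∈ MetricSystolic.vertices G'.complex, G'.map x = G.map (i x)) ∧
      G'.area ≤ G.area) ∧
    (∀ M : MetricSystolic.Diagram V W, M.IsMinimal X.complex C →
      M.IsNondegenerate ∧ M.IsReduced ∧ M.IsCAT0 X) := by
  constructor
  · obtain ⟨K', hK', hG', ⟨h1, h2, h3⟩, hle⟩ :=
      MetricSystolic.exists_reflTransGen_moveStep (K := G.complex) (f := G.map) hX.large hG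
    -- All the moves keep the map and produce no new vertices, so the identity serves as the
    -- injection of vertices.
    refine ⟨⟨K', G.map⟩, ?_, hG', h1, h2, h3,
      ⟨id, ?_, Set.injOn_id _, fun _ _ => rfl⟩, hle⟩
    · exact hK'.lift (p := fun H H' => MetricSystolic.Diagram.Move X.complex H H' ∧
        H'.IsDiscDiagram X.complex C) (fun K => (⟨K, G.map⟩ : MetricSystolic.Diagram V W))
        (fun _ _ h => ⟨h.1, h.2.1⟩)
    · exact MetricSystolic.vertices_subset_of_reflTransGen hK'
  · intro M hM
    by_contra h
    obtain ⟨K', -, hG', hlt⟩ :=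
      MetricSystolic.exists_improves (K := M.complex) (f := M.map) hX.large hM.1 h
    exact absurd (hM.2 V ⟨K', M.map⟩ hG') (not_le.2 hlt)
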